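/- **Setting.** Let $d\in\{1,2\}$. Fix a substitution on finitely many labelled prototiles $t_1,\dots,t_N\subset\mathbb R^d$ (closed topological discs carrying finite regular cell structures) with inflation factor $\lambda>1$: each $\omega(t_i)$ is a finite patch of translates of prototiles, forming a cell complex, that exactly subdivides $\lambda t_i$, inflated $k$-cells being unions of $k$-cells. Put $\omega(t_i+x)=\omega(t_i)+\lambda x$. Let $\Omega$ be the space of all tilings of $\mathbb R^d$ by translates of prototiles, forming a locally finite cell complex, each of whose finite patches is contained in a translate of some $\omega^n(t_j)$. Assume that $\omega$ maps $\Omega$ to $\Omega$, is primitive and injective on $\Omega$, and that $\Omega$ has finite local complexity. Fix $T\in\Omega$. For $X\subset\mathbb R^d$ let $T(X)$ be the set of tiles of $T$ meeting $X$, and let $\sigma^\circ$ be the open cell of a closed cell $\sigma$. *Stable cells.* Two $k$-cells $\sigma,\sigma'$ of $T$ are equivalent if for some $x\in\mathbb R^d$ both $\sigma'=\sigma+x$ and $T(\sigma'^\circ)=T(\sigma^\circ)+x$; the classes $[\sigma]$ are the stable $k$-cells, and $C_S^k$ is the free abelian group on them. In the same way every cell of $\omega(T)$ determines a stable cell of $T$.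 Give the stable edges orientations (hence all edges of $T$ and $\omega(T)$), and, if $d=2$, all faces the counterclockwise orientation. *Coboundary.* $\delta^0[v]=\sum_{e}\delta_{e,v}[e]$, over the edges $e$ of $T(v)$, with $\delta_{e,v}=-1,1,0$ if $v$ is the initial vertex, the final vertex, not a vertex of $e$; $\delta^1[e]=\sum_{f\in T(e^\circ)}\delta_{f,e}[f]$, with $\delta_{f,e}=1,-1,0$ if $e$ is in $\partial f$ with the same orientation, in $\partial f$ with the opposite orientation, not in $\partial f$. *Homotopy.* Let $T_1=\lambda^{-1}\omega(T)$ be the shrunk tiling, and assume given a homotopy $h_s$ ($0\le s\le1$) of $\mathbb R^d$ such that: $h_0=\mathrm{id}$; for $0<s<1$, $h_s$ is a homeomorphism mapping each cell of $T$ onto itself; $h_s$ is the same, up to translation, on any two tiles of $T$ that are translates of the same prototile; and for every tile $t$ of $T$: (i) $h_1:\lambda^{-1}\omega(t)\to t$ is cellular and surjective, and if the image of a shrunk edge contains an edge $e$ of $t$ then it equals $e$; (ii) exactly one shrunk tile is mapped onto $t$, homeomorphically on interiors; (iii) $h_1$ fixes the vertices of $t$, and, if $d=2$, for each edge $e$ of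 $t$ exactly one shrunk edge in $\partial t$ is mapped onto $e$, it lies in $e$ and is mapped homeomorphically on interiors; (iv) if $d=2$, for each edge $e$ of $t$: if the image of a shrunk tile $t''$ of $\lambda^{-1}\omega(t)$ contains $e$, then exactly two edges of $t''$ are mapped onto $e$ if $t''$ is not mapped onto $t$, and exactly one if it is; moreover $h_1^{-1}(e)\cap t$ is connected. *Connecting maps.* $W^k[\sigma]=\sum_\tau\delta_{\sigma,\tau}[\tau]$, over the $k$-cells $\tau$ of $\omega(T(\sigma^\circ))$ with $h_1(\lambda^{-1}\tau)=\sigma$; for $k=1$, $\delta_{\sigma,\tau}=1,-1$ if $h_1$ matches, reverses the orientations (and $0$ if it maps both ends of the shrunk edge to one vertex); otherwise $\delta_{\sigma,\tau}=1$. **Statement.** There are finitely many stable cells, $C_S^\bullet=(C_S^k,\delta^k)$ is a cochain complex, and $W^\bullet$ is a cochain map of it. Let $C^{ST}_\bullet$ be the transposed chain complex, with chain map $(W^\bullet)^t$. For an endomorphism $A$ of $X$ let $\varinjlim(X,A)$ be the direct limit of $X\xrightarrow{A}X\xrightarrow{A}\cdots$, and put $$H_S^k=\varinjlim(H^k(C_S^\bullet),H^k(W^\bullet)),\qquad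 H^{ST}_k=\varinjlim(H_k(C^{ST}_\bullet),H_k((W^\bullet)^t)),$$ $$H^{\text{S-tor}}_k=\varinjlim(\mathrm{Ext}^1_{\mathbb Z}(H^k(C_S^\bullet),\mathbb Z),\mathrm{Ext}^1_{\mathbb Z}(H^k(W^\bullet),\mathbb Z)),\qquad H^{\text{ST-torFree}}_k=\varinjlim(\mathrm{Hom}(H^k(C_S^\bullet),\mathbb Z),\mathrm{Hom}(H^k(W^\bullet),\mathbb Z)).$$ Then for all $k\ge 0$: 1. $H_k(C^{ST}_\bullet)\cong \mathrm{Ext}^1_{\mathbb Z}(H^{k+1}(C_S^\bullet),\mathbb Z)\oplus\mathrm{Hom}(H^k(C_S^\bullet),\mathbb Z)$ (non-canonically), and the torsion subgroup of $H_k(C^{ST}_\bullet)$ is isomorphic to the torsion subgroup of $H^{k+1}(C_S^\bullet)$ (torsion moves from level $k+1$ to level $k$). 2. $H^{\text{S-tor}}_k$ is a torsion group and $H^{\text{ST-torFree}}_k$ is torsion free. There is a short exact sequence $$0\to \mathrm{Ext}^1_{\mathbb Z}(H^{k+1}(C_S^\bullet),\mathbb Z)\to H_k(C^{ST}_\bullet)\to\mathrm{Hom}(H^k(C_S^\bullet),\mathbb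 Z)\to0,$$ whose second map is the evaluation of cycles on cocycles and which is compatible with the endomorphisms above, and it induces a short exact sequence $$0\to H^{\text{S-tor}}_{k+1}\to H^{ST}_k\to H^{\text{ST-torFree}}_k\to 0$$ of direct limits (which is not claimed to split). 3. If $d=1$, then all the groups $H^k(C_S^\bullet)$, $H_k(C^{ST}_\bullet)$, $H^k_S$, $H^{ST}_k$ are torsion free. 4. If $d=2$, then $H^0_S$ and $H^2_S\cong\mathbb Z$ are torsion free, and $H^{ST}_2\cong\mathbb Z$ and $H^{ST}_1$ are torsion free. Thus only $H^1_S$ and $H^{ST}_0$ can have torsion. -/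

import Mathlib

open scoped Pointwise

noncomputable section

namespace SubstTiling

/-! ## Cell complexes in Euclidean space -/

/-- The Euclidean space `ℝ^d`. -/
abbrev Eu (d : ℕ) : Type := EuclideanSpace ℝ (Fin d)

/-- The translate `σ + x`. -/
def tr {d : ℕ} (x : Eu d) (σ : Set (Eu d)) : Set (Eu d) := (fun y => y + x) '' σ

/-- For a family `K` of closed cells (`K k` is the set of closed `k`-cells), the union of all closed
cells of dimension `< k`, that is, the `(k-1)`-skeleton. -/
def skel {d : ℕ} (K : ℕ → Set (Set (Eu d))) (k : ℕ) : Set (Eu d) :=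
  {z | ∃ j < k, ∃ τ ∈ K j, z ∈ τ}

/-- The open cell of a closed `k`-cell: the cell without its lower-dimensional skeleton (a vertex is
its own open cell; the open cell of an edge is the edge without its vertices). -/
def openCell {d : ℕ} (K : ℕ → Set (Set (Eu d))) (k : ℕ) (σ : Set (Eu d)) : Set (Eu d) :=
  σ \ skel K k

/-- `K` is a (regular) cell complex in `ℝ^d`: every closed `k`-cell is homeomorphic to the closed unit
ball of `ℝ^k`, the open ball corresponding to the open cell; distinct cells have disjoint open cells;
the boundary of a cell is a union of lower-dimensional closed cells. -/
structure IsCellComplex {d : ℕ} (K : ℕ → Set (Set (Eu d))) : Prop where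
  disc : ∀ k, ∀ σ ∈ K k, ∃ φ : Metric.closedBall (0 : Eu k) 1 → Eu d,
    Continuous φ ∧ Function.Injective φ ∧ Set.range φ = σ ∧
      φ '' {z | ‖(z : Eu k)‖ < 1} = openCell K k σ
  disjoint : ∀ k, ∀ σ ∈ K k, ∀ τ ∈ K k, σ ≠ τ → Disjoint (openCell K k σ) (openCell K k τ)
  boundary : ∀ k, ∀ σ ∈ K k, ∀ z ∈ σ ∩ skel K k, ∃ j < k, ∃ τ ∈ K j, z ∈ τ ∧ τ ⊆ σ

/-! ## Substitutions, patches, tilings, and the tiling space -/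

/-- A substitution with inflation factor `lam > 1` on finitely many labelled prototiles of `ℝ^d`.
A tile is a pair `(i, x)`, standing for the translate by `x` of the prototile labelled `i`.
`face i k` is the set of closed `k`-cells of the `i`-th prototile, the prototile itself being its only
`d`-cell. `sub i` is the patch `ω(tᵢ)`, which subdivides the inflated prototile. -/
structure Substitution (d : ℕ) where
  ι : Type
  finite_labels : Finite ι
  proto : ι → Set (Eu d)
  face : ι → ℕ → Set (Set (Eu d))
  face_finite : ∀ i k, (face i k).Finite
  face_top : ∀ i, face i d = {proto i}
  face_above : ∀ i k, d < k → face i k = ∅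
  face_subset : ∀ i k, ∀ σ ∈ face i k, σ ⊆ proto i
  face_complex : ∀ i, IsCellComplex (face i)
  lam : ℝ
  one_lt_lam : 1 < lam
  sub : ι → Set (ι × Eu d)
  sub_finite : ∀ i, (sub i).Finite
  /-- distinct tiles of `ω(tᵢ)` occupy distinct regions -/
  sub_inj : ∀ i, Set.InjOn (fun t : ι × Eu d => tr t.2 (proto t.1)) (sub i)
  /-- `ω(tᵢ)` is a cell complex; in particular its tiles only meet along their boundaries -/
  sub_complex : ∀ i, IsCellComplex (fun k => {σ | ∃ t ∈ sub i, ∃ τ ∈ face t.1 k, σ = tr t.2 τ})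
  /-- the tiles of `ω(tᵢ)` cover exactly the inflated prototile -/
  sub_union : ∀ i, (⋃ t ∈ sub i, tr t.2 (proto t.1)) = lam • proto i
  /-- every inflated `k`-cell of a prototile is a union of `k`-cells of `ω(tᵢ)` -/
  sub_cells : ∀ i k, ∀ σ ∈ face i k,
    ∃ F ⊆ {σ' | ∃ t ∈ sub i, ∃ τ ∈ face t.1 k, σ' = tr t.2 τ}, lam • σ = ⋃₀ F

namespace Substitution

variable {d : ℕ} (S : Substitution d)

/-- Labelled tiles: translates of the prototiles. -/
abbrev Tile : Type := S.ι × Eu d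

/-- The region of `ℝ^d` covered by a tile. -/
def supp (t : S.Tile) : Set (Eu d) := tr t.2 (S.proto t.1)

/-- The translate `P + x` of a set of tiles. -/
def shift (x : Eu d) (P : Set S.Tile) : Set S.Tile := (fun t => (t.1, t.2 + x)) '' P

/-- The closed `k`-cells of a set of tiles. -/
def cells (P : Set S.Tile) (k : ℕ) : Set (Set (Eu d)) :=
  {σ | ∃ t ∈ P, ∃ τ ∈ S.face t.1 k, σ = tr t.2 τ}

/-- The open cell of a closed `k`-cell of a set of tiles. -/
def opn (P : Set S.Tile) (k : ℕ) (σ : Set (Eu d)) : Set (Eu d) := openCell (S.cells P) k σ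

/-- `T(X)`: the tiles of `T` containing at least one point of `X`. -/
def patchAt (T : Set S.Tile) (X : Set (Eu d)) : Set S.Tile := {t ∈ T | (S.supp t ∩ X).Nonempty}

/-- The substitution map `ω` on sets of tiles: `ω(tᵢ + x) = ω(tᵢ) + λx`, tile by tile. -/
def subst (P : Set S.Tile) : Set S.Tile := {u | ∃ t ∈ P, u ∈ S.shift (S.lam • t.2) (S.sub t.1)}

/-- A tiling: a set of tiles that covers `ℝ^d`, is locally finite, and whose cells form a cell complex
(so that distinct tiles only meet along their boundaries, cell to cell). -/
structure IsTiling (T : Set S.Tile) : Prop where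
  cover : (⋃ t ∈ T, S.supp t) = Set.univ
  inj : Set.InjOn S.supp T
  complex : IsCellComplex (S.cells T)
  locallyFinite : ∀ R : ℝ, (S.patchAt T (Metric.closedBall 0 R)).Finite

/-- The tiling space `Ω`: all tilings each of whose finite patches occurs, up to translation, in some
iterated substitution `ωⁿ(tⱼ)` of a prototile. -/
def hull : Set (Set S.Tile) :=
  {T | S.IsTiling T ∧ ∀ P ⊆ T, P.Finite →
    ∃ (n : ℕ) (j : S.ι) (x : Eu d), P ⊆ S.shift x (S.subst^[n] {(j, 0)})}

/-- Primitivity: for some `n > 0`, every `ωⁿ(tᵢ)` contains a translate of every prototile. -/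
def Primitive : Prop :=
  ∃ n > 0, ∀ i j : S.ι, ∃ x : Eu d, (j, x) ∈ S.subst^[n] {(i, (0 : Eu d))}

/-- Finite local complexity: for every radius `R` there are, up to translation, only finitely many
patches `T(B)` with `T ∈ Ω` and `B` a closed ball of radius `R`. -/
def FLC : Prop :=
  ∀ R : ℝ, ∃ F : Set (Set S.Tile), F.Finite ∧ ∀ T ∈ S.hull, ∀ c : Eu d,
    ∃ P ∈ F, ∃ x : Eu d, S.patchAt T (Metric.closedBall c R) = S.shift x P

/-! ## Stable cells -/

/-- The closed `k`-cells `σ` of `T` and `σ'` of `T'` agree up to a translation that also matches the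
patches `T(σ°)` and `T'(σ'°)`. -/
def StableEq (k : ℕ) (T : Set S.Tile) (σ : Set (Eu d)) (T' : Set S.Tile) (σ' : Set (Eu d)) : Prop :=
  ∃ x : Eu d, σ' = tr x σ ∧ S.patchAt T' (S.opn T' k σ') = S.shift x (S.patchAt T (S.opn T k σ))

/-- The closed `k`-cells of a tiling, as a type. -/
abbrev Cell (T : Set S.Tile) (k : ℕ) : Type := {σ : Set (Eu d) // σ ∈ S.cells T k}

theorem tr_zero (σ : Set (Eu d)) : tr 0 σ = σ := by simp [tr]

theorem tr_tr (x y : Eu d) (σ : Set (Eu d)) : tr y (tr x σ) = tr (x + y) σ := by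
  simp only [tr, Set.image_image, add_assoc]

theorem shift_zero (P : Set S.Tile) : S.shift 0 P = P := by simp [shift]

theorem shift_shift (x y : Eu d) (P : Set S.Tile) :
    S.shift y (S.shift x P) = S.shift (x + y) P := by
  simp [shift, Set.image_image, add_assoc]

/-- The equivalence relation `∼_{R₀}` on the `k`-cells of `T`. -/
def stableSetoid (T : Set S.Tile) (k : ℕ) : Setoid (S.Cell T k) where
  r σ τ := S.StableEq k T σ.1 T τ.1
  iseqv :=
    { refl := fun σ => ⟨0, (tr_zero σ.1).symm, (S.shift_zero _).symm⟩
      symm := by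
        rintro σ τ ⟨x, h1, h2⟩
        refine ⟨-x, ?_, ?_⟩
        · rw [h1, tr_tr, add_neg_cancel, tr_zero]
        · rw [h2, S.shift_shift, add_neg_cancel, S.shift_zero]
      trans := by
        rintro σ τ ρ ⟨x, h1, h2⟩ ⟨y, h3, h4⟩
        exact ⟨x + y, by rw [h3, h1, tr_tr], by rw [h4, h2, S.shift_shift]⟩ }

/-- The stable `k`-cells of `T`: the `R₀`-equivalence classes of `k`-cells. -/
def StableCell (T : Set S.Tile) (k : ℕ) : Type := Quotient (S.stableSetoid T k)

/-- A representative, in `T`, of a stable cell. -/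
def rep {T : Set S.Tile} {k : ℕ} (c : StableCell S T k) : Set (Eu d) :=
  (Quotient.out (s := S.stableSetoid T k) c).1

open Classical in
/-- The basis element of `ℤ^{stable k-cells of T}` given by a `k`-cell `τ` of a tiling `T'` of the
tiling space (below `T' = T` or `T' = ω(T)`; all tilings of `Ω` have the same stable cells, so that the
class exists, and it is unique). -/
def cls (T T' : Set S.Tile) (k : ℕ) (τ : Set (Eu d)) : StableCell S T k →₀ ℤ :=
  if h : ∃ σ : S.Cell T k, S.StableEq k T σ.1 T' τ then
    Finsupp.single (Quotient.mk (S.stableSetoid T k) h.choose) 1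
  else 0

/-! ## Orientations and the coboundary maps -/

/-- An orientation of the stable edges: for every edge `e` of a tiling `T ∈ Ω` its initial vertex
`src T e` and its final vertex `tgt T e`, compatibly with the translations that identify stable
edges. -/
structure Orientation where
  src : Set S.Tile → Set (Eu d) → Eu d
  tgt : Set S.Tile → Set (Eu d) → Eu d
  src_ne_tgt : ∀ T ∈ S.hull, ∀ e ∈ S.cells T 1, src T e ≠ tgt T e
  src_mem : ∀ T ∈ S.hull, ∀ e ∈ S.cells T 1, src T e ∈ e ∧ {src T e} ∈ S.cells T 0
  tgt_mem : ∀ T ∈ S.hull, ∀ e ∈ S.cells T 1, tgt T e ∈ e ∧ {tgt T e} ∈ S.cells T 0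
  equivariant : ∀ T ∈ S.hull, ∀ T' ∈ S.hull, ∀ e ∈ S.cells T 1, ∀ x : Eu d,
    tr x e ∈ S.cells T' 1 →
    S.patchAt T' (S.opn T' 1 (tr x e)) = S.shift x (S.patchAt T (S.opn T 1 e)) →
    src T' (tr x e) = src T e + x ∧ tgt T' (tr x e) = tgt T e + x

end Substitution

/-- The point of `ℂ` with real and imaginary part the first two coordinates. -/
def planar {d : ℕ} (x : Eu d) : ℂ :=
  if h : 2 ≤ d then ⟨x ⟨0, by omega⟩, x ⟨1, by omega⟩⟩ else 0

/-- The 1-periodic curve `γ` winds exactly once around `p`, counterclockwise (`L` is a continuous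
logarithm of `γ - p`, which grows by `2πi` over a period). -/
def WindsOnce {d : ℕ} (γ : ℝ → Eu d) (p : Eu d) : Prop :=
  ∃ L : ℝ → ℂ, Continuous L ∧
    ∀ t, planar (γ t) - planar p = Complex.exp (L t) ∧ L (t + 1) = L t + 2 * Real.pi * Complex.I

/-- The arc `e` is part of the boundary of the planar disc `f`, and is traversed from `a` to `b` when
the boundary of `f` is traversed counterclockwise. -/
def Counterclockwise {d : ℕ} (f e : Set (Eu d)) (a b : Eu d) : Prop :=
  ∃ γ : ℝ → Eu d, Continuous γ ∧ (∀ t, γ (t + 1) = γ t) ∧ Set.InjOn γ (Set.Ico 0 1) ∧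
    Set.range γ = frontier f ∧ (∀ p ∈ interior f, WindsOnce γ p) ∧
    ∃ s t : ℝ, s < t ∧ t < s + 1 ∧ γ '' Set.Icc s t = e ∧ γ s = a ∧ γ t = b

namespace Substitution

variable {d : ℕ} (S : Substitution d)

open Classical in
/-- The incidence number of a `(k+1)`-cell `τ` and a `k`-cell `σ` of `T`. For `k = 0` it is
`δ_{e,v}`, equal to `-1` or `1` when `v` is the initial or final vertex of the edge `e`, and `0`
otherwise; for `k = 1` it is `δ_{f,e}`, equal to `1` or `-1` when the orientation of the edge `e` agrees
or disagrees with the counterclockwise orientation of the boundary of the face `f`, and `0` if `e` is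
not in that boundary. -/
def inc (o : S.Orientation) (T : Set S.Tile) (k : ℕ) (τ σ : Set (Eu d)) : ℤ :=
  match k with
  | 0 => if σ = {o.src T τ} then -1 else if σ = {o.tgt T τ} then 1 else 0
  | 1 => if Counterclockwise τ σ (o.src T σ) (o.tgt T σ) then 1
         else if Counterclockwise τ σ (o.tgt T σ) (o.src T σ) then -1 else 0
  | _ => 0

/-- The coboundary map `δ^k[σ] = ∑ δ_{τ,σ} [τ]`, the sum being over the `(k+1)`-cells `τ` of the patch
`T(σ°)`. -/
def delta (o : S.Orientation) (T : Set S.Tile) (k : ℕ) :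
    (StableCell S T k →₀ ℤ) →ₗ[ℤ] (StableCell S T (k + 1) →₀ ℤ) :=
  Finsupp.linearCombination ℤ fun c =>
    ∑ᶠ τ : S.Cell (S.patchAt T (S.opn T k (S.rep c))) (k + 1),
      inc S o T k τ.1 (S.rep c) • S.cls T T (k + 1) τ.1

/-! ## The homotopy and the connecting maps -/

/-- `f` restricts to a homeomorphism from `A` onto `B`. -/
def HomeoOn (f : Eu d → Eu d) (A B : Set (Eu d)) : Prop :=
  ContinuousOn f A ∧ Set.BijOn f A B ∧ ∃ g : Eu d → Eu d, ContinuousOn g B ∧ Set.LeftInvOn g f A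

/-- The homotopy `h_s`, `0 ≤ s ≤ 1`, of `ℝ^d`, adapted to the tiling `T = T₀`; the tiling `T₁` has as
cells the sets `λ⁻¹σ'`, where `σ'` is a cell of `ω(T)`. -/
structure Homotopy (T : Set S.Tile) where
  h : ℝ → Eu d → Eu d
  continuous : ContinuousOn (Function.uncurry h) (Set.Icc 0 1 ×ˢ Set.univ)
  zero : h 0 = id
  /-- for `0 < s < 1` the map `h_s` is a homeomorphism that maps every cell of `T` to itself -/
  homeo : ∀ s ∈ Set.Ioo (0 : ℝ) 1, IsHomeomorph (h s)
  cell : ∀ s ∈ Set.Ioo (0 : ℝ) 1, ∀ k, ∀ σ ∈ S.cells T k, h s '' σ = σ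
  /-- `h₁ : λ⁻¹ω(t) → t` is surjective and cellular -/
  surj : ∀ t ∈ T, h 1 '' S.supp t = S.supp t
  cellular : ∀ t ∈ T, ∀ k, ∀ σ ∈ S.cells (S.subst {t}) k,
    h 1 '' (S.lam⁻¹ • σ) ⊆ skel (S.cells {t}) (k + 1)
  /-- a shrunk edge whose image contains an edge of the tile is mapped onto that edge -/
  edge : ∀ t ∈ T, ∀ e ∈ S.cells {t} 1, ∀ e' ∈ S.cells (S.subst {t}) 1,
    e ⊆ h 1 '' (S.lam⁻¹ • e') → h 1 '' (S.lam⁻¹ • e') = e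
  /-- exactly one shrunk tile is mapped onto the tile `t`, homeomorphically on the interiors -/
  tile : ∀ t ∈ T, ∃! t' : S.Tile, t' ∈ S.subst {t} ∧ h 1 '' (S.lam⁻¹ • S.supp t') = S.supp t
  tile_homeo : ∀ t ∈ T, ∀ t' ∈ S.subst {t}, h 1 '' (S.lam⁻¹ • S.supp t') = S.supp t →
    HomeoOn (h 1) (S.lam⁻¹ • S.opn (S.subst {t}) d (S.supp t')) (S.opn {t} d (S.supp t))
  /-- the vertices of the tiles are fixed -/
  vertex : ∀ t ∈ T, ∀ v : Eu d, {v} ∈ S.cells {t} 0 → h 1 v = v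
  /-- in the plane, for each edge `e` of the boundary of a tile exactly one shrunk edge of the
  boundary is mapped onto `e`; it lies in `e` and is mapped homeomorphically on the interiors -/
  boundary : d = 2 → ∀ t ∈ T, ∀ e ∈ S.cells {t} 1,
    ∃! e' : Set (Eu d), e' ∈ S.cells (S.subst {t}) 1 ∧
      S.lam⁻¹ • e' ⊆ skel (S.cells {t}) 2 ∧ h 1 '' (S.lam⁻¹ • e') = e
  boundary_homeo : d = 2 → ∀ t ∈ T, ∀ e ∈ S.cells {t} 1, ∀ e' ∈ S.cells (S.subst {t}) 1,
    S.lam⁻¹ • e' ⊆ skel (S.cells {t}) 2 → h 1 '' (S.lam⁻¹ • e') = e →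
    S.lam⁻¹ • e' ⊆ e ∧ HomeoOn (h 1) (S.lam⁻¹ • S.opn (S.subst {t}) 1 e') (S.opn {t} 1 e)
  /-- in the plane, a shrunk tile whose image contains an edge `e` of the tile `t` has exactly two
  edges mapped onto `e`, respectively exactly one if the shrunk tile is mapped onto `t` -/
  two_edges : d = 2 → ∀ t ∈ T, ∀ e ∈ S.cells {t} 1, ∀ t' ∈ S.subst {t},
    e ⊆ h 1 '' (S.lam⁻¹ • S.supp t') → h 1 '' (S.lam⁻¹ • S.supp t') ≠ S.supp t →
    {e' ∈ S.cells {t'} 1 | h 1 '' (S.lam⁻¹ • e') = e}.encard = 2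
  one_edge : d = 2 → ∀ t ∈ T, ∀ e ∈ S.cells {t} 1, ∀ t' ∈ S.subst {t},
    h 1 '' (S.lam⁻¹ • S.supp t') = S.supp t →
    {e' ∈ S.cells {t'} 1 | h 1 '' (S.lam⁻¹ • e') = e}.encard = 1
  connected : d = 2 → ∀ t ∈ T, ∀ e ∈ S.cells {t} 1, IsConnected (S.supp t ∩ h 1 ⁻¹' e)
  /-- on translates of the same prototile the homotopy is the same up to translation -/
  translate : ∀ s ∈ Set.Icc (0 : ℝ) 1, ∀ t ∈ T, ∀ x : Eu d, (t.1, t.2 + x) ∈ T →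
    ∀ z ∈ S.supp t, h s (z + x) = h s z + x

open Classical in
/-- The sign of a `k`-cell `τ` of `ω(T)` whose shrunk copy is mapped by `h₁` onto the `k`-cell `σ` of
`T`: for `k = 1` it is `δ_{σ,τ}`, which is `1` or `-1` according to whether `h₁` matches or reverses the
orientations (and `0` if `h₁` maps both ends of the shrunk edge to the same vertex); for vertices and for
the counterclockwise oriented faces it is `1`. -/
def sgn (o : S.Orientation) {T : Set S.Tile} (H : S.Homotopy T) (k : ℕ) (σ τ : Set (Eu d)) : ℤ :=
  if k = 1 then
    if H.h 1 (S.lam⁻¹ • o.src (S.subst T) τ) = o.src T σ ∧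
        H.h 1 (S.lam⁻¹ • o.tgt (S.subst T) τ) = o.tgt T σ then 1
    else if H.h 1 (S.lam⁻¹ • o.src (S.subst T) τ) = o.tgt T σ ∧
        H.h 1 (S.lam⁻¹ • o.tgt (S.subst T) τ) = o.src T σ then -1
    else 0
  else 1

/-- The connecting maps `W_V`, `W_E`, `W_F` (for `k = 0, 1, 2`): `W[σ] = ∑ δ_{σ,τ} [τ]`, the sum being
over the `k`-cells `τ` of `ω(T(σ°))` with `h₁(λ⁻¹τ) = σ`. -/
def W (o : S.Orientation) {T : Set S.Tile} (H : S.Homotopy T) (k : ℕ) :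
    (StableCell S T k →₀ ℤ) →ₗ[ℤ] (StableCell S T k →₀ ℤ) :=
  Finsupp.linearCombination ℤ fun c =>
    ∑ᶠ τ : {τ : Set (Eu d) // τ ∈ S.cells (S.subst (S.patchAt T (S.opn T k (S.rep c)))) k ∧
        H.h 1 '' (S.lam⁻¹ • τ) = S.rep c},
      S.sgn o H k (S.rep c) τ.1 • S.cls T (S.subst T) k τ.1

end Substitution

/-! ## Cohomology, transposed homology, and direct limits -/

/-- The subquotient `Z / (B ∩ Z)` of an abelian group; here always `B ⊆ Z`. -/
abbrev Subquotient {M : Type} [AddCommGroup M] (Z B : Submodule ℤ M) : Type :=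
  Z ⧸ B.submoduleOf Z

/-- The map of subquotients induced by `f`. -/
def Subquotient.map {M : Type} [AddCommGroup M] (Z B : Submodule ℤ M) (f : M →ₗ[ℤ] M)
    (hZ : ∀ z ∈ Z, f z ∈ Z) (hB : ∀ b ∈ B, f b ∈ B) : Subquotient Z B →+ Subquotient Z B :=
  (Submodule.mapQ (B.submoduleOf Z) (B.submoduleOf Z) (f.restrict hZ)
    (fun z hz => hB z.1 hz)).toAddMonoidHom

/-- The transpose `ℤ^Y → ℤ^X` of a homomorphism `ℤ^X → ℤ^Y` (`X`, `Y` finite): the entry at `x` of the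
image of `g` is `∑_y A_{y,x} g_y`. -/
def transpose {X Y : Type} (A : (X →₀ ℤ) →ₗ[ℤ] (Y →₀ ℤ)) : (Y → ℤ) →ₗ[ℤ] (X → ℤ) :=
  LinearMap.pi fun x => (A (Finsupp.single x 1)).sum fun y a => a • LinearMap.proj y

section Complex

variable {X : ℕ → Type} (δ : ∀ k, (X k →₀ ℤ) →ₗ[ℤ] (X (k + 1) →₀ ℤ))
  (f : ∀ k, (X k →₀ ℤ) →ₗ[ℤ] (X k →₀ ℤ))

/-- `f` commutes with the differentials. -/
def IsCochainMap : Prop := ∀ k, f (k + 1) ∘ₗ δ k = δ k ∘ₗ f k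

/-- The image of the differential ending in degree `k`. -/
def coboundaries : ∀ k, Submodule ℤ (X k →₀ ℤ)
  | 0 => ⊥
  | k + 1 => LinearMap.range (δ k)

/-- `H^k(C) = ker δ^k / Im δ^{k-1}`. -/
abbrev Coh (k : ℕ) : Type := Subquotient (LinearMap.ker (δ k)) (coboundaries δ k)

/-- The kernel of the transposed differential starting in degree `k`. -/
def cycles : ∀ k, Submodule ℤ (X k → ℤ)
  | 0 => ⊤
  | k + 1 => LinearMap.ker (transpose (δ k))

/-- The homology `H_k(C^t) = ker (δ^{k-1})^t / Im (δ^k)^t` of the transposed complex. -/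
abbrev Hml (k : ℕ) : Type := Subquotient (cycles δ k) (LinearMap.range (transpose (δ k)))

theorem transpose_apply {X Y : Type} (A : (X →₀ ℤ) →ₗ[ℤ] (Y →₀ ℤ)) (g : Y → ℤ) (x : X) :
    transpose A g x = (A (Finsupp.single x 1)).sum fun y a => a * g y := by
  simp [transpose, Finsupp.sum, LinearMap.sum_apply]

theorem pairing_transpose {X Y : Type} (A : (X →₀ ℤ) →ₗ[ℤ] (Y →₀ ℤ)) (g : Y → ℤ) (z : X →₀ ℤ) :
    Finsupp.linearCombination ℤ (transpose A g) z = Finsupp.linearCombination ℤ g (A z) := by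
  induction z using Finsupp.induction_linear with
  | zero => simp
  | add a b ha hb => simp only [map_add, ha, hb]
  | single x n =>
    have h : Finsupp.single x n = n • (Finsupp.single x (1 : ℤ)) := by simp
    rw [h, map_smul, map_smul, map_smul, Finsupp.linearCombination_single, transpose_apply,
      Finsupp.linearCombination_apply]
    simp

theorem transpose_comp {X Y Z : Type} (B : (Y →₀ ℤ) →ₗ[ℤ] (Z →₀ ℤ))
    (A : (X →₀ ℤ) →ₗ[ℤ] (Y →₀ ℤ)) : transpose (B ∘ₗ A) = transpose A ∘ₗ transpose B := by
  ext g x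
  have h1 := pairing_transpose (B ∘ₗ A) g (Finsupp.single x 1)
  have h2 := pairing_transpose A (transpose B g) (Finsupp.single x 1)
  have h3 := pairing_transpose B g (A (Finsupp.single x 1))
  simp only [Finsupp.linearCombination_single, one_smul, LinearMap.comp_apply] at h1 h2 h3 ⊢
  rw [h1, h2, h3]

variable {δ f}

/-- `H^k(f)`. -/
def cohMap (hf : IsCochainMap δ f) (k : ℕ) : AddMonoid.End (Coh δ k) :=
  Subquotient.map _ _ (f k)
    (by
      intro z hz
      have h := LinearMap.congr_fun (hf k) z
      simp only [LinearMap.comp_apply, LinearMap.mem_ker] at h hz ⊢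
      rw [← h, hz, map_zero])
    (by
      cases k with
      | zero =>
        intro b hb
        simp only [coboundaries, Submodule.mem_bot] at hb ⊢
        rw [hb, map_zero]
      | succ k =>
        rintro _ ⟨y, rfl⟩
        exact ⟨f k y, (LinearMap.congr_fun (hf k) y).symm⟩)

/-- `H_k(f^t)`. -/
def hmlMap (hf : IsCochainMap δ f) (k : ℕ) : AddMonoid.End (Hml δ k) :=
  Subquotient.map _ _ (transpose (f k))
    (by
      cases k with
      | zero => intro z _; exact Submodule.mem_top
      | succ k =>
        intro z hz
        have h := congrArg transpose (hf k)
        rw [transpose_comp, transpose_comp] at h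
        have h' := LinearMap.congr_fun h z
        simp only [cycles, LinearMap.comp_apply, LinearMap.mem_ker] at h' hz ⊢
        rw [h', hz, map_zero])
    (by
      rintro _ ⟨y, rfl⟩
      have h := congrArg transpose (hf k)
      rw [transpose_comp, transpose_comp] at h
      exact ⟨transpose (f (k + 1)) y, LinearMap.congr_fun h y⟩)

end Complex

/-- The abelian group `Ext¹_ℤ(M, ℤ)`. -/
abbrev Ext1 (M : Type) [AddCommGroup M] : Type :=
  CategoryTheory.Abelian.Ext (ModuleCat.of ℤ M) (ModuleCat.of ℤ ℤ) 1

/-- `Ext¹_ℤ(A, ℤ)`, for an endomorphism `A` of `M`. -/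
def ext1Map {M : Type} [AddCommGroup M] (A : AddMonoid.End M) : AddMonoid.End (Ext1 M) :=
  (CategoryTheory.Abelian.Ext.mk₀ (ModuleCat.ofHom (AddMonoidHom.toIntLinearMap A))).precomp
    (ModuleCat.of ℤ ℤ) (zero_add 1)

/-- `Hom(A, ℤ)`, for an endomorphism `A` of `M`. -/
def homMap {M : Type} [AddCommGroup M] (A : AddMonoid.End M) : AddMonoid.End (M →+ ℤ) :=
  AddMonoidHom.compHom' A

/-- The direct limit of `G → G → G → ⋯`, all maps being the endomorphism `A`. -/
def Lim {G : Type} [AddCommGroup G] (A : AddMonoid.End G) : Type :=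
  AddCommGroup.DirectLimit (fun _ : ℕ => G) (fun i j _ => (A ^ (j - i) : AddMonoid.End G))

instance Lim.instAddCommGroup {G : Type} [AddCommGroup G] (A : AddMonoid.End G) :
    AddCommGroup (Lim A) :=
  AddCommGroup.DirectLimit.addCommGroup (fun _ : ℕ => G)
    (fun i j _ => (A ^ (j - i) : AddMonoid.End G))

/-- The canonical map from the `n`-th copy of `G` to the direct limit. -/
def Lim.of {G : Type} [AddCommGroup G] (A : AddMonoid.End G) (n : ℕ) : G →+ Lim A :=
  AddCommGroup.DirectLimit.of (fun _ : ℕ => G)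
    (fun i j _ => (A ^ (j - i) : AddMonoid.End G)) n

end SubstTiling

end

namespace SubstTiling

/-! ## Continuous logarithms and winding numbers -/

/-! The transposed complex is the integral dual of C_S, a complex of finitely generated free groups,
so the algebraic half is the universal coefficient theorem, natural for `W`. Put B = im δ^k and Z =
ker δ^{k+1}. As Z is free, the presentation 0 → B → Z → H^{k+1} → 0 exhibits Ext¹(H^{k+1}, ℤ) as
Hom(B, ℤ) modulo restrictions of forms on Z (`exists_connecting`). A form g on B gives the cycle g ∘
δ^k. These are exactly the cycles that vanish on cocycles, and g ∘ δ^k is a boundary iff g extends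
to Z, because Z is a direct summand of the cochains. This is the short exact sequence
(`exists_sequence`), and sequential limits keep it exact (`Lim.exists_exact`). Ext¹ of a finitely
generated group is finite and isomorphic to its torsion subgroup, while groups Hom(-, ℤ) are torsion
free. Hence all torsion of H_k comes from H^{k+1}, and it remains to see that H^0 and the top
cohomology are torsion free. H^0 is a subgroup of a free group.

For the top degree, two tiles that share an edge run through it in opposite directions
(`IsTiling.ends_ne`), so δ of an edge is, up to sign, the difference of its two tiles. Any two tiles
are joined by a chain of adjacent ones, so the coboundaries are exactly the kernel of the sum of
coefficients. On the line the same holds for a sum with signs. Exactly one shrunk tile is mapped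
onto each tile, so `W` preserves this sum, and in the plane H² is ℤ with `W` acting as the identity.

That `W` is a cochain map is a count of degrees. The boundary loop of a shrunk tile u inside t is
mapped by h₁ into the boundary loop of t, and lifts to a function b on the parameter line. The
signed number of edges of u mapped onto an edge e counts the passages of b through an interior
parameter of e, and so equals the degree b(x+1) - b(x) of the loop. This degree is 1 if u is mapped
onto t, since h_s joins h₁ to the identity through homeomorphisms, and 0 otherwise, since the image
of the disc u then misses an interior point of t. Both facts, and the meaning of the
counterclockwise orientation, rest on winding numbers, obtained here from continuous logarithms.

Finally, primitivity makes every finite patch of one tiling of Ω recur in every other, so cells of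
ω(T) do define stable cells of T. Finite local complexity makes the stable cells finite in number.
-/

/-- The exponential covers the punctured plane, and a nonempty convex set is contractible and
locally path connected, so maps from it lift. -/
theorem exists_log {E : Type*} [NormedAddCommGroup E] [NormedSpace ℝ E] {s : Set E}
    (hs : Convex ℝ s) {g : E → ℂ} (hg : ContinuousOn g s) (h0 : ∀ x ∈ s, g x ≠ 0) :
    ∃ L : E → ℂ, ContinuousOn L s ∧ ∀ x ∈ s, Complex.exp (L x) = g x := by
  classical
  rcases s.eq_empty_or_nonempty with rfl | ⟨x₀, hx₀⟩
  · exact ⟨0, by simp, by simp⟩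
  have : ContractibleSpace s := hs.contractibleSpace ⟨x₀, hx₀⟩
  have : LocallyPathConnectedSpace s := hs.locallyPathConnectedSpace
  obtain ⟨f, ⟨-, hf⟩, -⟩ := Complex.isCoveringMapOn_exp.existsUnique_continuousMap_lifts
    ⟨s.domRestrict g, continuousOn_iff_continuous_domRestrict.mp hg⟩ (a₀ := ⟨x₀, hx₀⟩)
    (Complex.exp_log (h0 x₀ hx₀)) (fun x => h0 x x.2)
  refine ⟨fun z => if hz : z ∈ s then f ⟨z, hz⟩ else 0, ?_, fun x hx => ?_⟩
  · rw [continuousOn_iff_continuous_domRestrict]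
    convert! map_continuous f
    ext z
    simp
  · simpa [hx] using congrFun hf ⟨x, hx⟩

/-- The difference divided by 2πi is continuous and takes integer values on a preconnected set. -/
theorem log_unique {X : Type*} [TopologicalSpace X] {s : Set X} (hs : IsPreconnected s)
    {L M : X → ℂ} (hL : ContinuousOn L s) (hM : ContinuousOn M s)
    (h : ∀ x ∈ s, Complex.exp (L x) = Complex.exp (M x)) :
    ∃ n : ℤ, ∀ x ∈ s, L x = M x + n * (2 * Real.pi * Complex.I) := by
  rcases s.eq_empty_or_nonempty with rfl | ⟨x₀, hx₀⟩
  · exact ⟨0, by simp⟩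
  have h' : ∀ x ∈ s, ∃ n : ℤ, L x = M x + n * (2 * Real.pi * Complex.I) := fun x hx =>
    Complex.exp_eq_exp_iff_exists_int.1 (h x hx)
  obtain ⟨n, hn⟩ := h' x₀ hx₀
  refine ⟨n, fun x hx => ?_⟩
  have hpi : (2 * Real.pi * Complex.I : ℂ) ≠ 0 := by simp [Real.pi_ne_zero]
  have hdisc : IsDiscrete (Set.range ((↑) : ℤ → ℝ)) :=
    Int.isClosedEmbedding_coe_real.isInducing.isDiscrete_range
  have hc : ContinuousOn (fun x => ((L x - M x) / (2 * Real.pi * Complex.I)).re) s :=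
    Complex.continuous_re.comp_continuousOn ((hL.sub hM).div_const _)
  have hval : ∀ y ∈ s, ∀ m : ℤ, L y = M y + m * (2 * Real.pi * Complex.I) →
      ((L y - M y) / (2 * Real.pi * Complex.I)).re = m := by
    intro y _ m hm
    rw [hm, add_sub_cancel_left, mul_div_cancel_right₀ _ hpi]
    simp
  have := hs.constant_of_mapsTo hdisc hc
    (fun y hy => by
      obtain ⟨m, hm⟩ := h' y hy
      exact ⟨m, (hval y hy m hm).symm⟩) hx hx₀
  obtain ⟨m, hm⟩ := h' x hx
  rw [hval x hx m hm, hval x₀ hx₀ n hn] at this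
  rw [hm, Int.cast_injective this]

/-- The standard 1-periodic parametrization of the unit circle. -/
noncomputable def circ (x : ℝ) : ℂ := Complex.exp (x * (2 * Real.pi * Complex.I))

theorem continuous_circ : Continuous circ := by unfold circ; fun_prop

theorem norm_circ (x : ℝ) : ‖circ x‖ = 1 := by
  have : (x * (2 * Real.pi * Complex.I) : ℂ) = ((x * (2 * Real.pi) : ℝ) : ℂ) * Complex.I := by
    push_cast; ring
  rw [circ, this, Complex.norm_exp_ofReal_mul_I]

theorem circ_ne_zero (x : ℝ) : circ x ≠ 0 := Complex.exp_ne_zero _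

theorem circ_add_int (x : ℝ) (n : ℤ) : circ (x + n) = circ x := by
  have := Complex.exp_int_mul_two_pi_mul_I n
  simp only [circ, Complex.ofReal_add, Complex.ofReal_intCast, add_mul, Complex.exp_add, this,
    mul_one]

theorem circ_add_one (x : ℝ) : circ (x + 1) = circ x := by simpa using circ_add_int x 1

theorem circ_eq_circ_iff {x y : ℝ} : circ x = circ y ↔ ∃ n : ℤ, x = y + n := by
  constructor
  · intro h
    obtain ⟨n, hn⟩ := Complex.exp_eq_exp_iff_exists_int.1 h
    refine ⟨n, ?_⟩
    have hpi : (2 * Real.pi * Complex.I : ℂ) ≠ 0 := by simp [Real.pi_ne_zero]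
    rw [← add_mul] at hn
    exact_mod_cast mul_right_cancel₀ hpi hn
  · rintro ⟨n, rfl⟩
    exact circ_add_int y n

theorem exists_circ_eq {z : ℂ} (hz : ‖z‖ = 1) : ∃ x, circ x = z := by
  refine ⟨z.arg / (2 * Real.pi), ?_⟩
  rw [circ]
  have : ((z.arg / (2 * Real.pi) : ℝ) * (2 * Real.pi * Complex.I) : ℂ) = z.arg * Complex.I := by
    have : (Real.pi : ℂ) ≠ 0 := by simp [Real.pi_ne_zero]
    push_cast
    field_simp
  rw [this]
  simpa [hz] using Complex.norm_mul_exp_arg_mul_I z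

theorem star_circ (x : ℝ) : (starRingEnd ℂ) (circ x) = circ (-x) := by
  rw [circ, circ, ← Complex.exp_conj]
  simp [Complex.conj_ofNat]

/-- A logarithm of a function with values on the unit circle is purely imaginary. -/
theorem exists_circ_lift {E : Type*} [NormedAddCommGroup E] [NormedSpace ℝ E] {s : Set E}
    (hs : Convex ℝ s) {g : E → ℂ} (hg : ContinuousOn g s) (h1 : ∀ x ∈ s, ‖g x‖ = 1) :
    ∃ b : E → ℝ, ContinuousOn b s ∧ ∀ x ∈ s, circ (b x) = g x := by
  obtain ⟨L, hL, h⟩ := exists_log hs hg (fun x hx => norm_ne_zero_iff.1 (by simp [h1 x hx]))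
  refine ⟨fun x => (L x).im / (2 * Real.pi),
    (Complex.continuous_im.comp_continuousOn hL).div_const _, fun x hx => ?_⟩
  have hre : (L x).re = 0 := by
    have := h1 x hx
    rw [← h x hx, Complex.norm_exp] at this
    simpa using this
  rw [← h x hx, circ]
  congr 1
  have : (Real.pi : ℂ) ≠ 0 := by simp [Real.pi_ne_zero]
  push_cast
  field_simp
  apply Complex.ext <;> simp [hre]

/-- A continuous injection of a compact set into a Hausdorff space is a closed map onto its image.
-/
theorem continuousOn_invFunOn {X Y : Type*} [TopologicalSpace X] [Nonempty X] [TopologicalSpace Y]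
    [T2Space Y] {f : X → Y} {s : Set X} (hs : IsCompact s) (hf : ContinuousOn f s)
    (hi : Set.InjOn f s) : ContinuousOn (Function.invFunOn f s) (f '' s) := by
  rw [continuousOn_iff_isClosed]
  intro t ht
  refine ⟨f '' (s ∩ t), ((hs.inter_right ht).image_of_continuousOn
    (hf.mono Set.inter_subset_left)).isClosed, ?_⟩
  ext y
  constructor
  · rintro ⟨h1, x, hx, rfl⟩
    refine ⟨⟨x, ⟨hx, ?_⟩, rfl⟩, x, hx, rfl⟩
    have : Function.invFunOn f s (f x) = x := hi.leftInvOn_invFunOn hx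
    simpa [this] using h1
  · rintro ⟨⟨x, ⟨hx, hxt⟩, rfl⟩, -⟩
    refine ⟨?_, x, hx, rfl⟩
    have : Function.invFunOn f s (f x) = x := hi.leftInvOn_invFunOn hx
    simpa [this] using hxt

/-- By strict convexity a boundary point is extreme, and deleting an extreme point keeps a set
convex. The punctured disc therefore carries logarithms. -/
theorem convex_closedBall_diff {ζ : ℂ} (hζ : ‖ζ‖ = 1) :
    Convex ℝ (Metric.closedBall (0 : ℂ) 1 \ {ζ}) := by
  have h : ζ ∈ (Metric.closedBall (0 : ℂ) 1).extremePoints ℝ := by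
    refine mem_extremePoints.2 ⟨by simp [hζ], fun x hx y hy hxy => ?_⟩
    by_contra hne
    have hxy' : x ≠ y := by
      rintro rfl
      simp only [openSegment_same, Set.mem_singleton_iff] at hxy
      simp [hxy] at hne
    have := (strictConvex_closedBall ℝ (0 : ℂ) 1).openSegment_subset hx hy hxy' hxy
    rw [interior_closedBall _ one_ne_zero] at this
    simp [hζ] at this
  exact ((convex_closedBall _ _).mem_extremePoints_iff_convex_sdiff.1 h).2

/-- A boundary point of an embedded closed disc is not an interior point of the image. -/
theorem image_closedBall_notMem_nhds {Φ : ℂ → ℂ} (hc : ContinuousOn Φ (Metric.closedBall 0 1))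
    (hi : Set.InjOn Φ (Metric.closedBall 0 1)) {ζ : ℂ} (hζ : ‖ζ‖ = 1) :
    Φ '' Metric.closedBall 0 1 ∉ nhds (Φ ζ) := by
  intro hn
  have hζm : ζ ∈ Metric.closedBall (0 : ℂ) 1 := by simp [hζ]
  obtain ⟨ε, hε, hsub⟩ := Metric.nhds_basis_closedBall.mem_iff.1 hn
  set D := Metric.closedBall (0 : ℂ) 1
  have hcomp : IsCompact D := isCompact_closedBall _ _
  -- On the convex set D without ζ, the function Φ - Φ ζ has a logarithm. If the image contained a
  -- small circle around Φ ζ, its pullback to D would be a loop along which this logarithm closes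
  -- up, although the circle itself winds once.
  obtain ⟨Λ, hΛc, hΛ⟩ := exists_log (convex_closedBall_diff hζ) (g := fun w => Φ w - Φ ζ)
    ((hc.mono Set.sdiff_subset).sub continuousOn_const)
    (fun x hx h => hx.2 (hi hx.1 hζm (sub_eq_zero.1 h)))
  let c : ℝ → ℂ := fun x => Φ ζ + ε * circ x
  have hcim : ∀ x, c x ∈ Φ '' D := fun x => hsub (by
    simp [c, norm_circ, abs_of_pos hε])
  let β : ℝ → ℂ := fun x => Function.invFunOn Φ D (c x)
  have hβD : ∀ x, β x ∈ D := fun x => Function.invFunOn_mem (hcim x)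
  have hβ : ∀ x, Φ (β x) = c x := fun x => Function.invFunOn_eq (hcim x)
  have hcc : Continuous c := by
    have := continuous_circ
    fun_prop
  have hβc : Continuous β := (continuousOn_invFunOn hcomp hc hi).comp_continuous hcc hcim
  have hβ' : ∀ x, β x ∈ D \ {ζ} := fun x => ⟨hβD x, fun h => by
    have := hβ x
    rw [Set.mem_singleton_iff.1 h] at this
    have h2 : (ε : ℂ) * circ x = 0 := by
      simpa [c] using this
    rcases mul_eq_zero.1 h2 with h2 | h2
    · exact hε.ne' (by exact_mod_cast h2)
    · exact circ_ne_zero x h2⟩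
  obtain ⟨n, hn⟩ := log_unique (s := (Set.univ : Set ℝ)) isPreconnected_univ
    (L := fun x => Λ (β x)) (M := fun x : ℝ => Real.log ε + x * (2 * Real.pi * Complex.I))
    (hΛc.comp_continuous hβc hβ').continuousOn (by fun_prop) (fun x _ => by
      rw [hΛ _ (hβ' x), hβ x, Complex.exp_add, ← Complex.ofReal_exp, Real.exp_log hε]
      simp [c, circ])
  have h0 := hn 0 trivial
  have h1 := hn 1 trivial
  have hβ01 : β 1 = β 0 := by
    have : c 1 = c 0 := by simp only [c]; rw [← circ_add_one 0, zero_add]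
    simp only [β, this]
  simp only [hβ01] at h1
  rw [h0] at h1
  have : (2 * Real.pi * Complex.I : ℂ) ≠ 0 := by simp [Real.pi_ne_zero]
  apply this
  push_cast at h1
  linear_combination -h1

/-- The boundary circle of an embedded closed disc winds `±1` times around the image of the centre. -/
theorem exists_winding_unit {Φ : ℂ → ℂ} (hc : ContinuousOn Φ (Metric.closedBall 0 1))
    (hi : Set.InjOn Φ (Metric.closedBall 0 1)) (hn : Φ '' Metric.closedBall 0 1 ∈ nhds (Φ 0)) :
    ∃ (n : ℤ) (L : ℝ → ℂ), (n = 1 ∨ n = -1) ∧ Continuous L ∧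
      ∀ x, Complex.exp (L x) = Φ (circ x) - Φ 0 ∧ L (x + 1) = L x + n * (2 * Real.pi * Complex.I) := by
  set D := Metric.closedBall (0 : ℂ) 1
  have h0D : (0 : ℂ) ∈ D := by simp [D]
  obtain ⟨ε, hε, hsub⟩ := Metric.nhds_basis_closedBall.mem_iff.1 hn
  have hcomp : IsCompact D := isCompact_closedBall _ _
  -- Via the exponential, the closed left half-plane is the universal cover of the punctured closed
  -- disc, and translation by 2πi generates the deck group. There n is the winding number of the
  -- boundary circle.
  let H : Set ℂ := {w | w.re ≤ 0}
  have hH : Convex ℝ H := convex_halfSpace_re_le 0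
  have hexp : ∀ w ∈ H, Complex.exp w ∈ D := fun w hw => by
    simpa [D, Complex.norm_exp] using (show w.re ≤ 0 from hw)
  have hHs : ∀ w ∈ H, ∀ m : ℤ, w + m * (2 * Real.pi * Complex.I) ∈ H := fun w hw m => by
    simpa [H] using (show w.re ≤ 0 from hw)
  have hexps : ∀ w, ∀ m : ℤ, Complex.exp (w + m * (2 * Real.pi * Complex.I)) = Complex.exp w :=
    fun w m => by rw [Complex.exp_add, Complex.exp_int_mul_two_pi_mul_I, mul_one]
  obtain ⟨Λ, hΛc, hΛ⟩ := exists_log hH (g := fun w => Φ (Complex.exp w) - Φ 0)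
    ((hc.comp Complex.continuous_exp.continuousOn hexp).sub continuousOn_const)
    (fun x hx h => Complex.exp_ne_zero x (hi (hexp x hx) h0D (sub_eq_zero.1 h)))
  obtain ⟨n, hΛn⟩ := log_unique hH.isPreconnected
    (L := fun w => Λ (w + (1 : ℤ) * (2 * Real.pi * Complex.I))) (M := Λ)
    (hΛc.comp (by fun_prop) (fun w hw => hHs w hw 1)) hΛc (fun w hw => by
      rw [hΛ _ (hHs w hw 1), hΛ w hw, hexps])
  have hΛm : ∀ m : ℤ, ∀ w ∈ H, Λ (w + m * (2 * Real.pi * Complex.I)) =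
      Λ w + (m * n : ℤ) * (2 * Real.pi * Complex.I) := by
    intro m
    induction m using Int.induction_on with
    | zero => intro w _; simp
    | succ m ih =>
      intro w hw
      have h1 := hΛn _ (hHs w hw m)
      have h2 := ih w hw
      push_cast at h1 h2 ⊢
      rw [show w + ((m : ℂ) + 1) * (2 * Real.pi * Complex.I) =
        w + m * (2 * Real.pi * Complex.I) + 1 * (2 * Real.pi * Complex.I) by ring, h1, h2]
      ring
    | pred m ih =>
      intro w hw
      have h1 := hΛn _ (hHs w hw (-m - 1))
      have h2 := ih w hw
      push_cast at h1 h2 ⊢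
      rw [show w + (-(m : ℂ) - 1) * (2 * Real.pi * Complex.I) + 1 * (2 * Real.pi * Complex.I)
        = w + -m * (2 * Real.pi * Complex.I) by ring, h2] at h1
      linear_combination -h1
  let c : ℝ → ℂ := fun x => Φ 0 + ε * circ x
  have hcim : ∀ x, c x ∈ Φ '' D := fun x => hsub (by
    simp [c, norm_circ, abs_of_pos hε])
  let β : ℝ → ℂ := fun x => Function.invFunOn Φ D (c x)
  have hβD : ∀ x, β x ∈ D := fun x => Function.invFunOn_mem (hcim x)
  have hβ : ∀ x, Φ (β x) = c x := fun x => Function.invFunOn_eq (hcim x)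
  have hcc : Continuous c := by
    have := continuous_circ
    fun_prop
  have hβc : Continuous β := (continuousOn_invFunOn hcomp hc hi).comp_continuous hcc hcim
  have hβ0 : ∀ x, β x ≠ 0 := fun x h => by
    have := hβ x
    rw [h] at this
    have h2 : (ε : ℂ) * circ x = 0 := by
      simpa [c] using this
    rcases mul_eq_zero.1 h2 with h2 | h2
    · exact hε.ne' (by exact_mod_cast h2)
    · exact circ_ne_zero x h2
  obtain ⟨b, hbc, hb⟩ := exists_log (convex_univ (𝕜 := ℝ) (E := ℝ)) hβc.continuousOn (fun x _ => hβ0 x)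
  have hbH : ∀ x, b x ∈ H := fun x => by
    have := hβD x
    rw [← hb x trivial] at this
    show (b x).re ≤ 0
    simpa [D, Complex.norm_exp] using this
  have hβp : ∀ x, β (x + 1) = β x := fun x => by
    simp only [β, c, circ_add_one]
  obtain ⟨m, hm⟩ := log_unique (s := (Set.univ : Set ℝ)) isPreconnected_univ
    (L := fun x => b (x + 1)) (M := b) (hbc.comp (by fun_prop) (fun _ _ => trivial)) hbc
    (fun x _ => by rw [hb _ trivial, hb _ trivial, hβp])
  obtain ⟨k, hk⟩ := log_unique (s := (Set.univ : Set ℝ)) isPreconnected_univ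
    (L := fun x => Λ (b x)) (M := fun x : ℝ => Real.log ε + x * (2 * Real.pi * Complex.I))
    (hΛc.comp hbc (fun x _ => hbH x)) (by fun_prop) (fun x _ => by
      rw [hΛ _ (hbH x), hb x trivial, hβ x, Complex.exp_add, ← Complex.ofReal_exp, Real.exp_log hε]
      simp [c, circ])
  -- The preimage `β` of a small circle winds m times around 0, and Φ multiplies winding numbers by
  -- n. The small circle itself winds once, so m n = 1 and n is a unit.
  have hmn : m * n = 1 := by
    have h0 := hk 0 trivial
    have h1 := hk 1 trivial
    have h2 := hm 0 trivial
    have h3 := hΛm m (b 0) (hbH 0)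
    have hpi : (2 * Real.pi * Complex.I : ℂ) ≠ 0 := by simp [Real.pi_ne_zero]
    rw [zero_add] at h2
    simp only [h2] at h1
    rw [h3, h0] at h1
    have h4 : (((m * n : ℤ) : ℂ) - 1) * (2 * Real.pi * Complex.I) = 0 := by
      push_cast at h1 ⊢
      linear_combination h1
    rcases mul_eq_zero.1 h4 with h4 | h4
    · exact_mod_cast sub_eq_zero.1 h4
    · exact absurd h4 hpi
  have himH : ∀ x : ℝ, (x * (2 * Real.pi * Complex.I) : ℂ) ∈ H := fun x => by simp [H]
  refine ⟨n, fun x => Λ (x * (2 * Real.pi * Complex.I)), ?_,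
    hΛc.comp_continuous (by fun_prop) himH, fun x => ⟨hΛ _ (himH x), ?_⟩⟩
  · exact Int.isUnit_iff.1 (IsUnit.of_mul_eq_one m (by rw [mul_comm]; exact hmn))
  · have := hΛn _ (himH x)
    rw [← this]
    push_cast
    ring_nf

/-- Periodic families of loops that avoid the origin have constant winding number. -/
theorem winding_homotopy {E : Type*} [NormedAddCommGroup E] [NormedSpace ℝ E] {s : Set E}
    (hs : Convex ℝ s) {g : E × ℝ → ℂ} (hg : ContinuousOn g (s ×ˢ Set.univ))
    (h0 : ∀ p ∈ s ×ˢ (Set.univ : Set ℝ), g p ≠ 0) (hp : ∀ a ∈ s, ∀ x, g (a, x + 1) = g (a, x)) :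
    ∃ (n : ℤ) (L : E × ℝ → ℂ), ContinuousOn L (s ×ˢ Set.univ) ∧ ∀ a ∈ s, ∀ x,
      Complex.exp (L (a, x)) = g (a, x) ∧
      L (a, x + 1) = L (a, x) + n * (2 * Real.pi * Complex.I) := by
  have hconv : Convex ℝ (s ×ˢ (Set.univ : Set ℝ)) := hs.prod convex_univ
  obtain ⟨L, hLc, hL⟩ := exists_log hconv hg h0
  obtain ⟨n, hn⟩ := log_unique hconv.isPreconnected (L := fun p => L (p.1, p.2 + 1)) (M := L)
    (hLc.comp (by fun_prop) (fun p hp => ⟨hp.1, trivial⟩)) hLc (fun p hpp => by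
      rw [hL (p.1, p.2 + 1) ⟨hpp.1, trivial⟩, hL p hpp, hp _ hpp.1])
  exact ⟨n, L, hLc, fun a ha x => ⟨hL _ ⟨ha, trivial⟩, hn (a, x) ⟨ha, trivial⟩⟩⟩

/-- All continuous logarithms of a loop have the same increment over a period. -/
theorem log_increment {g L M : ℝ → ℂ} (hL : Continuous L) (hM : Continuous M)
    (h1 : ∀ x, Complex.exp (L x) = g x) (h2 : ∀ x, Complex.exp (M x) = g x) (x y : ℝ) :
    L x - L y = M x - M y := by
  obtain ⟨n, hn⟩ := log_unique (s := (Set.univ : Set ℝ)) isPreconnected_univ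
    hL.continuousOn hM.continuousOn (fun x _ => by rw [h1, h2])
  rw [hn x trivial, hn y trivial]
  ring

/-- Every embedded closed disc has a parametrization by the unit disc for which the boundary circle
winds exactly once around all the images of interior points. -/
theorem exists_oriented_disc {Φ : ℂ → ℂ} (hc : Continuous Φ)
    (hi : Set.InjOn Φ (Metric.closedBall 0 1)) (hn : Φ '' Metric.closedBall 0 1 ∈ nhds (Φ 0)) :
    ∃ σ : ℂ → ℂ, Continuous σ ∧ (∀ z, ‖σ z‖ = ‖z‖) ∧ (∀ z, σ (σ z) = z) ∧
      ∀ w ∈ Metric.ball (0 : ℂ) 1, ∃ L : ℝ → ℂ, Continuous L ∧ ∀ x,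
        Complex.exp (L x) = Φ (σ (circ x)) - Φ (σ w) ∧
        L (x + 1) = L x + 2 * Real.pi * Complex.I := by
  -- Letting w vary over the convex open disc, the winding number around the image of w is constant,
  -- so the value at the centre decides.
  have key : ∀ σ : ℂ → ℂ, Continuous σ → (∀ z, ‖σ z‖ = ‖z‖) → (∀ z, σ (σ z) = z) → σ 0 = 0 →
      (∃ L : ℝ → ℂ, Continuous L ∧ ∀ x, Complex.exp (L x) = Φ (σ (circ x)) - Φ 0 ∧
        L (x + 1) = L x + 2 * Real.pi * Complex.I) →
      ∀ w ∈ Metric.ball (0 : ℂ) 1, ∃ L : ℝ → ℂ, Continuous L ∧ ∀ x,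
        Complex.exp (L x) = Φ (σ (circ x)) - Φ (σ w) ∧
        L (x + 1) = L x + 2 * Real.pi * Complex.I := by
    rintro σ hσc hσn hσσ hσ0 ⟨M, hMc, hM⟩ w hw
    obtain ⟨n, L, hLc, hL⟩ := winding_homotopy (convex_ball (0 : ℂ) 1)
      (g := fun p => Φ (σ (circ p.2)) - Φ (σ p.1))
      (by have := continuous_circ; fun_prop) (by
        rintro ⟨a, x⟩ ⟨ha, -⟩ h
        have ha' : ‖a‖ < 1 := by simpa using ha
        have h1 := hi (by simp [hσn, norm_circ]) (by simp [hσn, ha'.le]) (sub_eq_zero.1 h)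
        have := congrArg norm h1
        rw [hσn, hσn, norm_circ] at this
        linarith)
      (fun a _ x => by simp only [circ_add_one])
    have hcont : ∀ a ∈ Metric.ball (0 : ℂ) 1, Continuous fun x => L (a, x) := fun a ha =>
      hLc.comp_continuous (by fun_prop) (fun x => ⟨ha, trivial⟩)
    have h00 : (0 : ℂ) ∈ Metric.ball (0 : ℂ) 1 := by simp
    have h1 := log_increment (hcont 0 h00) hMc (g := fun x => Φ (σ (circ x)) - Φ 0)
      (fun x => by rw [(hL 0 h00 x).1, hσ0]) (fun x => (hM x).1) (0 + 1) 0
    rw [(hL 0 h00 0).2, (hM 0).2] at h1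
    refine ⟨fun x => L (w, x), hcont w hw, fun x => ⟨(hL w hw x).1, ?_⟩⟩
    have h2 := (hL w hw x).2
    linear_combination h1 + h2
  obtain ⟨n, L, hn1 | hn1, hLc, hL⟩ := exists_winding_unit hc.continuousOn hi hn
  · subst hn1
    exact ⟨id, continuous_id, fun _ => rfl, fun _ => rfl,
      key id continuous_id (fun _ => rfl) (fun _ => rfl) rfl
        ⟨L, hLc, fun x => ⟨(hL x).1, by simpa using (hL x).2⟩⟩⟩
  -- Winding number -1 is corrected by precomposing with complex conjugation.
  · subst hn1
    refine ⟨starRingEnd ℂ, Complex.continuous_conj, Complex.norm_conj, Complex.conj_conj,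
      key _ Complex.continuous_conj Complex.norm_conj Complex.conj_conj (map_zero _)
        ⟨fun x => L (-x), hLc.comp continuous_neg, fun x => ⟨?_, ?_⟩⟩⟩
    · rw [star_circ]; exact (hL (-x)).1
    · have := (hL (-x - 1)).2
      rw [sub_add_cancel] at this
      simp only [neg_add', this]
      push_cast
      ring

end SubstTiling

namespace SubstTiling

/-! ## Cell complexes -/

theorem mem_tr {d : ℕ} {x y : Eu d} {σ : Set (Eu d)} : y ∈ tr x σ ↔ y - x ∈ σ := by
  constructor
  · rintro ⟨z, hz, rfl⟩
    simpa using hz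
  · intro h
    exact ⟨y - x, h, by simp⟩

theorem tr_injective {d : ℕ} (x : Eu d) : Function.Injective (tr x) :=
  Set.image_injective.2 (add_left_injective x)

theorem tr_subset_tr {d : ℕ} {x : Eu d} {σ τ : Set (Eu d)} : tr x σ ⊆ tr x τ ↔ σ ⊆ τ :=
  Set.image_subset_image_iff (add_left_injective x)

theorem skel_tr {d : ℕ} {K K' : ℕ → Set (Set (Eu d))} {x : Eu d} (h : ∀ k, K' k = tr x '' K k)
    (k : ℕ) : skel K' k = tr x (skel K k) := by
  ext z
  simp only [skel, mem_tr, h, Set.mem_ofPred_eq, Set.exists_mem_image]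

theorem openCell_tr {d : ℕ} {K K' : ℕ → Set (Set (Eu d))} {x : Eu d} (h : ∀ k, K' k = tr x '' K k)
    (k : ℕ) (σ : Set (Eu d)) : openCell K' k (tr x σ) = tr x (openCell K k σ) := by
  rw [openCell, skel_tr h, openCell]
  exact (Set.image_sdiff (add_left_injective x) _ _).symm

theorem skel_mono {d : ℕ} {K K' : ℕ → Set (Set (Eu d))} (h : ∀ k, K' k ⊆ K k) (k : ℕ) :
    skel K' k ⊆ skel K k := fun _ ⟨j, hj, τ, hτ, hz⟩ => ⟨j, hj, τ, h j hτ, hz⟩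

theorem skel_mono_right {d : ℕ} {K : ℕ → Set (Set (Eu d))} {j k : ℕ} (h : j ≤ k) :
    skel K j ⊆ skel K k := fun _ ⟨i, hi, τ, hτ, hz⟩ => ⟨i, hi.trans_le h, τ, hτ, hz⟩

theorem IsCellComplex.translate {d : ℕ} {K K' : ℕ → Set (Set (Eu d))} {x : Eu d}
    (hK : IsCellComplex K) (h : ∀ k, K' k = tr x '' K k) : IsCellComplex K' where
  disc := by
    intro k σ hσ
    rw [h] at hσ
    obtain ⟨σ, hσ, rfl⟩ := hσ
    obtain ⟨φ, hc, hi, hr, ho⟩ := hK.disc k σ hσ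
    refine ⟨fun z => φ z + x, by fun_prop, fun a b hab => hi (add_right_cancel hab), ?_, ?_⟩
    · rw [tr, ← hr, ← Set.range_comp]; rfl
    · rw [openCell_tr h, ← ho, tr, ← Set.image_comp]; rfl
  disjoint := by
    intro k σ hσ τ hτ hne
    rw [h] at hσ hτ
    obtain ⟨σ, hσ, rfl⟩ := hσ
    obtain ⟨τ, hτ, rfl⟩ := hτ
    rw [openCell_tr h, openCell_tr h, tr, tr, Set.disjoint_image_iff (add_left_injective x)]
    exact hK.disjoint k σ hσ τ hτ (fun h => hne (h ▸ rfl))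
  boundary := by
    intro k σ hσ z hz
    rw [h] at hσ
    obtain ⟨σ, hσ, rfl⟩ := hσ
    rw [skel_tr h] at hz
    obtain ⟨j, hj, τ, hτ, h1, h2⟩ := hK.boundary k σ hσ (z - x) ⟨mem_tr.1 hz.1, mem_tr.1 hz.2⟩
    exact ⟨j, hj, tr x τ, h j ▸ ⟨τ, hτ, rfl⟩, mem_tr.2 h1, tr_subset_tr.2 h2⟩

namespace IsCellComplex

variable {d : ℕ} {K : ℕ → Set (Set (Eu d))} (hK : IsCellComplex K)

include hK

theorem isCompact {k : ℕ} {σ : Set (Eu d)} (hσ : σ ∈ K k) : IsCompact σ := by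
  obtain ⟨φ, hc, hi, hr, ho⟩ := hK.disc k σ hσ
  rw [← hr]
  have : CompactSpace (Metric.closedBall (0 : Eu k) 1) :=
    isCompact_iff_compactSpace.1 (isCompact_closedBall _ _)
  exact isCompact_range hc

theorem openCell_nonempty {k : ℕ} {σ : Set (Eu d)} (hσ : σ ∈ K k) : (openCell K k σ).Nonempty := by
  obtain ⟨φ, hc, hi, hr, ho⟩ := hK.disc k σ hσ
  rw [← ho]
  exact ⟨_, ⟨0, by simp⟩, by simp, rfl⟩

theorem subset_closure_openCell {k : ℕ} {σ : Set (Eu d)} (hσ : σ ∈ K k) :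
    σ ⊆ closure (openCell K k σ) := by
  obtain ⟨φ, hc, hi, hr, ho⟩ := hK.disc k σ hσ
  rw [← ho, ← hr]
  rintro _ ⟨z, rfl⟩
  refine image_closure_subset_closure_image hc ⟨z, ?_, rfl⟩
  rw [Topology.IsInducing.subtypeVal.closure_eq_preimage_closure_image]
  have : Subtype.val '' {z : Metric.closedBall (0 : Eu k) 1 | ‖(z : Eu k)‖ < 1} =
      Metric.ball 0 1 := by
    ext w
    simp only [Set.mem_image, Subtype.exists, mem_ball_zero_iff]
    constructor
    · rintro ⟨a, h1, h2, rfl⟩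
      exact h2
    · intro h
      exact ⟨w, by simpa using h.le, h, rfl⟩
  rw [this, Set.mem_preimage, closure_ball _ one_ne_zero]
  exact z.2

theorem exists_vertex {σ : Set (Eu d)} (hσ : σ ∈ K 0) : ∃ v, σ = {v} := by
  obtain ⟨φ, hc, hi, hr, ho⟩ := hK.disc 0 σ hσ
  refine ⟨φ ⟨0, by simp⟩, ?_⟩
  rw [← hr]
  ext y
  constructor
  · rintro ⟨z, rfl⟩
    simp [Subsingleton.elim z ⟨0, by simp⟩]
  · rintro rfl
    exact ⟨_, rfl⟩

theorem exists_arc_param {e : Set (Eu d)} (he : e ∈ K 1) :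
    ∃ ψ : ℝ → Eu d, Continuous ψ ∧ Set.InjOn ψ (Set.Icc 0 1) ∧ ψ '' Set.Icc 0 1 = e ∧
      ψ '' Set.Ioo 0 1 = openCell K 1 e := by
  obtain ⟨φ, hc, hi, hr, ho⟩ := hK.disc 1 e he
  -- Clamping to [0, 1] makes the parametrization continuous on the whole line.
  let r : ℝ → Eu 1 := fun x => EuclideanSpace.single 0 (2 * max 0 (min 1 x) - 1)
  have hrn : ∀ x, ‖r x‖ = |2 * max 0 (min 1 x) - 1| := fun x => by simp [r]
  have hrm : ∀ x, r x ∈ Metric.closedBall (0 : Eu 1) 1 := fun x => by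
    rw [mem_closedBall_zero_iff, hrn, abs_le]
    have h1 : max 0 (min 1 x) ≤ 1 := max_le zero_le_one (min_le_left _ _)
    have h2 : 0 ≤ max 0 (min 1 x) := le_max_left _ _
    constructor <;> linarith
  have hclamp : ∀ x ∈ Set.Icc (0 : ℝ) 1, max 0 (min 1 x) = x := fun x hx => by
    rw [min_eq_right hx.2, max_eq_right hx.1]
  have hrc : Continuous r := by
    have : r = fun x => (2 * max 0 (min 1 x) - 1 : ℝ) • EuclideanSpace.single 0 (1 : ℝ) := by
      ext x i
      simp [r]
    rw [this]
    fun_prop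
  have hEu1 : ∀ z : Eu 1, z = EuclideanSpace.single 0 (z 0) := fun z => by
    ext i
    rw [Subsingleton.elim i 0]
    simp
  have hnorm : ∀ z : Eu 1, ‖z‖ = |z 0| := fun z => by
    conv_lhs => rw [hEu1 z]
    simp
  have hsurj : ∀ z : Eu 1, ‖z‖ ≤ 1 → (z 0 + 1) / 2 ∈ Set.Icc (0 : ℝ) 1 ∧ r ((z 0 + 1) / 2) = z := by
    intro z hz
    rw [hnorm, abs_le] at hz
    have : (z 0 + 1) / 2 ∈ Set.Icc (0 : ℝ) 1 := ⟨by linarith [hz.1], by linarith [hz.2]⟩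
    refine ⟨this, ?_⟩
    simp only [r]
    rw [hclamp _ this]
    conv_rhs => rw [hEu1 z]
    congr 1
    ring
  refine ⟨fun x => φ ⟨r x, hrm x⟩, hc.comp (by fun_prop), ?_, ?_, ?_⟩
  · intro x hx y hy hxy
    have h1 : r x = r y := congrArg Subtype.val (hi hxy)
    have h2 := congrArg (fun z : Eu 1 => z 0) h1
    simp only [r, PiLp.single_apply, if_true] at h2
    rw [hclamp x hx, hclamp y hy] at h2
    linarith
  · rw [← hr]
    ext y
    constructor
    · rintro ⟨x, -, rfl⟩
      exact ⟨_, rfl⟩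
    · rintro ⟨z, rfl⟩
      obtain ⟨h1, h2⟩ := hsurj z (mem_closedBall_zero_iff.1 z.2)
      exact ⟨_, h1, by simp only [h2]⟩
  · rw [← ho]
    ext y
    constructor
    · rintro ⟨x, hx, rfl⟩
      refine ⟨_, ?_, rfl⟩
      rw [Set.mem_ofPred_eq, hrn, hclamp x (Set.Ioo_subset_Icc_self hx), abs_lt]
      constructor <;> linarith [hx.1, hx.2]
    · rintro ⟨z, hz, rfl⟩
      obtain ⟨h1, h2⟩ := hsurj z (mem_closedBall_zero_iff.1 z.2)
      refine ⟨((z : Eu 1) 0 + 1) / 2, ?_, by simp only [h2]⟩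
      have : ‖(z : Eu 1)‖ < 1 := hz
      rw [hnorm, abs_lt] at this
      constructor <;> linarith [this.1, this.2]

end IsCellComplex

/-- The coordinate isometry of the Euclidean plane with `ℂ`. -/
noncomputable def planeEquiv : Eu 2 ≃ₗᵢ[ℝ] ℂ := Complex.orthonormalBasisOneI.repr.symm

theorem planar_eq (x : Eu 2) : planar x = planeEquiv x := by
  rw [planar, dif_pos le_rfl, planeEquiv, Complex.orthonormalBasisOneI_repr_symm_apply]
  apply Complex.ext <;> simp

namespace IsCellComplex

variable {d : ℕ} {K : ℕ → Set (Set (Eu d))} (hK : IsCellComplex K)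

include hK

theorem exists_disc_param {f : Set (Eu d)} (hf : f ∈ K 2) :
    ∃ Φ : ℂ → Eu d, Continuous Φ ∧ Set.InjOn Φ (Metric.closedBall 0 1) ∧
      Φ '' Metric.closedBall 0 1 = f ∧ Φ '' Metric.ball 0 1 = openCell K 2 f := by
  obtain ⟨φ, hc, hi, hr, ho⟩ := hK.disc 2 f hf
  -- Radial retraction onto the closed disc, so that Φ is continuous on all of ℂ.
  let r : ℂ → Eu 2 := fun z => planeEquiv.symm ((max 1 ‖z‖)⁻¹ • z)
  have hpos : ∀ z : ℂ, 0 < max 1 ‖z‖ := fun z => lt_max_of_lt_left one_pos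
  have hrm : ∀ z, r z ∈ Metric.closedBall (0 : Eu 2) 1 := fun z => by
    rw [mem_closedBall_zero_iff, LinearIsometryEquiv.norm_map, norm_smul, norm_inv,
      Real.norm_of_nonneg (hpos z).le, inv_mul_le_iff₀ (hpos z), mul_one]
    exact le_max_right _ _
  have hrc : Continuous r := by
    have : Continuous fun z : ℂ => (max 1 ‖z‖)⁻¹ :=
      Continuous.inv₀ (by fun_prop) (fun z => (hpos z).ne')
    exact planeEquiv.symm.continuous.comp (this.smul continuous_id)
  have hr1 : ∀ z : ℂ, ‖z‖ ≤ 1 → r z = planeEquiv.symm z := fun z hz => by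
    simp [r, max_eq_left hz]
  refine ⟨fun z => φ ⟨r z, hrm z⟩, hc.comp (by fun_prop), ?_, ?_, ?_⟩
  · intro x hx y hy hxy
    have h1 : r x = r y := congrArg Subtype.val (hi hxy)
    rw [hr1 x (by simpa using hx), hr1 y (by simpa using hy)] at h1
    exact planeEquiv.symm.injective h1
  · rw [← hr]
    ext y
    constructor
    · rintro ⟨x, -, rfl⟩
      exact ⟨_, rfl⟩
    · rintro ⟨z, rfl⟩
      have hz : ‖planeEquiv (z : Eu 2)‖ ≤ 1 := by
        simpa using mem_closedBall_zero_iff.1 z.2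
      exact ⟨planeEquiv z, by simpa using hz, by simp [hr1 _ hz]⟩
  · rw [← ho]
    ext y
    constructor
    · rintro ⟨x, hx, rfl⟩
      have hx' : ‖x‖ < 1 := by simpa using hx
      refine ⟨_, ?_, rfl⟩
      show ‖r x‖ < 1
      rw [hr1 x hx'.le]
      simpa using hx'
    · rintro ⟨z, hz, rfl⟩
      have hz' : ‖planeEquiv (z : Eu 2)‖ < 1 := by simpa using hz
      exact ⟨planeEquiv z, by simpa using hz', by simp [hr1 _ hz'.le]⟩

/-- The open cell of a closed cell of dimension at most two does not depend on the complex. -/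
theorem openCell_eq {K' : ℕ → Set (Set (Eu d))} (hK' : IsCellComplex K')
    {k : ℕ} (hk : k ≤ 2) {σ : Set (Eu d)} (hσ : σ ∈ K k) (hσ' : σ ∈ K' k)
    (hsub : skel K' k ⊆ skel K k) : openCell K k σ = openCell K' k σ := by
  have hsub' : openCell K k σ ⊆ openCell K' k σ := Set.sdiff_subset_sdiff_right hsub
  refine hsub'.antisymm fun z hz => ?_
  by_contra hzn
  interval_cases k
  · apply hzn
    refine ⟨hz.1, ?_⟩
    rintro ⟨j, hj, -⟩
    omega
  -- Only the two ends of an arc lie outside its open cell. The two ends for `K'` are already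
  -- outside the open cell of `K`, so they are the ends for `K`, and nothing is left for z.
  · obtain ⟨ψ, hc, hi, hr, ho⟩ := hK.exists_arc_param hσ
    obtain ⟨ψ', hc', hi', hr', ho'⟩ := hK'.exists_arc_param hσ'
    have hnot : ∀ y ∈ σ, y ∉ openCell K 1 σ → y = ψ 0 ∨ y = ψ 1 := by
      intro y hy hyn
      rw [← hr] at hy
      obtain ⟨x, hx, rfl⟩ := hy
      rw [← ho] at hyn
      by_contra! h
      exact hyn ⟨x, ⟨lt_of_le_of_ne hx.1 (fun h' => h.1 (h' ▸ rfl)),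
        lt_of_le_of_ne hx.2 (fun h' => h.2 (h' ▸ rfl))⟩, rfl⟩
    have h0 : (0 : ℝ) ∈ Set.Icc (0 : ℝ) 1 := by simp
    have h1 : (1 : ℝ) ∈ Set.Icc (0 : ℝ) 1 := by simp
    have hend : ∀ x ∈ Set.Icc (0 : ℝ) 1, (x = 0 ∨ x = 1) →
        ψ' x ∈ σ ∧ ψ' x ∉ openCell K' 1 σ ∧ ψ' x ∉ openCell K 1 σ := by
      intro x hx hx01
      have hn : ψ' x ∉ openCell K' 1 σ := by
        rw [← ho']
        rintro ⟨y, hy, hyx⟩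
        have := hi' (Set.Ioo_subset_Icc_self hy) hx hyx
        rcases hx01 with rfl | rfl <;> simp [this] at hy
      exact ⟨hr' ▸ ⟨x, hx, rfl⟩, hn, fun h => hn (hsub' h)⟩
    obtain ⟨a1, a2, a3⟩ := hend 0 h0 (Or.inl rfl)
    obtain ⟨b1, b2, b3⟩ := hend 1 h1 (Or.inr rfl)
    have hne : ψ' 0 ≠ ψ' 1 := fun h => zero_ne_one (hi' h0 h1 h)
    have hza : z ≠ ψ' 0 := fun h => a2 (h ▸ hz)
    have hzb : z ≠ ψ' 1 := fun h => b2 (h ▸ hz)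
    rcases hnot _ a1 a3 with h2 | h2 <;> rcases hnot _ b1 b3 with h3 | h3 <;>
      rcases hnot _ hz.1 hzn with h4 | h4 <;> simp_all
  · obtain ⟨Φ, hc, hi, hr, ho⟩ := hK.exists_disc_param hσ
    obtain ⟨Φ', hc', hi', hr', ho'⟩ := hK'.exists_disc_param hσ'
    have hcomp : IsCompact (Metric.closedBall (0 : ℂ) 1) := isCompact_closedBall _ _
    have himg : ∀ x ∈ Metric.closedBall (0 : ℂ) 1, Φ x ∈ Φ' '' Metric.closedBall 0 1 := by
      intro x hx
      rw [hr', ← hr]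
      exact ⟨x, hx, rfl⟩
    have hz' := hz.1
    rw [← hr] at hz'
    obtain ⟨ζ, hζ, rfl⟩ := hz'
    rw [← ho'] at hz
    obtain ⟨w, hw, hwζ⟩ := hz
    have hζ1 : ‖ζ‖ = 1 := by
      refine le_antisymm (by simpa using hζ) (not_lt.1 fun h => hzn ?_)
      rw [← ho]
      exact ⟨ζ, by simpa using h, rfl⟩
    -- The change of parameters embeds the disc in the plane, and sends the boundary point ζ to the
    -- interior point w. Its image is the whole disc, a neighbourhood of w, which is impossible.
    let ψ : ℂ → ℂ := fun x => Function.invFunOn Φ' (Metric.closedBall 0 1) (Φ x)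
    have hΦψ : ∀ x ∈ Metric.closedBall (0 : ℂ) 1, Φ' (ψ x) = Φ x := fun x hx =>
      Function.invFunOn_eq (himg x hx)
    have hψw : ψ ζ = w := by
      simp only [ψ]
      rw [← hwζ]
      exact hi'.leftInvOn_invFunOn (Metric.ball_subset_closedBall hw)
    refine image_closedBall_notMem_nhds (Φ := ψ) ?_ ?_ hζ1 ?_
    · exact (continuousOn_invFunOn hcomp hc'.continuousOn hi').comp hc.continuousOn himg
    · intro x hx y hy hxy
      refine hi hx hy ?_
      rw [← hΦψ x hx, ← hΦψ y hy, hxy]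
    · rw [hψw]
      refine Filter.mem_of_superset (Metric.isOpen_ball.mem_nhds hw) fun y hy => ?_
      have hyD := Metric.ball_subset_closedBall hy
      have : Φ' y ∈ Φ '' Metric.closedBall 0 1 := by
        rw [hr, ← hr']
        exact ⟨y, hyD, rfl⟩
      obtain ⟨x, hx, hxy⟩ := this
      exact ⟨x, hx, hi' (Function.invFunOn_mem (himg x hx)) hyD ((hΦψ x hx).trans hxy)⟩

end IsCellComplex

end SubstTiling

namespace SubstTiling

namespace Substitution

variable {d : ℕ} {S : Substitution d}

/-! ## Cells of patches -/

theorem mem_cells {P : Set S.Tile} {k : ℕ} {σ : Set (Eu d)} :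
    σ ∈ S.cells P k ↔ ∃ t ∈ P, σ ∈ S.cells {t} k := by
  simp [cells]

theorem cells_mono {P Q : Set S.Tile} (h : P ⊆ Q) (k : ℕ) : S.cells P k ⊆ S.cells Q k :=
  fun _ ⟨t, ht, hσ⟩ => ⟨t, h ht, hσ⟩

theorem cells_tile_subset {P : Set S.Tile} {t : S.Tile} (ht : t ∈ P) (k : ℕ) :
    S.cells {t} k ⊆ S.cells P k := cells_mono (Set.singleton_subset_iff.2 ht) k

theorem cells_singleton (t : S.Tile) (k : ℕ) : S.cells {t} k = tr t.2 '' S.face t.1 k := by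
  ext σ
  simp [cells, eq_comm]

theorem shift_singleton (x : Eu d) (t : S.Tile) : S.shift x {t} = {(t.1, t.2 + x)} := by
  simp [shift]

theorem mem_shift {x : Eu d} {P : Set S.Tile} {t : S.Tile} :
    t ∈ S.shift x P ↔ (t.1, t.2 - x) ∈ P := by
  constructor
  · rintro ⟨u, hu, rfl⟩
    simpa using hu
  · intro h
    exact ⟨_, h, by simp⟩

theorem shift_mono {x : Eu d} {P Q : Set S.Tile} (h : P ⊆ Q) : S.shift x P ⊆ S.shift x Q :=
  Set.image_mono h

theorem cells_shift (x : Eu d) (P : Set S.Tile) (k : ℕ) :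
    S.cells (S.shift x P) k = tr x '' S.cells P k := by
  ext σ
  constructor
  · rintro ⟨_, ⟨t, ht, rfl⟩, τ, hτ, rfl⟩
    exact ⟨tr t.2 τ, ⟨t, ht, τ, hτ, rfl⟩, tr_tr _ _ _⟩
  · rintro ⟨_, ⟨t, ht, τ, hτ, rfl⟩, rfl⟩
    exact ⟨_, ⟨t, ht, rfl⟩, τ, hτ, tr_tr _ _ _⟩

theorem cells_translate (x : Eu d) (t : S.Tile) (k : ℕ) :
    S.cells {(t.1, t.2 + x)} k = tr x '' S.cells {t} k := by
  rw [← shift_singleton, cells_shift]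

theorem supp_translate (x : Eu d) (t : S.Tile) : S.supp (t.1, t.2 + x) = tr x (S.supp t) :=
  (tr_tr _ _ _).symm

theorem isCellComplex_singleton (t : S.Tile) : IsCellComplex (S.cells {t}) :=
  (S.face_complex t.1).translate (cells_singleton t)

theorem cells_top (t : S.Tile) : S.cells {t} d = {S.supp t} := by
  rw [cells_singleton, S.face_top, Set.image_singleton]; rfl

theorem mem_cells_top {P : Set S.Tile} {σ : Set (Eu d)} :
    σ ∈ S.cells P d ↔ ∃ t ∈ P, σ = S.supp t := by
  rw [mem_cells]
  simp [cells_top]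

theorem supp_mem_cells {P : Set S.Tile} {t : S.Tile} (ht : t ∈ P) : S.supp t ∈ S.cells P d :=
  mem_cells_top.2 ⟨t, ht, rfl⟩

theorem cells_eq_empty (P : Set S.Tile) {k : ℕ} (hk : d < k) : S.cells P k = ∅ := by
  ext σ
  simp [cells, S.face_above _ k hk]

theorem le_of_mem_cells {P : Set S.Tile} {k : ℕ} {σ : Set (Eu d)} (h : σ ∈ S.cells P k) :
    k ≤ d := by
  by_contra hk
  rw [cells_eq_empty P (not_le.1 hk)] at h
  exact h

theorem cells_finite {P : Set S.Tile} (hP : P.Finite) (k : ℕ) : (S.cells P k).Finite := by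
  have : S.cells P k = ⋃ t ∈ P, tr t.2 '' S.face t.1 k := by
    ext σ
    simp [cells, eq_comm]
  rw [this]
  exact hP.biUnion fun t _ => (S.face_finite t.1 k).image _

theorem cell_subset_supp {t : S.Tile} {k : ℕ} {σ : Set (Eu d)} (h : σ ∈ S.cells {t} k) :
    σ ⊆ S.supp t := by
  rw [cells_singleton] at h
  obtain ⟨τ, hτ, rfl⟩ := h
  exact tr_subset_tr.2 (S.face_subset _ _ _ hτ)

theorem skel_subset_supp (t : S.Tile) (k : ℕ) : skel (S.cells {t}) k ⊆ S.supp t := by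
  rintro z ⟨j, -, τ, hτ, hz⟩
  exact cell_subset_supp hτ hz

theorem skel_cells_mono {P Q : Set S.Tile} (h : P ⊆ Q) (k : ℕ) :
    skel (S.cells P) k ⊆ skel (S.cells Q) k := skel_mono (fun _ => cells_mono h _) k

theorem isCompact_supp (t : S.Tile) : IsCompact (S.supp t) :=
  (isCellComplex_singleton t).isCompact (supp_mem_cells rfl)

theorem supp_nonempty (t : S.Tile) : (S.supp t).Nonempty :=
  ((isCellComplex_singleton t).openCell_nonempty (supp_mem_cells rfl)).mono Set.sdiff_subset

/-! ## Cells of tilings -/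

namespace IsTiling

variable {T : Set S.Tile} (hT : S.IsTiling T)

include hT

theorem cell_nonempty {k : ℕ} {σ : Set (Eu d)} (hσ : σ ∈ S.cells T k) :
    (S.opn T k σ).Nonempty := hT.complex.openCell_nonempty hσ

theorem opn_eq (hd : d ≤ 2) {t : S.Tile} (ht : t ∈ T) {k : ℕ} {σ : Set (Eu d)}
    (hσ : σ ∈ S.cells {t} k) : S.opn T k σ = S.opn {t} k σ :=
  hT.complex.openCell_eq (isCellComplex_singleton t) ((le_of_mem_cells hσ).trans hd)
    (cells_tile_subset ht k hσ) hσ (skel_cells_mono (Set.singleton_subset_iff.2 ht) k)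

/-- Among the cells of u that contain the common point, one of least dimension has it in its open
cell. Comparing dimensions and using disjointness of open cells in T, that cell is σ. -/
theorem mem_cells_of_inter (hd : d ≤ 2) {u : S.Tile} (hu : u ∈ T) {k : ℕ} {σ : Set (Eu d)}
    (hσ : σ ∈ S.cells T k) (h : (S.supp u ∩ S.opn T k σ).Nonempty) : σ ∈ S.cells {u} k := by
  classical
  obtain ⟨z, hzu, hzσ⟩ := h
  have hex : ∃ j, ∃ τ ∈ S.cells {u} j, z ∈ τ := ⟨d, _, supp_mem_cells rfl, hzu⟩
  obtain ⟨τ, hτ, hzτ⟩ := Nat.find_spec hex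
  have hzo : z ∈ S.opn {u} (Nat.find hex) τ := ⟨hzτ, fun ⟨i, hi, ρ, hρ, hz⟩ =>
    Nat.find_min hex hi ⟨ρ, hρ, hz⟩⟩
  rw [← hT.opn_eq hd hu hτ] at hzo
  have hτT := cells_tile_subset hu _ hτ
  have hk : Nat.find hex = k := by
    rcases lt_trichotomy (Nat.find hex) k with h | h | h
    · exact absurd ⟨_, h, τ, hτT, hzτ⟩ hzσ.2
    · exact h
    · exact absurd ⟨_, h, σ, hσ, hzσ.1⟩ hzo.2
  rw [hk] at hτ hzo hτT
  by_contra hne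
  have : τ ≠ σ := fun h => hne (h ▸ hτ)
  exact Set.disjoint_left.1 (hT.complex.disjoint k τ hτT σ hσ this) hzo hzσ

/-- This turns the topological patch T(σ°) into a combinatorial one, consisting of the tiles that
have σ as a cell. Translation arguments below use only this form. -/
theorem mem_patchAt_iff (hd : d ≤ 2) {u : S.Tile} {k : ℕ} {σ : Set (Eu d)}
    (hσ : σ ∈ S.cells T k) : u ∈ S.patchAt T (S.opn T k σ) ↔ u ∈ T ∧ σ ∈ S.cells {u} k := by
  constructor
  · rintro ⟨hu, h⟩
    exact ⟨hu, hT.mem_cells_of_inter hd hu hσ h⟩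
  · rintro ⟨hu, h⟩
    obtain ⟨z, hz⟩ := hT.cell_nonempty hσ
    exact ⟨hu, z, cell_subset_supp h hz.1, hz⟩

theorem mem_cells_iff_subset (hd : d ≤ 2) {u : S.Tile} (hu : u ∈ T) {k : ℕ} {σ : Set (Eu d)}
    (hσ : σ ∈ S.cells T k) : σ ∈ S.cells {u} k ↔ σ ⊆ S.supp u := by
  refine ⟨cell_subset_supp, fun h => hT.mem_cells_of_inter hd hu hσ ?_⟩
  obtain ⟨z, hz⟩ := hT.cell_nonempty hσ
  exact ⟨z, h hz.1, hz⟩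

theorem tile_eq (hd : d ≤ 2) {t u : S.Tile} (ht : t ∈ T) (hu : u ∈ T) {y : Eu d}
    (hy : y ∈ S.opn T d (S.supp t)) (hyu : y ∈ S.supp u) : u = t := by
  have := hT.mem_cells_of_inter hd hu (supp_mem_cells ht) ⟨y, hyu, hy⟩
  rw [cells_top, Set.mem_singleton_iff] at this
  exact hT.inj hu ht this.symm

theorem eq_of_supp_subset (hd : d ≤ 2) {t u : S.Tile} (ht : t ∈ T) (hu : u ∈ T)
    (h : S.supp t ⊆ S.supp u) : u = t := by
  obtain ⟨z, hz⟩ := hT.cell_nonempty (supp_mem_cells ht)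
  exact hT.tile_eq hd ht hu hz (h hz.1)

theorem exists_mem_supp (x : Eu d) : ∃ t ∈ T, x ∈ S.supp t := by
  have : x ∈ ⋃ t ∈ T, S.supp t := by rw [hT.cover]; trivial
  simpa using this

theorem patchAt_finite (c : Eu d) (R : ℝ) : (S.patchAt T (Metric.closedBall c R)).Finite := by
  refine (hT.locallyFinite (R + dist c 0)).subset fun t ht => ⟨ht.1, ht.2.mono ?_⟩
  exact Set.inter_subset_inter_right _ (Metric.closedBall_subset_closedBall' le_rfl)

theorem patchAt_finite_of_isBounded {X : Set (Eu d)} (hX : Bornology.IsBounded X) :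
    (S.patchAt T X).Finite := by
  obtain ⟨R, hR⟩ := hX.subset_closedBall 0
  exact (hT.locallyFinite R).subset fun t ht => ⟨ht.1, ht.2.mono (Set.inter_subset_inter_right _ hR)⟩

theorem isCompact_cell {k : ℕ} {σ : Set (Eu d)} (hσ : σ ∈ S.cells T k) : IsCompact σ :=
  hT.complex.isCompact hσ

theorem locallyFinite_supp : LocallyFinite fun t : T => S.supp t.1 := by
  intro x
  refine ⟨Metric.closedBall x 1, Metric.closedBall_mem_nhds x one_pos, ?_⟩
  refine Set.Finite.of_finite_image (f := Subtype.val) ((hT.patchAt_finite x 1).subset ?_)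
    Subtype.val_injective.injOn
  rintro _ ⟨t, ht, rfl⟩
  exact ⟨t.2, ht⟩

theorem isClosed_iUnion_supp (A : Set S.Tile) (hA : A ⊆ T) : IsClosed (⋃ t ∈ A, S.supp t) := by
  rw [Set.biUnion_eq_iUnion]
  refine LocallyFinite.isClosed_iUnion ?_ (fun t => (isCompact_supp t.1).isClosed)
  have := hT.locallyFinite_supp.comp_injective (g := Set.inclusion hA) (Set.inclusion_injective hA)
  exact this

/-- A cell whose neighbourhood in `T'` recurs in `T` is stably equivalent to a cell of `T`. -/
theorem stableEq_of_patch (hd : d ≤ 2) {T' : Set S.Tile} (hT' : S.IsTiling T') {k : ℕ}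
    {σ : Set (Eu d)} (hσ : σ ∈ S.cells T' k) {c : Eu d} {R : ℝ} (hσR : σ ⊆ Metric.ball c R)
    {z : Eu d} (hz : S.shift z (S.patchAt T' (Metric.closedBall c R)) ⊆ T) :
    tr z σ ∈ S.cells T k ∧ S.StableEq k T' σ T (tr z σ) := by
  have hback : ∀ t ∈ T', (S.supp t ∩ Metric.ball c R).Nonempty → (t.1, t.2 + z) ∈ T :=
    fun t ht h => hz ⟨t, ⟨ht, h.mono (Set.inter_subset_inter_right _ Metric.ball_subset_closedBall)⟩,
      rfl⟩
  have hne : σ.Nonempty := (hT'.cell_nonempty hσ).mono Set.sdiff_subset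
  have hmeet : ∀ t : S.Tile, σ ∈ S.cells {t} k → (S.supp t ∩ Metric.ball c R).Nonempty := by
    intro t ht
    obtain ⟨y, hy⟩ := hne
    exact ⟨y, cell_subset_supp ht hy, hσR hy⟩
  have hcell : tr z σ ∈ S.cells T k := by
    obtain ⟨t, ht, hσt⟩ := mem_cells.1 hσ
    refine cells_tile_subset (hback t ht (hmeet t hσt)) k ?_
    rw [cells_translate]
    exact ⟨σ, hσt, rfl⟩
  refine ⟨hcell, z, rfl, ?_⟩
  ext u
  rw [hT.mem_patchAt_iff hd hcell, mem_shift, hT'.mem_patchAt_iff hd hσ]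
  have hu : u = (u.1, u.2 - z + z) := by simp
  have hcells : tr z σ ∈ S.cells {u} k ↔ σ ∈ S.cells {(u.1, u.2 - z)} k := by
    have := cells_translate z (u.1, u.2 - z) k
    rw [← hu] at this
    rw [this, (tr_injective z).mem_set_image]
  rw [hcells]
  constructor
  · rintro ⟨huT, hσu⟩
    refine ⟨?_, hσu⟩
    obtain ⟨y, hy⟩ := hne
    have hyu : y + z ∈ S.supp u := cell_subset_supp (hcells.2 hσu) ⟨y, hy, rfl⟩
    -- A tile u of T touching the translated cell must come from T'. Near the touching point u has
    -- points of its open cell, and the tile of T' lying below such a point is carried to a tile of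
    -- T through it, which can only be u.
    have hcl := hT.complex.subset_closure_openCell (supp_mem_cells huT) hyu
    have hopen : IsOpen ((fun w => w - z) ⁻¹' Metric.ball c R) :=
      Metric.isOpen_ball.preimage (by fun_prop)
    obtain ⟨w, hw1, hw2⟩ := mem_closure_iff.1 hcl _ hopen (by simpa using hσR hy)
    obtain ⟨v, hv, hwv⟩ := hT'.exists_mem_supp (w - z)
    have hvT := hback v hv ⟨w - z, hwv, hw1⟩
    have : (v.1, v.2 + z) = u := hT.tile_eq hd huT hvT hw2 (by
      rw [supp_translate, mem_tr]; exact hwv)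
    rw [← this]
    simpa using hv
  · rintro ⟨huT, hσu⟩
    refine ⟨?_, hσu⟩
    rw [hu]
    exact hback _ huT (hmeet _ hσu)

end IsTiling

/-! ## Substituted patches -/

theorem mem_subst {P : Set S.Tile} {u : S.Tile} : u ∈ S.subst P ↔ ∃ t ∈ P, u ∈ S.subst {t} := by
  simp [subst]

theorem subst_mono {P Q : Set S.Tile} (h : P ⊆ Q) : S.subst P ⊆ S.subst Q :=
  fun _ ⟨t, ht, hu⟩ => ⟨t, h ht, hu⟩

theorem subst_singleton (t : S.Tile) : S.subst {t} = S.shift (S.lam • t.2) (S.sub t.1) := by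
  ext u
  simp [subst]

theorem subst_shift (x : Eu d) (P : Set S.Tile) :
    S.subst (S.shift x P) = S.shift (S.lam • x) (S.subst P) := by
  ext u
  constructor
  · rintro ⟨_, ⟨t, ht, rfl⟩, hu⟩
    rw [mem_shift]
    refine ⟨t, ht, ?_⟩
    rw [smul_add, ← S.shift_shift, mem_shift] at hu
    exact hu
  · rw [mem_shift]
    rintro ⟨t, ht, hu⟩
    refine ⟨_, ⟨t, ht, rfl⟩, ?_⟩
    rw [smul_add, ← S.shift_shift, mem_shift]
    exact hu

theorem subst_finite {P : Set S.Tile} (hP : P.Finite) : (S.subst P).Finite := by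
  have : S.subst P = ⋃ t ∈ P, S.shift (S.lam • t.2) (S.sub t.1) := by
    ext u
    simp [subst]
  rw [this]
  exact hP.biUnion fun t _ => (S.sub_finite t.1).image _

theorem lam_pos : 0 < S.lam := one_pos.trans S.one_lt_lam

theorem lam_ne_zero : S.lam ≠ 0 := lam_pos.ne'

theorem smul_tr (a : ℝ) (x : Eu d) (σ : Set (Eu d)) : a • tr x σ = tr (a • x) (a • σ) := by
  rw [tr, tr, ← Set.image_smul, ← Set.image_smul, Set.image_image, Set.image_image]
  simp

theorem iUnion_supp_subst_singleton (t : S.Tile) :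
    ⋃ u ∈ S.subst {t}, S.supp u = S.lam • S.supp t := by
  rw [subst_singleton, supp, smul_tr, ← S.sub_union]
  ext y
  simp only [Set.mem_iUnion, mem_tr, supp, exists_prop]
  constructor
  · rintro ⟨_, ⟨u, hu, rfl⟩, hy⟩
    exact ⟨u, hu, by rwa [sub_sub, add_comm (S.lam • t.2)]⟩
  · rintro ⟨u, hu, hy⟩
    refine ⟨_, ⟨u, hu, rfl⟩, ?_⟩
    show y - (u.2 + S.lam • t.2) ∈ _
    rwa [add_comm, ← sub_sub]

theorem supp_subset_of_mem_subst {t u : S.Tile} (h : u ∈ S.subst {t}) :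
    S.supp u ⊆ S.lam • S.supp t := by
  rw [← iUnion_supp_subst_singleton]
  exact Set.subset_biUnion_of_mem h

theorem inv_smul_subset_of_mem_subst {t u : S.Tile} (h : u ∈ S.subst {t}) :
    S.lam⁻¹ • S.supp u ⊆ S.supp t := by
  rintro _ ⟨y, hy, rfl⟩
  have := supp_subset_of_mem_subst h hy
  rwa [← Set.mem_smul_set_iff_inv_smul_mem₀ lam_ne_zero]

end Substitution

end SubstTiling

namespace SubstTiling

namespace Substitution

variable {d : ℕ} {S : Substitution d}

/-! ## Supertiles and recurrence -/

theorem mem_iterate_subst {n : ℕ} {P : Set S.Tile} {u : S.Tile} :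
    u ∈ S.subst^[n] P ↔ ∃ t ∈ P, u ∈ S.subst^[n] {t} := by
  induction n generalizing u with
  | zero => simp
  | succ n ih =>
    simp only [Function.iterate_succ', Function.comp_apply]
    rw [mem_subst]
    constructor
    · rintro ⟨v, hv, huv⟩
      obtain ⟨t, ht, hvt⟩ := ih.1 hv
      exact ⟨t, ht, mem_subst.2 ⟨v, hvt, huv⟩⟩
    · rintro ⟨t, ht, hut⟩
      obtain ⟨v, hv, huv⟩ := mem_subst.1 hut
      exact ⟨v, ih.2 ⟨t, ht, hv⟩, huv⟩

theorem iterate_subst_mono {n : ℕ} {P Q : Set S.Tile} (h : P ⊆ Q) :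
    S.subst^[n] P ⊆ S.subst^[n] Q := fun _ hu =>
  let ⟨t, ht, hu⟩ := mem_iterate_subst.1 hu
  mem_iterate_subst.2 ⟨t, h ht, hu⟩

theorem iterate_subst_shift (n : ℕ) (x : Eu d) (P : Set S.Tile) :
    S.subst^[n] (S.shift x P) = S.shift (S.lam ^ n • x) (S.subst^[n] P) := by
  induction n with
  | zero => simp
  | succ n ih => simp only [Function.iterate_succ', Function.comp_apply, ih, subst_shift,
      smul_smul, pow_succ']

theorem iterate_subst_singleton (n : ℕ) (t : S.Tile) :
    S.subst^[n] {t} = S.shift (S.lam ^ n • t.2) (S.subst^[n] {(t.1, 0)}) := by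
  rw [← iterate_subst_shift, shift_singleton]
  simp

theorem supp_subset_of_mem_iterate {n : ℕ} {t u : S.Tile} (h : u ∈ S.subst^[n] {t}) :
    S.supp u ⊆ S.lam ^ n • S.supp t := by
  induction n generalizing u with
  | zero => simp_all
  | succ n ih =>
    rw [Function.iterate_succ', Function.comp_apply] at h
    obtain ⟨v, hv, huv⟩ := mem_subst.1 h
    rw [pow_succ', ← smul_smul]
    exact (supp_subset_of_mem_subst huv).trans (Set.smul_set_mono (ih hv))

theorem iterate_mem_hull (hmaps : Set.MapsTo S.subst S.hull S.hull) {T : Set S.Tile}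
    (hT : T ∈ S.hull) (n : ℕ) : S.subst^[n] T ∈ S.hull := hmaps.iterate n hT

variable (S) in
theorem exists_diam_bound : ∃ D : ℝ, 0 < D ∧ ∀ t : S.Tile, ∀ y ∈ S.supp t, ∀ z ∈ S.supp t,
    dist y z ≤ D := by
  have := S.finite_labels
  have hb : Bornology.IsBounded (⋃ i, S.supp (i, 0)) :=
    (isCompact_iUnion fun i => isCompact_supp (S := S) (i, 0)).isBounded
  obtain ⟨D, hD⟩ := Metric.isBounded_iff.1 hb
  refine ⟨max D 1, by positivity, fun t y hy z hz => ?_⟩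
  have h : ∀ y ∈ S.supp t, y - t.2 ∈ ⋃ i, S.supp (i, 0) := fun y hy =>
    Set.mem_iUnion.2 ⟨t.1, by simpa [supp, mem_tr] using hy⟩
  have := hD (h y hy) (h z hz)
  rw [dist_sub_right] at this
  exact this.trans (le_max_left _ _)

theorem exists_mem_hull_tile (hmaps : Set.MapsTo S.subst S.hull S.hull) (hprim : S.Primitive)
    {T : Set S.Tile} (hT : T ∈ S.hull) (j : S.ι) : ∃ T' ∈ S.hull, ∃ y, (j, y) ∈ T' := by
  obtain ⟨n, -, hn⟩ := hprim
  obtain ⟨t, ht, -⟩ := hT.1.exists_mem_supp 0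
  obtain ⟨x, hx⟩ := hn t.1 j
  refine ⟨_, iterate_mem_hull hmaps hT n, x + S.lam ^ n • t.2, ?_⟩
  refine mem_iterate_subst.2 ⟨t, ht, ?_⟩
  rw [iterate_subst_singleton]
  exact ⟨_, hx, rfl⟩

/-- The supertile sits inside the n-th substitution of a tiling of Ω, where a point of an open tile
belongs to no other tile. Such points identify tiles of a supertile by position alone. -/
theorem exists_isolated_point (hd : d ≤ 2) (hmaps : Set.MapsTo S.subst S.hull S.hull)
    (hprim : S.Primitive) {T : Set S.Tile} (hT : T ∈ S.hull) (j : S.ι) (n : ℕ) {v : S.Tile}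
    (hv : v ∈ S.subst^[n] {(j, 0)}) :
    ∃ y ∈ S.supp v, ∀ w ∈ S.subst^[n] {(j, 0)}, y ∈ S.supp w → w = v := by
  obtain ⟨T', hT', x, hx⟩ := exists_mem_hull_tile hmaps hprim hT j
  have hT'' := (iterate_mem_hull hmaps hT' n).1
  have hmem : ∀ w ∈ S.subst^[n] {(j, 0)}, (w.1, w.2 + S.lam ^ n • x) ∈ S.subst^[n] T' := by
    intro w hw
    refine mem_iterate_subst.2 ⟨_, hx, ?_⟩
    rw [iterate_subst_singleton]
    exact ⟨w, hw, rfl⟩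
  obtain ⟨y, hy⟩ := hT''.cell_nonempty (supp_mem_cells (hmem v hv))
  refine ⟨y - S.lam ^ n • x, ?_, fun w hw hyw => ?_⟩
  · have := hy.1
    rwa [supp_translate, mem_tr] at this
  · have := hT''.tile_eq hd (hmem v hv) (hmem w hw) hy (by rwa [supp_translate, mem_tr])
    simpa [Prod.ext_iff] using this

/-- A large ball patch of T is contained in some ωⁿ(t_j) by the definition of Ω. The m-supertile
there around the centre of the ball is too small to leave the ball, so all its tiles belong to T. -/
theorem exists_supertile (hd : d = 1 ∨ d = 2) (hmaps : Set.MapsTo S.subst S.hull S.hull)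
    (hprim : S.Primitive) {T : Set S.Tile} (hT : T ∈ S.hull) (m : ℕ) :
    ∃ (i : S.ι) (x : Eu d), S.shift x (S.subst^[m] {(i, 0)}) ⊆ T := by
  have hd2 : d ≤ 2 := by omega
  obtain ⟨D, hD0, hD⟩ := exists_diam_bound S
  have hdist : ∀ n ≤ m, ∀ t : S.Tile, ∀ u ∈ S.subst^[n] {t}, ∀ v ∈ S.subst^[n] {t},
      ∀ y ∈ S.supp u, ∀ z ∈ S.supp v, dist y z ≤ S.lam ^ m * D := by
    intro n hn t u hu v hv y hy z hz
    obtain ⟨y', hy', rfl⟩ := supp_subset_of_mem_iterate hu hy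
    obtain ⟨z', hz', rfl⟩ := supp_subset_of_mem_iterate hv hz
    have h1 : 0 < S.lam ^ n := pow_pos lam_pos n
    simp only [dist_smul₀, norm_pow, Real.norm_of_nonneg (lam_pos (S := S)).le]
    exact mul_le_mul (pow_le_pow_right₀ S.one_lt_lam.le hn) (hD t y' hy' z' hz') dist_nonneg
      (pow_pos lam_pos m).le
  -- E bounds the diameter of all supertiles of level at most m.
  set E := S.lam ^ m * D
  have hE : 0 ≤ E := mul_nonneg (pow_pos lam_pos m).le hD0.le
  set P := S.patchAt T (Metric.closedBall 0 (E + 1))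
  have hPT : P ⊆ T := fun t ht => ht.1
  obtain ⟨n, j, x, hsub⟩ := hT.2 P hPT (hT.1.patchAt_finite _ _)
  have hcover : ∀ y ∈ Metric.closedBall (0 : Eu d) (E + 1), ∃ u ∈ P, y ∈ S.supp u := by
    intro y hy
    obtain ⟨u, hu, hyu⟩ := hT.1.exists_mem_supp y
    exact ⟨u, ⟨hu, y, hyu, hy⟩, hyu⟩
  obtain ⟨u, huP, h0u⟩ := hcover 0 (by simp; linarith)
  have htr : ∀ v : S.Tile, ∀ y, y ∈ S.supp v → y - x ∈ S.supp (v.1, v.2 - x) := fun v y hy => by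
    have := supp_translate (S := S) x (v.1, v.2 - x)
    simp only [sub_add_cancel] at this
    rw [← mem_tr, ← this]
    exact hy
  -- If n < m, the single supertile ωⁿ(t_j) would contain two points at distance E + 1.
  have hnm : m ≤ n := by
    by_contra! hlt
    let e : Eu d := EuclideanSpace.single ⟨0, by omega⟩ (E + 1)
    have hen : ‖e‖ = E + 1 := by simp [e, abs_of_nonneg (by linarith : 0 ≤ E + 1)]
    obtain ⟨w, hwP, hew⟩ := hcover e (by simp [hen])
    have := hdist n hlt.le (j, 0) _ (mem_shift.1 (hsub huP)) _ (mem_shift.1 (hsub hwP))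
      (0 - x) (htr _ _ h0u) (e - x) (htr _ _ hew)
    rw [dist_sub_right, dist_zero_left, hen] at this
    linarith
  obtain ⟨l, rfl⟩ := Nat.exists_eq_add_of_le hnm
  have hu := mem_shift.1 (hsub huP)
  rw [Function.iterate_add_apply] at hu
  obtain ⟨q, hq, huq⟩ := mem_iterate_subst.1 hu
  refine ⟨q.1, S.lam ^ m • q.2 + x, ?_⟩
  rw [← S.shift_shift, ← iterate_subst_singleton]
  rintro _ ⟨v, hv, rfl⟩
  have hvn : v ∈ S.subst^[m + l] {(j, 0)} := by
    rw [Function.iterate_add_apply]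
    exact mem_iterate_subst.2 ⟨q, hq, hv⟩
  -- The definition of Ω only says that the patch is contained in the supertile. For the converse,
  -- the isolated point of v is covered by some tile of the patch, and this tile must be v.
  obtain ⟨y, hy, hyv⟩ := exists_isolated_point hd2 hmaps hprim hT j _ hvn
  have hyB : y + x ∈ Metric.closedBall (0 : Eu d) (E + 1) := by
    have := hdist m le_rfl q v hv _ huq y hy (0 - x) (htr _ _ h0u)
    rw [mem_closedBall_iff_norm]
    rw [dist_eq_norm] at this
    have h2 : y + x - 0 = y - (0 - x) := by abel
    rw [h2]
    linarith
  obtain ⟨w, hwP, hyw⟩ := hcover _ hyB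
  have := hyv _ (mem_shift.1 (hsub hwP)) (by simpa using htr _ _ hyw)
  rw [← this]
  simpa using hPT hwP

/-- All tilings of the tiling space have the same finite patches up to translation. -/
theorem exists_shift_subset (hd : d = 1 ∨ d = 2) (hmaps : Set.MapsTo S.subst S.hull S.hull)
    (hprim : S.Primitive) {T T' : Set S.Tile} (hT : T ∈ S.hull) (hT' : T' ∈ S.hull)
    {P : Set S.Tile} (hPT' : P ⊆ T') (hP : P.Finite) : ∃ z, S.shift z P ⊆ T := by
  obtain ⟨n, j, x, hsub⟩ := hT'.2 P hPT' hP
  have hprim' := hprim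
  obtain ⟨M, -, hM⟩ := hprim'
  -- By primitivity ω^M of any prototile contains a translate of t_j, so an (n+M)-supertile contains
  -- a translate of ωⁿ(t_j).
  obtain ⟨i, y, hiy⟩ := exists_supertile hd hmaps hprim hT (n + M)
  obtain ⟨w, hw⟩ := hM i j
  refine ⟨-x + (S.lam ^ n • w + y), ?_⟩
  rw [← S.shift_shift, ← S.shift_shift]
  have h1 : S.shift (-x) P ⊆ S.subst^[n] {(j, 0)} := by
    refine (shift_mono hsub).trans ?_
    rw [S.shift_shift, add_neg_cancel, S.shift_zero]
  have h2 : S.shift (S.lam ^ n • w) (S.subst^[n] {(j, 0)}) ⊆ S.subst^[n + M] {(i, 0)} := by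
    rw [Function.iterate_add_apply, ← iterate_subst_shift, shift_singleton, zero_add]
    exact iterate_subst_mono (Set.singleton_subset_iff.2 hw)
  exact (shift_mono (shift_mono h1)).trans ((shift_mono h2).trans hiy)

/-! ## Stable cells -/

theorem StableEq.symm {k : ℕ} {T T' : Set S.Tile} {σ σ' : Set (Eu d)}
    (h : S.StableEq k T σ T' σ') : S.StableEq k T' σ' T σ := by
  obtain ⟨x, h1, h2⟩ := h
  refine ⟨-x, ?_, ?_⟩
  · rw [h1, tr_tr, add_neg_cancel, tr_zero]
  · rw [h2, S.shift_shift, add_neg_cancel, S.shift_zero]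

theorem StableEq.trans {k : ℕ} {T T' T'' : Set S.Tile} {σ σ' σ'' : Set (Eu d)}
    (h : S.StableEq k T σ T' σ') (h' : S.StableEq k T' σ' T'' σ'') : S.StableEq k T σ T'' σ'' := by
  obtain ⟨x, h1, h2⟩ := h
  obtain ⟨y, h3, h4⟩ := h'
  exact ⟨x + y, by rw [h3, h1, tr_tr], by rw [h4, h2, S.shift_shift]⟩

theorem StableEq.refl (k : ℕ) (T : Set S.Tile) (σ : Set (Eu d)) : S.StableEq k T σ T σ :=
  ⟨0, (tr_zero σ).symm, (S.shift_zero _).symm⟩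

/-- A bounded neighbourhood of the cell recurs in T. Hence the default value 0 in `cls` never occurs
for cells of tilings of Ω. -/
theorem exists_stableEq (hd : d = 1 ∨ d = 2) (hmaps : Set.MapsTo S.subst S.hull S.hull)
    (hprim : S.Primitive) {T T' : Set S.Tile} (hT : T ∈ S.hull) (hT' : T' ∈ S.hull)
    {k : ℕ} {σ : Set (Eu d)} (hσ : σ ∈ S.cells T' k) :
    ∃ ρ : S.Cell T k, S.StableEq k T ρ.1 T' σ := by
  obtain ⟨R, hR⟩ := (hT'.1.isCompact_cell hσ).isBounded.subset_ball 0
  obtain ⟨z, hz⟩ := exists_shift_subset hd hmaps hprim hT hT'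
    (P := S.patchAt T' (Metric.closedBall 0 R)) (fun t ht => ht.1) (hT'.1.patchAt_finite _ _)
  obtain ⟨h1, h2⟩ := hT.1.stableEq_of_patch (by omega) hT'.1 hσ hR hz
  exact ⟨⟨_, h1⟩, h2.symm⟩

/-- The stable cell of a cell. -/
def StableCell.mk {T : Set S.Tile} {k : ℕ} (σ : S.Cell T k) : StableCell S T k :=
  Quotient.mk (S.stableSetoid T k) σ

theorem cls_eq_single {T T' : Set S.Tile} {k : ℕ} {τ : Set (Eu d)} (ρ : S.Cell T k)
    (h : S.StableEq k T ρ.1 T' τ) :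
    S.cls T T' k τ = Finsupp.single (StableCell.mk ρ) 1 := by
  have hex : ∃ σ : S.Cell T k, S.StableEq k T σ.1 T' τ := ⟨ρ, h⟩
  rw [cls, dif_pos hex]
  congr 1
  exact Quotient.sound (s := S.stableSetoid T k) (hex.choose_spec.trans h.symm)

theorem cls_congr {T T₁ T₂ : Set S.Tile} {k : ℕ} {τ₁ τ₂ : Set (Eu d)}
    (h : S.StableEq k T₁ τ₁ T₂ τ₂) : S.cls T T₁ k τ₁ = S.cls T T₂ k τ₂ := by
  by_cases hex : ∃ σ : S.Cell T k, S.StableEq k T σ.1 T₁ τ₁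
  · obtain ⟨ρ, hρ⟩ := hex
    rw [cls_eq_single ρ hρ, cls_eq_single ρ (hρ.trans h)]
  · have hex' : ¬∃ σ : S.Cell T k, S.StableEq k T σ.1 T₂ τ₂ :=
      fun ⟨ρ, hρ⟩ => hex ⟨ρ, hρ.trans h.symm⟩
    rw [cls, dif_neg hex, cls, dif_neg hex']

theorem rep_mem {T : Set S.Tile} {k : ℕ} (c : StableCell S T k) : S.rep c ∈ S.cells T k :=
  (Quotient.out (s := S.stableSetoid T k) c).2

theorem cls_rep {T : Set S.Tile} {k : ℕ} (c : StableCell S T k) :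
    S.cls T T k (S.rep c) = Finsupp.single c 1 := by
  rw [cls_eq_single (τ := S.rep c) (Quotient.out (s := S.stableSetoid T k) c) (StableEq.refl _ _ _)]
  congr 1
  exact Quotient.out_eq (s := S.stableSetoid T k) c

theorem stableEq_rep {T : Set S.Tile} {k : ℕ} (σ : S.Cell T k) :
    S.StableEq k T (S.rep (StableCell.mk σ)) T σ.1 :=
  Quotient.exact (s := S.stableSetoid T k)
    (Quotient.out_eq (s := S.stableSetoid T k) (Quotient.mk (S.stableSetoid T k) σ))

theorem stableCell_isEmpty (T : Set S.Tile) {k : ℕ} (hk : d < k) : IsEmpty (StableCell S T k) :=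
  ⟨fun c => by
    have := rep_mem c
    rw [cells_eq_empty T hk] at this
    exact this⟩

/-- A stable cell is determined by a ball patch around a representative together with the position
of the cell in it. By finite local complexity there are finitely many such pairs up to translation.
-/
theorem finite_stableCell (hd : d ≤ 2) (hflc : S.FLC) {T : Set S.Tile} (hT : T ∈ S.hull) (k : ℕ) :
    Finite (S.StableCell T k) := by
  classical
  obtain ⟨D, hD0, hD⟩ := exists_diam_bound S
  -- Radius D + 1 puts the whole closed cell in the open ball around any of its points.
  obtain ⟨F, hF, hFT⟩ := hflc (D + 1)
  have hdata : ∀ c : S.StableCell T k, ∃ (p : Set S.Tile × Set (Eu d)) (x y : Eu d),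
      p ∈ F ×ˢ (⋃ P ∈ {P ∈ F | P.Finite}, S.cells P k) ∧
      S.rep c ⊆ Metric.ball y (D + 1) ∧
      S.patchAt T (Metric.closedBall y (D + 1)) = S.shift x p.1 ∧ S.rep c = tr x p.2 := by
    intro c
    obtain ⟨t, ht, hct⟩ := mem_cells.1 (rep_mem c)
    obtain ⟨y, hy⟩ := hT.1.cell_nonempty (rep_mem c)
    obtain ⟨P, hP, x, hPx⟩ := hFT T hT y
    have hball : S.rep c ⊆ Metric.ball y (D + 1) := fun z hz => by
      rw [Metric.mem_ball]
      linarith [hD t z (cell_subset_supp hct hz) y (cell_subset_supp hct hy.1)]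
    have htP : (t.1, t.2 - x) ∈ P := by
      rw [← mem_shift, ← hPx]
      exact ⟨ht, y, cell_subset_supp hct hy.1, Metric.mem_closedBall_self (by linarith)⟩
    have hPfin : P.Finite := by
      have := hT.1.patchAt_finite y (D + 1)
      rw [hPx] at this
      exact this.of_finite_image fun a _ b _ hab => by simpa [Prod.ext_iff] using hab
    refine ⟨(P, tr (-x) (S.rep c)), x, y, ⟨hP, Set.mem_biUnion (show P ∈ _ from ⟨hP, hPfin⟩) ?_⟩,
      hball, hPx, ?_⟩
    · refine cells_tile_subset htP k ?_
      have := cells_translate (-x) t k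
      rw [← sub_eq_add_neg] at this
      rw [this]
      exact ⟨_, hct, rfl⟩
    · rw [tr_tr, neg_add_cancel, tr_zero]
  choose p x y hp hball hpatch hrep using hdata
  have hfin : (F ×ˢ (⋃ P ∈ {P ∈ F | P.Finite}, S.cells P k)).Finite :=
    hF.prod ((hF.subset (Set.sep_subset _ _)).biUnion fun P hP => cells_finite hP.2 k)
  have := hfin.to_subtype
  refine Finite.of_injective (fun c => (⟨p c, hp c⟩ : ↥(F ×ˢ (⋃ P ∈ {P ∈ F | P.Finite},
    S.cells P k)))) fun c c' hcc => ?_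
  have hpp : p c = p c' := congrArg Subtype.val hcc
  have hz : tr (x c' - x c) (S.rep c) = S.rep c' := by
    rw [hrep c, hrep c', tr_tr, hpp]
    congr 1
    abel
  obtain ⟨h1, h2⟩ := hT.1.stableEq_of_patch hd hT.1 (rep_mem c) (hball c) (z := x c' - x c) (by
    rw [hpatch c, S.shift_shift, hpp]
    have : x c + (x c' - x c) = x c' := by abel
    rw [this, ← hpatch c']
    exact fun t ht => ht.1)
  rw [hz] at h2
  have h3 := cls_congr (T := T) h2
  rw [cls_rep, cls_rep] at h3
  exact Finsupp.single_left_injective one_ne_zero h3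

end Substitution

end SubstTiling

namespace SubstTiling

/-! ## Translation of orientations -/

theorem planar_add {d : ℕ} (x y : Eu d) : planar (x + y) = planar x + planar y := by
  unfold planar
  split_ifs
  · rfl
  · simp

theorem WindsOnce.translate {d : ℕ} {γ : ℝ → Eu d} {p : Eu d} (h : WindsOnce γ p) (x : Eu d) :
    WindsOnce (fun t => γ t + x) (p + x) := by
  obtain ⟨L, hc, hL⟩ := h
  refine ⟨L, hc, fun t => ⟨?_, (hL t).2⟩⟩
  rw [planar_add, planar_add, add_sub_add_right_eq_sub]
  exact (hL t).1

theorem Counterclockwise.translate {d : ℕ} {f e : Set (Eu d)} {a b : Eu d}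
    (h : Counterclockwise f e a b) (x : Eu d) :
    Counterclockwise (tr x f) (tr x e) (a + x) (b + x) := by
  obtain ⟨γ, hc, hp, hi, hr, hw, s, t, hst, hts, he, ha, hb⟩ := h
  have htr : ∀ σ : Set (Eu d), tr x σ = Homeomorph.addRight x '' σ := fun _ => rfl
  refine ⟨fun t => γ t + x, by fun_prop, fun t => by simp only [hp],
    fun u hu v hv huv => hi hu hv (add_right_cancel huv), ?_, ?_, s, t, hst, hts, ?_,
    congrArg (· + x) ha, congrArg (· + x) hb⟩
  · rw [htr, ← Homeomorph.image_frontier, ← hr, ← Set.range_comp]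
    rfl
  · intro p hp
    rw [htr, ← Homeomorph.image_interior] at hp
    obtain ⟨q, hq, rfl⟩ := hp
    exact (hw q hq).translate x
  · rw [← he, tr, Set.image_image]

theorem counterclockwise_tr_iff {d : ℕ} {f e : Set (Eu d)} {a b x : Eu d} :
    Counterclockwise (tr x f) (tr x e) (a + x) (b + x) ↔ Counterclockwise f e a b := by
  refine ⟨fun h => ?_, fun h => h.translate x⟩
  have := h.translate (-x)
  rwa [Substitution.tr_tr, Substitution.tr_tr, add_neg_cancel, Substitution.tr_zero, Substitution.tr_zero, add_neg_cancel_right,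
    add_neg_cancel_right] at this

theorem tr_singleton {d : ℕ} (x v : Eu d) : tr x {v} = {v + x} := Set.image_singleton

namespace Substitution

variable {d : ℕ} {S : Substitution d}

/-! ## The coboundary of an arbitrary cell -/

open Classical in
theorem inc_zero (o : S.Orientation) (T : Set S.Tile) (τ σ : Set (Eu d)) :
    S.inc o T 0 τ σ = if σ = {o.src T τ} then -1 else if σ = {o.tgt T τ} then 1 else 0 := rfl

open Classical in
theorem inc_one (o : S.Orientation) (T : Set S.Tile) (τ σ : Set (Eu d)) :
    S.inc o T 1 τ σ = if Counterclockwise τ σ (o.src T σ) (o.tgt T σ) then 1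
      else if Counterclockwise τ σ (o.tgt T σ) (o.src T σ) then -1 else 0 := rfl

theorem subset_of_inc_ne_zero {o : S.Orientation} {T : Set S.Tile} (hT : T ∈ S.hull) {k : ℕ}
    {τ σ : Set (Eu d)} (hτ : τ ∈ S.cells T (k + 1)) (h : S.inc o T k τ σ ≠ 0) : σ ⊆ τ := by
  match k with
  | 0 =>
    rw [inc_zero] at h
    split_ifs at h with h1 h2
    · rw [h1]
      exact Set.singleton_subset_iff.2 (o.src_mem T hT τ hτ).1
    · rw [h2]
      exact Set.singleton_subset_iff.2 (o.tgt_mem T hT τ hτ).1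
    · exact absurd rfl h
  | 1 =>
    have key : ∀ a b, Counterclockwise τ σ a b → σ ⊆ τ := by
      rintro a b ⟨γ, -, -, -, hr, -, s, t, -, -, he, -⟩
      rw [← he]
      refine (Set.image_subset_range _ _).trans ?_
      rw [hr]
      exact (hT.1.isCompact_cell hτ).isClosed.frontier_subset
    rw [inc_one] at h
    split_ifs at h with h1 h2
    · exact key _ _ h1
    · exact key _ _ h2
    · exact absurd rfl h
  | _ + 2 => exact absurd rfl h

/-- Every tile containing τ contains ρ, hence lies in the patch of ρ that is known to be translated.
-/
theorem StableEq.translate_of_subset (hd : d ≤ 2) {T T' : Set S.Tile} (hT : S.IsTiling T)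
    (hT' : S.IsTiling T') {k j : ℕ} {ρ τ : Set (Eu d)} {x : Eu d} (hρ : ρ ∈ S.cells T k)
    (hρ' : tr x ρ ∈ S.cells T' k) (hτ : τ ∈ S.cells T j)
    (h : S.patchAt T' (S.opn T' k (tr x ρ)) = S.shift x (S.patchAt T (S.opn T k ρ)))
    (hsub : ρ ⊆ τ) :
    tr x τ ∈ S.cells T' j ∧
      S.patchAt T' (S.opn T' j (tr x τ)) = S.shift x (S.patchAt T (S.opn T j τ)) := by
  have hiff : ∀ u : S.Tile, (u.1, u.2 + x) ∈ T' ∧ ρ ⊆ S.supp u ↔ u ∈ T ∧ ρ ⊆ S.supp u := by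
    intro u
    have h1 : (u.1, u.2 + x) ∈ S.patchAt T' (S.opn T' k (tr x ρ)) ↔
        u ∈ S.patchAt T (S.opn T k ρ) := by
      rw [h, mem_shift]
      simp
    rw [hT.mem_patchAt_iff hd hρ, hT'.mem_patchAt_iff hd hρ', cells_translate,
      (tr_injective x).mem_set_image] at h1
    constructor
    · rintro ⟨hu, hs⟩
      refine ⟨(h1.1 ⟨hu, ?_⟩).1, hs⟩
      have := (hT'.mem_cells_iff_subset hd hu hρ').2 (by
        rw [supp_translate]; exact tr_subset_tr.2 hs)
      rwa [cells_translate, (tr_injective x).mem_set_image] at this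
    · rintro ⟨hu, hs⟩
      exact ⟨(h1.2 ⟨hu, (hT.mem_cells_iff_subset hd hu hρ).2 hs⟩).1, hs⟩
  have hcell : tr x τ ∈ S.cells T' j := by
    obtain ⟨u, hu, hτu⟩ := mem_cells.1 hτ
    refine cells_tile_subset ((hiff u).2 ⟨hu, hsub.trans (cell_subset_supp hτu)⟩).1 j ?_
    rw [cells_translate]
    exact ⟨_, hτu, rfl⟩
  refine ⟨hcell, ?_⟩
  ext u
  rw [hT'.mem_patchAt_iff hd hcell, mem_shift, hT.mem_patchAt_iff hd hτ]
  have hu : u = (u.1, u.2 - x + x) := by simp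
  have hc : tr x τ ∈ S.cells {u} j ↔ τ ∈ S.cells {(u.1, u.2 - x)} j := by
    have := cells_translate x (u.1, u.2 - x) j
    rw [← hu] at this
    rw [this, (tr_injective x).mem_set_image]
  rw [hc]
  have := hiff (u.1, u.2 - x)
  simp only [← hu] at this
  constructor
  · rintro ⟨h1, h2⟩
    exact ⟨(this.1 ⟨h1, hsub.trans (cell_subset_supp h2)⟩).1, h2⟩
  · rintro ⟨h1, h2⟩
    exact ⟨(this.2 ⟨h1, hsub.trans (cell_subset_supp h2)⟩).1, h2⟩

theorem inc_translate (hd : d ≤ 2) (o : S.Orientation) {T T' : Set S.Tile} (hT : T ∈ S.hull)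
    (hT' : T' ∈ S.hull) {k : ℕ} {ρ τ : Set (Eu d)} {x : Eu d} (hρ : ρ ∈ S.cells T k)
    (hρ' : tr x ρ ∈ S.cells T' k) (hτ : τ ∈ S.cells T (k + 1))
    (h : S.patchAt T' (S.opn T' k (tr x ρ)) = S.shift x (S.patchAt T (S.opn T k ρ)))
    (hsub : ρ ⊆ τ) : S.inc o T' k (tr x τ) (tr x ρ) = S.inc o T k τ ρ := by
  match k with
  | 0 =>
    obtain ⟨h1, h2⟩ := StableEq.translate_of_subset hd hT.1 hT'.1 hρ hρ' hτ h hsub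
    obtain ⟨h3, h4⟩ := o.equivariant T hT T' hT' τ hτ x h1 h2
    simp only [inc_zero, h3, h4, ← tr_singleton, (tr_injective x).eq_iff]
  | 1 =>
    obtain ⟨h3, h4⟩ := o.equivariant T hT T' hT' ρ hρ x hρ' h
    rw [inc_one, inc_one, h3, h4]
    have e1 := counterclockwise_tr_iff (f := τ) (e := ρ) (a := o.src T ρ) (b := o.tgt T ρ) (x := x)
    have e2 := counterclockwise_tr_iff (f := τ) (e := ρ) (a := o.tgt T ρ) (b := o.src T ρ) (x := x)
    classical exact if_congr e1 rfl (if_congr e2 rfl rfl)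
  | _ + 2 => rfl

/-- This frees the coboundary from chosen representatives, and makes it available for cells of ω(T).
The sum may run over all cells, since a nonzero incidence number forces σ ⊆ τ, and then τ belongs to
the patch of σ. -/
theorem delta_cls (hd : d = 1 ∨ d = 2) (hmaps : Set.MapsTo S.subst S.hull S.hull)
    (hprim : S.Primitive) (o : S.Orientation) {T T' : Set S.Tile} (hT : T ∈ S.hull)
    (hT' : T' ∈ S.hull) {k : ℕ} {σ : Set (Eu d)} (hσ : σ ∈ S.cells T' k) :
    S.delta o T k (S.cls T T' k σ) =
      ∑ᶠ τ ∈ S.cells T' (k + 1), S.inc o T' k τ σ • S.cls T T' (k + 1) τ := by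
  have hd2 : d ≤ 2 := by omega
  obtain ⟨ρ₀, hρ₀⟩ := exists_stableEq hd hmaps hprim hT hT' hσ
  rw [cls_eq_single ρ₀ hρ₀, delta, Finsupp.linearCombination_single, one_smul]
  set c : StableCell S T k := StableCell.mk ρ₀
  obtain ⟨x, hx, hpatch⟩ := (stableEq_rep ρ₀).trans hρ₀
  change σ = tr x (S.rep c) at hx
  change _ = S.shift x (S.patchAt T (S.opn T k (S.rep c))) at hpatch
  have hρ := rep_mem c
  set ρ := S.rep c
  subst hx
  rw [finsum_set_coe_eq_finsum_mem (s := S.cells (S.patchAt T (S.opn T k ρ)) (k + 1))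
    (f := fun τ => S.inc o T k τ ρ • S.cls T T (k + 1) τ)]
  have hbij : Set.BijOn (tr x) (S.cells (S.patchAt T (S.opn T k ρ)) (k + 1))
      (S.cells (S.patchAt T' (S.opn T' k (tr x ρ))) (k + 1)) := by
    rw [hpatch, cells_shift]
    exact (tr_injective x).injOn.bijOn_image
  rw [finsum_mem_eq_of_bijOn (g := fun τ => S.inc o T' k τ (tr x ρ) • S.cls T T' (k + 1) τ)
    (tr x) hbij]
  · refine finsum_mem_inter_support_eq' _ _ _ fun τ hτ => ?_
    refine ⟨fun h => cells_mono (fun u hu => hu.1) _ h, fun h => ?_⟩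
    have hinc : S.inc o T' k τ (tr x ρ) ≠ 0 := fun h0 => hτ (by simp [h0])
    have hsub := subset_of_inc_ne_zero hT' h hinc
    obtain ⟨u, hu, hτu⟩ := mem_cells.1 h
    refine mem_cells.2 ⟨u, ?_, hτu⟩
    rw [hT'.1.mem_patchAt_iff hd2 hσ, hT'.1.mem_cells_iff_subset hd2 hu hσ]
    exact ⟨hu, hsub.trans (cell_subset_supp hτu)⟩
  · intro τ hτ
    have hτT : τ ∈ S.cells T (k + 1) := cells_mono (fun u hu => hu.1) _ hτ
    have hτT' : tr x τ ∈ S.cells T' (k + 1) := cells_mono (fun u hu => hu.1) _ (hbij.mapsTo hτ)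
    by_cases hsub : ρ ⊆ τ
    · obtain ⟨h1, h2⟩ := StableEq.translate_of_subset hd2 hT.1 hT'.1 hρ hσ hτT hpatch hsub
      rw [inc_translate hd2 o hT hT' hρ hσ hτT hpatch hsub,
        cls_congr (T := T) (⟨x, rfl, h2⟩ : S.StableEq (k + 1) T τ T' (tr x τ))]
    · have h1 : S.inc o T k τ ρ = 0 := by
        by_contra h0
        exact hsub (subset_of_inc_ne_zero hT hτT h0)
      have h2 : S.inc o T' k (tr x τ) (tr x ρ) = 0 := by
        by_contra h0
        exact hsub (tr_subset_tr.1 (subset_of_inc_ne_zero hT' hτT' h0))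
      rw [h1, h2, zero_smul, zero_smul]

/-! ## The connecting maps on an arbitrary cell -/

namespace Homotopy

variable {T : Set S.Tile} (H : S.Homotopy T)

theorem image_cell_subset {t u : S.Tile} (ht : t ∈ T) (hu : u ∈ S.subst {t}) {k : ℕ}
    {τ : Set (Eu d)} (hτ : τ ∈ S.cells {u} k) : H.h 1 '' (S.lam⁻¹ • τ) ⊆ S.supp t := by
  rw [← H.surj t ht]
  exact Set.image_mono
    ((Set.smul_set_mono (cell_subset_supp hτ)).trans (inv_smul_subset_of_mem_subst hu))

theorem translate_inv_smul {t u : S.Tile} (ht : t ∈ T) {x : Eu d} (htx : (t.1, t.2 + x) ∈ T)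
    (hu : u ∈ S.subst {t}) {z : Eu d} (hz : z ∈ S.supp u) :
    H.h 1 (S.lam⁻¹ • (z + S.lam • x)) = H.h 1 (S.lam⁻¹ • z) + x := by
  rw [smul_add, inv_smul_smul₀ lam_ne_zero]
  exact H.translate 1 (by simp) t ht x htx _
    (inv_smul_subset_of_mem_subst hu (Set.smul_mem_smul_set hz))

theorem image_translate {t u : S.Tile} (ht : t ∈ T) {x : Eu d} (htx : (t.1, t.2 + x) ∈ T)
    (hu : u ∈ S.subst {t}) {k : ℕ} {τ : Set (Eu d)} (hτ : τ ∈ S.cells {u} k) :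
    H.h 1 '' (S.lam⁻¹ • tr (S.lam • x) τ) = tr x (H.h 1 '' (S.lam⁻¹ • τ)) := by
  rw [tr, tr, ← Set.image_smul, ← Set.image_smul, Set.image_image, Set.image_image,
    Set.image_image, Set.image_image]
  exact Set.image_congr fun z hz => H.translate_inv_smul ht htx hu (cell_subset_supp hτ hz)

theorem mem_patch_of_image (hd : d ≤ 2) (hT : S.IsTiling T) {t u : S.Tile} (ht : t ∈ T)
    (hu : u ∈ S.subst {t}) {k : ℕ} {σ τ : Set (Eu d)} (hσ : σ ∈ S.cells T k)
    (hτ : τ ∈ S.cells {u} k) (h : H.h 1 '' (S.lam⁻¹ • τ) = σ) :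
    t ∈ S.patchAt T (S.opn T k σ) := by
  rw [hT.mem_patchAt_iff hd hσ, hT.mem_cells_iff_subset hd ht hσ]
  exact ⟨ht, h ▸ H.image_cell_subset ht hu hτ⟩

/-- A shrunk cell of ω(t) is mapped into t, so it can only be mapped onto σ if t contains σ. The
restriction to the patch T(σ°) is therefore automatic. -/
theorem cells_subst_patch (hd : d ≤ 2) (hT : S.IsTiling T) {k : ℕ} {σ : Set (Eu d)}
    (hσ : σ ∈ S.cells T k) :
    {τ | τ ∈ S.cells (S.subst (S.patchAt T (S.opn T k σ))) k ∧ H.h 1 '' (S.lam⁻¹ • τ) = σ} =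
      {τ ∈ S.cells (S.subst T) k | H.h 1 '' (S.lam⁻¹ • τ) = σ} := by
  ext τ
  refine and_congr_left fun h => ⟨fun hτ => cells_mono (subst_mono fun u hu => hu.1) _ hτ,
    fun hτ => ?_⟩
  obtain ⟨u, hu, hτu⟩ := mem_cells.1 hτ
  obtain ⟨t, ht, hut⟩ := mem_subst.1 hu
  exact mem_cells.2 ⟨u, mem_subst.2 ⟨t, H.mem_patch_of_image hd hT ht hut hσ hτu h, hut⟩, hτu⟩

/-- A cell of `ω(T)` whose shrunk copy is mapped onto `ρ` may be translated along with the patch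
`T(ρ°)`. -/
theorem translate_preimage (hd : d ≤ 2) (hT : S.IsTiling T) (hωT : S.IsTiling (S.subst T)) {k : ℕ}
    {ρ τ : Set (Eu d)} {x : Eu d} (hρ : ρ ∈ S.cells T k) (hρ' : tr x ρ ∈ S.cells T k)
    (hpatch : S.patchAt T (S.opn T k (tr x ρ)) = S.shift x (S.patchAt T (S.opn T k ρ)))
    (hτ : τ ∈ S.cells (S.subst T) k) (h : H.h 1 '' (S.lam⁻¹ • τ) = ρ) :
    tr (S.lam • x) τ ∈ S.cells (S.subst T) k ∧
      H.h 1 '' (S.lam⁻¹ • tr (S.lam • x) τ) = tr x ρ ∧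
      (∀ z ∈ τ, H.h 1 (S.lam⁻¹ • (z + S.lam • x)) = H.h 1 (S.lam⁻¹ • z) + x) ∧
      S.patchAt (S.subst T) (S.opn (S.subst T) k (tr (S.lam • x) τ)) =
        S.shift (S.lam • x) (S.patchAt (S.subst T) (S.opn (S.subst T) k τ)) := by
  have hshift : ∀ t : S.Tile, t ∈ S.patchAt T (S.opn T k ρ) →
      (t.1, t.2 + x) ∈ S.patchAt T (S.opn T k (tr x ρ)) := fun t ht => by
    rw [hpatch]; exact ⟨t, ht, rfl⟩
  have hsub : ∀ t u : S.Tile, u ∈ S.subst {t} → (u.1, u.2 + S.lam • x) ∈ S.subst {(t.1, t.2 + x)} :=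
    fun t u hu => by
      rw [← shift_singleton, subst_shift]
      exact ⟨u, hu, rfl⟩
  obtain ⟨u, hu, hτu⟩ := mem_cells.1 hτ
  obtain ⟨t, ht, hut⟩ := mem_subst.1 hu
  have htp := H.mem_patch_of_image hd hT ht hut hρ hτu h
  have htx := (hshift t htp).1
  have hcell : tr (S.lam • x) τ ∈ S.cells (S.subst T) k := by
    refine cells_tile_subset (mem_subst.2 ⟨_, htx, hsub t u hut⟩) k ?_
    rw [cells_translate]
    exact ⟨τ, hτu, rfl⟩
  have himg : H.h 1 '' (S.lam⁻¹ • tr (S.lam • x) τ) = tr x ρ := by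
    rw [H.image_translate ht htx hut hτu, h]
  refine ⟨hcell, himg,
    fun z hz => H.translate_inv_smul ht htx hut (cell_subset_supp hτu hz), ?_⟩
  ext v
  rw [hωT.mem_patchAt_iff hd hcell, mem_shift, hωT.mem_patchAt_iff hd hτ]
  have hv : v = (v.1, v.2 - S.lam • x + S.lam • x) := by simp
  have hc : tr (S.lam • x) τ ∈ S.cells {v} k ↔ τ ∈ S.cells {(v.1, v.2 - S.lam • x)} k := by
    have := cells_translate (S.lam • x) (v.1, v.2 - S.lam • x) k
    rw [← hv] at this
    rw [this, (tr_injective _).mem_set_image]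
  rw [hc]
  refine and_congr_left fun hτv => ⟨fun hvT => ?_, fun hvT => ?_⟩
  · obtain ⟨s, hs, hvs⟩ := mem_subst.1 hvT
    have hsp := H.mem_patch_of_image hd hT hs hvs hρ' (hc.2 hτv) himg
    rw [hpatch, mem_shift] at hsp
    refine mem_subst.2 ⟨_, hsp.1, ?_⟩
    have hs' : ({s} : Set S.Tile) = S.shift x {(s.1, s.2 - x)} := by simp [shift_singleton]
    rw [hs', subst_shift, mem_shift] at hvs
    exact hvs
  · obtain ⟨s, hs, hvs⟩ := mem_subst.1 hvT
    have hsp := H.mem_patch_of_image hd hT hs hvs hρ hτv h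
    rw [hv]
    exact mem_subst.2 ⟨_, (hshift s hsp).1, hsub s _ hvs⟩

end Homotopy

open Classical in
theorem sgn_one (o : S.Orientation) {T : Set S.Tile} (H : S.Homotopy T) (σ τ : Set (Eu d)) :
    S.sgn o H 1 σ τ = if H.h 1 (S.lam⁻¹ • o.src (S.subst T) τ) = o.src T σ ∧
        H.h 1 (S.lam⁻¹ • o.tgt (S.subst T) τ) = o.tgt T σ then 1
      else if H.h 1 (S.lam⁻¹ • o.src (S.subst T) τ) = o.tgt T σ ∧
        H.h 1 (S.lam⁻¹ • o.tgt (S.subst T) τ) = o.src T σ then -1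
      else 0 := by
  rw [sgn, if_pos rfl]

theorem sgn_of_ne (o : S.Orientation) {T : Set S.Tile} (H : S.Homotopy T) {k : ℕ} (hk : k ≠ 1)
    (σ τ : Set (Eu d)) : S.sgn o H k σ τ = 1 := by
  rw [sgn, if_neg hk]

/-- Translating by x in T means translating by λx in ω(T). This is a bijection between the cells
mapped onto a cell and onto its stable translate, and it preserves signs and stable classes. -/
theorem W_cls (hd : d ≤ 2) (hmaps : Set.MapsTo S.subst S.hull S.hull) (o : S.Orientation)
    {T : Set S.Tile} (hT : T ∈ S.hull) (H : S.Homotopy T) {k : ℕ} {σ : Set (Eu d)}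
    (hσ : σ ∈ S.cells T k) :
    S.W o H k (S.cls T T k σ) =
      ∑ᶠ τ ∈ {τ ∈ S.cells (S.subst T) k | H.h 1 '' (S.lam⁻¹ • τ) = σ},
        S.sgn o H k σ τ • S.cls T (S.subst T) k τ := by
  have hωT := hmaps hT
  rw [cls_eq_single (⟨σ, hσ⟩ : S.Cell T k) (StableEq.refl _ _ _), W,
    Finsupp.linearCombination_single, one_smul]
  obtain ⟨x, hx, hpatch⟩ := stableEq_rep (⟨σ, hσ⟩ : S.Cell T k)
  generalize StableCell.mk (⟨σ, hσ⟩ : S.Cell T k) = c at hx hpatch ⊢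
  change σ = tr x (S.rep c) at hx
  change _ = S.shift x (S.patchAt T (S.opn T k (S.rep c))) at hpatch
  have hρ := rep_mem c
  set ρ := S.rep c
  simp only at hpatch
  subst hx
  refine (finsum_set_coe_eq_finsum_mem
    (s := {τ | τ ∈ S.cells (S.subst (S.patchAt T (S.opn T k ρ))) k ∧ H.h 1 '' (S.lam⁻¹ • τ) = ρ})
    (f := fun τ => S.sgn o H k ρ τ • S.cls T (S.subst T) k τ)).trans ?_
  rw [H.cells_subst_patch hd hT.1 hρ]
  have hpatch' : S.patchAt T (S.opn T k (tr (-x) (tr x ρ))) =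
      S.shift (-x) (S.patchAt T (S.opn T k (tr x ρ))) := by
    rw [hpatch, S.shift_shift, tr_tr, add_neg_cancel, tr_zero, S.shift_zero]
  have hback : tr (-x) (tr x ρ) = ρ := by rw [tr_tr, add_neg_cancel, tr_zero]
  refine finsum_mem_eq_of_bijOn (tr (S.lam • x)) ⟨?_, (tr_injective _).injOn, ?_⟩ ?_
  · rintro τ ⟨h1, h2⟩
    obtain ⟨h3, h4, -⟩ := H.translate_preimage hd hT.1 hωT.1 hρ hσ hpatch h1 h2
    exact ⟨h3, h4⟩
  · rintro τ ⟨h1, h2⟩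
    obtain ⟨h3, h4, -⟩ := H.translate_preimage hd hT.1 hωT.1 hσ (hback.symm ▸ hρ) hpatch' h1 h2
    refine ⟨_, ⟨h3, h4.trans hback⟩, ?_⟩
    rw [tr_tr, ← smul_add, neg_add_cancel, smul_zero, tr_zero]
  · rintro τ ⟨h1, h2⟩
    obtain ⟨h3, h4, h5, h6⟩ := H.translate_preimage hd hT.1 hωT.1 hρ hσ hpatch h1 h2
    rw [cls_congr (T := T) (⟨_, rfl, h6⟩ :
      S.StableEq k (S.subst T) τ (S.subst T) (tr (S.lam • x) τ))]
    congr 1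
    by_cases hk : k = 1
    · subst hk
      obtain ⟨a1, a2⟩ := o.equivariant _ hωT _ hωT τ h1 _ h3 h6
      obtain ⟨a3, a4⟩ := o.equivariant _ hT _ hT ρ hρ x hσ hpatch
      rw [sgn_one, sgn_one, a1, a2, a3, a4, h5 _ (o.src_mem _ hωT τ h1).1,
        h5 _ (o.tgt_mem _ hωT τ h1).1]
      exact (if_congr (and_congr (add_left_inj x) (add_left_inj x)) rfl
        (if_congr (and_congr (add_left_inj x) (add_left_inj x)) rfl rfl)).symm
    · rw [sgn_of_ne o H hk, sgn_of_ne o H hk]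

end Substitution

end SubstTiling

namespace SubstTiling

/-! ## Counterclockwise parametrizations of the boundary of a planar disc -/

/-- `γ` is a counterclockwise parametrization of the boundary of the closed planar disc `f`. -/
structure IsBoundaryParam (f : Set (Eu 2)) (γ : ℝ → Eu 2) : Prop where
  continuous : Continuous γ
  eq_iff : ∀ x y, γ x = γ y ↔ ∃ n : ℤ, x = y + n
  range_eq : Set.range γ = frontier f
  winds : ∀ p ∈ interior f, WindsOnce γ p
  lift : ∀ s : Set ℝ, Convex ℝ s → ∀ β : ℝ → Eu 2, ContinuousOn β s → (∀ x ∈ s, β x ∈ frontier f) →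
    ∃ b : ℝ → ℝ, ContinuousOn b s ∧ ∀ x ∈ s, γ (b x) = β x
  fill : ∀ G : Eu 2 → ℂ, ContinuousOn G f → (∀ z ∈ f, G z ≠ 0) →
    ∃ M : ℝ → ℂ, Continuous M ∧ ∀ x, Complex.exp (M x) = G (γ x) ∧ M (x + 1) = M x

theorem continuous_planar : Continuous (planar : Eu 2 → ℂ) := by
  have : (planar : Eu 2 → ℂ) = planeEquiv := funext planar_eq
  rw [this]
  exact planeEquiv.continuous

theorem planar_injective : Function.Injective (planar : Eu 2 → ℂ) := by
  have : (planar : Eu 2 → ℂ) = planeEquiv := funext planar_eq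
  rw [this]
  exact planeEquiv.injective

/-- Points of the disc outside the open cell come from the unit circle, and such points are never
interior to an embedded disc. -/
theorem interior_eq_openCell {K : ℕ → Set (Set (Eu 2))} (hK : IsCellComplex K) {f : Set (Eu 2)}
    (hf : f ∈ K 2) (ho : IsOpen (openCell K 2 f)) : interior f = openCell K 2 f := by
  refine subset_antisymm ?_ (interior_maximal Set.sdiff_subset ho)
  obtain ⟨Φ, hc, hi, hr, hΦo⟩ := hK.exists_disc_param hf
  intro z hz
  have hzf := interior_subset hz
  rw [← hr] at hzf
  obtain ⟨w, hw, rfl⟩ := hzf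
  rw [← hΦo]
  refine ⟨w, ?_, rfl⟩
  by_contra hwb
  have hw1 : ‖w‖ = 1 := le_antisymm (by simpa using hw) (by simpa using hwb)
  refine image_closedBall_notMem_nhds (Φ := fun z => planeEquiv (Φ z))
    (planeEquiv.continuous.comp hc).continuousOn
    (fun x hx y hy hxy => hi hx hy (planeEquiv.injective hxy)) hw1 ?_
  have h1 : f ∈ nhds (Φ w) := mem_interior_iff_mem_nhds.1 hz
  have h2 := planeEquiv.toHomeomorph.isOpenMap.image_mem_nhds h1
  rw [← hr, Set.image_image] at h2
  exact h2

/-- The parametrization is the image of the unit circle, reflected if necessary. The property `lift`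
is path lifting for the circle, and `fill` holds because a nonvanishing function on the disc has a
logarithm there, which closes up along the boundary. -/
theorem exists_isBoundaryParam {K : ℕ → Set (Set (Eu 2))} (hK : IsCellComplex K) {f : Set (Eu 2)}
    (hf : f ∈ K 2) (ho : IsOpen (openCell K 2 f)) : ∃ γ, IsBoundaryParam f γ := by
  obtain ⟨Φ, hc, hi, hr, hΦo⟩ := hK.exists_disc_param hf
  have hint := interior_eq_openCell hK hf ho
  have hfront : frontier f = Φ '' Metric.sphere 0 1 := by
    rw [(hK.isCompact hf).isClosed.frontier_eq, hint, ← hΦo, ← hr,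
      ← (hi.image_sdiff_subset Metric.ball_subset_closedBall), Metric.closedBall_sdiff_ball]
  obtain ⟨σ, hσc, hσn, hσσ, hσw⟩ := exists_oriented_disc (Φ := fun z => planeEquiv (Φ z))
    (planeEquiv.continuous.comp hc) (fun x hx y hy hxy => hi hx hy (planeEquiv.injective hxy)) (by
      have h1 : f ∈ nhds (Φ 0) := by
        refine mem_interior_iff_mem_nhds.1 ?_
        rw [hint, ← hΦo]
        exact ⟨0, by simp, rfl⟩
      have h2 := planeEquiv.toHomeomorph.isOpenMap.image_mem_nhds h1
      rw [← hr, Set.image_image] at h2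
      exact h2)
  have hσinj : Function.Injective σ := fun x y h => by rw [← hσσ x, h, hσσ]
  have hσcirc : ∀ x, σ (circ x) ∈ Metric.closedBall (0 : ℂ) 1 := fun x => by
    simp [hσn, norm_circ]
  refine ⟨fun x => Φ (σ (circ x)), ?_, ?_, ?_, ?_, ?_, ?_⟩
  · exact hc.comp (hσc.comp continuous_circ)
  · intro x y
    rw [← circ_eq_circ_iff]
    exact ⟨fun h => hσinj (hi (hσcirc x) (hσcirc y) h), fun h => by rw [h]⟩
  · rw [hfront]
    ext z
    constructor
    · rintro ⟨x, rfl⟩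
      exact ⟨_, by simp [hσn, norm_circ], rfl⟩
    · rintro ⟨w, hw, rfl⟩
      obtain ⟨x, hx⟩ := exists_circ_eq (z := σ w) (by rw [hσn]; simpa using hw)
      exact ⟨x, by simp only [hx, hσσ]⟩
  · intro p hp
    rw [hint, ← hΦo] at hp
    obtain ⟨w, hw, rfl⟩ := hp
    obtain ⟨L, hLc, hL⟩ := hσw (σ w) (by simpa [hσn] using hw)
    refine ⟨L, hLc, fun x => ⟨?_, (hL x).2⟩⟩
    rw [planar_eq, planar_eq, (hL x).1, hσσ]
  · intro s hs β hβ hβf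
    have hβ' : ∀ x ∈ s, β x ∈ Φ '' Metric.closedBall 0 1 := fun x hx => by
      have := hβf x hx
      rw [hfront] at this
      exact Set.image_mono Metric.sphere_subset_closedBall this
    obtain ⟨b, hbc, hb⟩ := exists_circ_lift hs
      (g := fun x => σ (Function.invFunOn Φ (Metric.closedBall 0 1) (β x)))
      (hσc.comp_continuousOn ((continuousOn_invFunOn (isCompact_closedBall _ _)
        hc.continuousOn hi).comp hβ hβ')) (fun x hx => by
        have := hβf x hx
        rw [hfront] at this
        obtain ⟨w, hw, hwx⟩ := this
        rw [hσn, ← hwx, hi.leftInvOn_invFunOn (Metric.sphere_subset_closedBall hw)]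
        simpa using hw)
    refine ⟨b, hbc, fun x hx => ?_⟩
    simp only [hb x hx, hσσ]
    exact Function.invFunOn_eq (hβ' x hx)
  · intro G hG hG0
    have hΦf : ∀ w ∈ Metric.closedBall (0 : ℂ) 1, Φ w ∈ f := fun w hw => hr ▸ ⟨w, hw, rfl⟩
    obtain ⟨L, hLc, hL⟩ := exists_log (convex_closedBall (0 : ℂ) 1) (g := fun w => G (Φ w))
      (hG.comp hc.continuousOn hΦf) (fun w hw => hG0 _ (hΦf w hw))
    exact ⟨fun x => L (σ (circ x)), hLc.comp_continuous (hσc.comp continuous_circ) hσcirc,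
      fun x => ⟨hL _ (hσcirc x), by simp only [circ_add_one]⟩⟩

/-- Two proper arcs of `ℝ / ℤ` with the same points have the same ends. -/
theorem arc_unique {a b c d : ℝ} (hab : a < b) (hba : b < a + 1) (hcd : c < d) (hdc : d < c + 1)
    (h : ∀ x, (∃ n : ℤ, a + n ≤ x ∧ x ≤ b + n) ↔ ∃ n : ℤ, c + n ≤ x ∧ x ≤ d + n) :
    ∃ n : ℤ, c = a + n ∧ d = b + n := by
  have int_le : ∀ m : ℤ, ∀ k : ℤ, (m : ℝ) < k + 1 → (m : ℝ) ≤ k := fun m k hm => by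
    exact_mod_cast Int.lt_add_one_iff.1 (by exact_mod_cast hm)
  refine ⟨⌊c - a⌋, ?_⟩
  set n := ⌊c - a⌋
  have hn1 : (n : ℝ) ≤ c - a := Int.floor_le _
  have hn2 : c - a < n + 1 := Int.lt_floor_add_one _
  have h' : ∀ x, (∃ m : ℤ, a + m ≤ x ∧ x ≤ b + m) ↔ ∃ m : ℤ, c - n + m ≤ x ∧ x ≤ d - n + m := by
    intro x
    rw [h x]
    constructor
    · rintro ⟨m, h1, h2⟩
      exact ⟨m + n, by push_cast; linarith, by push_cast; linarith⟩
    · rintro ⟨m, h1, h2⟩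
      exact ⟨m - n, by push_cast; linarith, by push_cast; linarith⟩
  have hcb : c - n ≤ b := by
    obtain ⟨m, h1, h2⟩ := (h' (c - n)).2 ⟨0, by simp, by push_cast; linarith⟩
    have := int_le m 0 (by push_cast; linarith)
    push_cast at this
    linarith
  have hca : c - n = a := by
    -- If a < c - n, then a lies in an earlier translate of the second arc, which forces d - n ≥ a +
    -- 1. The second arc then contains the midpoint of the gap (b, a + 1), a point that the
    -- translates of the first arc miss.
    by_contra hne
    have hlt : a < c - n := lt_of_le_of_ne (by linarith) (Ne.symm hne)
    obtain ⟨m, h1, h2⟩ := (h' a).1 ⟨0, by simp, by push_cast; linarith⟩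
    have := int_le m (-1) (by push_cast; linarith)
    push_cast at this
    obtain ⟨k, h3, h4⟩ := (h' ((b + (a + 1)) / 2)).2 ⟨0, by push_cast; linarith,
      by push_cast; linarith⟩
    have h5 := int_le k 0 (by push_cast; linarith)
    push_cast at h5
    linarith
  refine ⟨by linarith, ?_⟩
  have h1 : d - n ≤ b := by
    obtain ⟨m, h1, h2⟩ := (h' (d - n)).2 ⟨0, by push_cast; linarith, by simp⟩
    have := int_le m 0 (by push_cast; linarith)
    push_cast at this
    linarith
  have h2 : b ≤ d - n := by
    obtain ⟨m, h1, h2⟩ := (h' b).1 ⟨0, by push_cast; linarith, by simp⟩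
    have := int_le m 0 (by push_cast; linarith)
    push_cast at this
    linarith
  linarith

namespace IsBoundaryParam

variable {f : Set (Eu 2)} {γ : ℝ → Eu 2} (hγ : IsBoundaryParam f γ)

include hγ

theorem add_int (x : ℝ) (n : ℤ) : γ (x + n) = γ x := (hγ.eq_iff _ _).2 ⟨n, rfl⟩

theorem mem_image_iff {A : Set ℝ} {x : ℝ} : γ x ∈ γ '' A ↔ ∃ n : ℤ, x - n ∈ A := by
  constructor
  · rintro ⟨y, hy, hxy⟩
    obtain ⟨n, hn⟩ := (hγ.eq_iff x y).1 hxy.symm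
    exact ⟨n, by rwa [hn, add_sub_cancel_right]⟩
  · rintro ⟨n, hn⟩
    exact ⟨_, hn, ((hγ.eq_iff _ _).2 ⟨n, by ring⟩).symm⟩

theorem image_Icc_injective {a b c d : ℝ} (hab : a < b) (hba : b < a + 1) (hcd : c < d)
    (hdc : d < c + 1) (h : γ '' Set.Icc a b = γ '' Set.Icc c d) :
    ∃ n : ℤ, c = a + n ∧ d = b + n := by
  refine arc_unique hab hba hcd hdc fun x => ?_
  have key : ∀ a b : ℝ, (∃ n : ℤ, a + n ≤ x ∧ x ≤ b + n) ↔ γ x ∈ γ '' Set.Icc a b := fun a b => by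
    rw [hγ.mem_image_iff]
    exact exists_congr fun n => by rw [Set.mem_Icc, le_sub_iff_add_le, sub_le_iff_le_add]
  rw [key, key, h]

/-- Along γ the logarithm grows by 2πi per unit of parameter. Hence a loop γ ∘ b with logarithmic
increment 2πi m must advance b by m. -/
theorem lift_add_one {p : Eu 2} (hp : p ∈ interior f) {b : ℝ → ℝ} (hb : Continuous b)
    (hper : ∀ x, γ (b (x + 1)) = γ (b x)) {L : ℝ → ℂ} (hL : Continuous L)
    (hexp : ∀ x, Complex.exp (L x) = planar (γ (b x)) - planar p) {m : ℤ}
    (hm : ∀ x, L (x + 1) = L x + m * (2 * Real.pi * Complex.I)) (x : ℝ) : b (x + 1) = b x + m := by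
  have hpi : (2 * Real.pi * Complex.I : ℂ) ≠ 0 := by simp [Real.pi_ne_zero]
  obtain ⟨n, hn⟩ := log_unique (s := (Set.univ : Set ℝ)) isPreconnected_univ
    (L := fun x => b (x + 1) * (2 * Real.pi * Complex.I))
    (M := fun x => b x * (2 * Real.pi * Complex.I)) (by fun_prop) (by fun_prop) (fun x _ => by
      obtain ⟨k, hk⟩ := (hγ.eq_iff _ _).1 (hper x)
      exact circ_eq_circ_iff.2 ⟨k, hk⟩)
  have hbn : ∀ x, b (x + 1) = b x + n := fun x => by
    have := hn x trivial
    simp only [← add_mul] at this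
    exact_mod_cast mul_right_cancel₀ hpi this
  obtain ⟨M, hMc, hM⟩ := hγ.winds p hp
  have hMn : ∀ k : ℤ, ∀ y : ℝ, M (y + k) = M y + k * (2 * Real.pi * Complex.I) := by
    intro k
    induction k using Int.induction_on with
    | zero => intro y; simp
    | succ k ih =>
      intro y
      have h1 := (hM (y + k)).2
      have h2 := ih y
      push_cast at h1 h2 ⊢
      rw [← add_assoc, h1, h2]
      ring
    | pred k ih =>
      intro y
      have h1 := (hM (y + (-k - 1))).2
      have h2 := ih y
      push_cast at h1 h2 ⊢
      rw [add_assoc, sub_add_cancel, h2] at h1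
      linear_combination -h1
  have := log_increment hL (hMc.comp hb) (g := fun x => planar (γ (b x)) - planar p) hexp
    (fun x => ((hM (b x)).1).symm) (x + 1) x
  simp only [Function.comp_apply] at this
  rw [hm, hbn, hMn, add_sub_cancel_left, add_sub_cancel_left] at this
  have h3 := mul_right_cancel₀ hpi this
  rw [hbn]
  have h4 : m = n := by exact_mod_cast h3
  rw [h4]

/-- Any parametrization η admitted in the definition lifts through γ to some θ. Both loops wind
once, so θ advances by 1 per period, and being injective on the arc it is increasing. Thus η runs
through the arc in the same direction as γ. -/
theorem counterclockwise_iff (hf : (interior f).Nonempty) {s u : ℝ} (hsu : s < u)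
    (hus : u < s + 1) {a b : Eu 2} :
    Counterclockwise f (γ '' Set.Icc s u) a b ↔ a = γ s ∧ b = γ u := by
  constructor
  · rintro ⟨η, hηc, hηp, hηi, hηr, hηw, s', u', hsu', hus', he, rfl, rfl⟩
    obtain ⟨p, hp⟩ := hf
    obtain ⟨θ, hθc, hθ⟩ := hγ.lift Set.univ convex_univ η hηc.continuousOn
      (fun x _ => hηr ▸ ⟨x, rfl⟩)
    rw [continuousOn_univ] at hθc
    replace hθ : ∀ x, γ (θ x) = η x := fun x => hθ x trivial
    obtain ⟨L, hLc, hL⟩ := hηw p hp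
    have hθ1 : ∀ x, θ (x + 1) = θ x + 1 := by
      have := hγ.lift_add_one hp hθc (fun x => by rw [hθ, hθ, hηp]) hLc (m := 1)
        (fun x => by rw [hθ, (hL x).1]) (fun x => by simpa using (hL x).2)
      simpa using this
    have hηint : ∀ (n : ℤ) x, η (x + n) = η x := by
      intro n
      have hper : Function.Periodic η 1 := hηp
      intro x
      simpa using hper.int_mul n x
    have hinj : Set.InjOn θ (Set.Icc s' u') := by
      intro x hx y hy hxy
      have h1 : η x = η y := by rw [← hθ, ← hθ, hxy]
      have hfr : ∀ z : ℝ, η (Int.fract z) = η z := fun z => by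
        have := hηint ⌊z⌋ (Int.fract z)
        rw [Int.fract_add_floor] at this
        exact this.symm
      have h2 : Int.fract x = Int.fract y := hηi ⟨Int.fract_nonneg _, Int.fract_lt_one _⟩
        ⟨Int.fract_nonneg _, Int.fract_lt_one _⟩ (by rw [hfr, hfr, h1])
      obtain ⟨n, hn⟩ := Int.fract_eq_fract.1 h2
      have h3 : (n : ℝ) < 1 := by rw [← hn]; linarith [hx.1, hx.2, hy.1, hy.2]
      have h4 : (-1 : ℝ) < n := by rw [← hn]; linarith [hx.1, hx.2, hy.1, hy.2]
      have h5 : n = 0 := by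
        have h3' : n < 1 := by exact_mod_cast h3
        have h4' : -1 < n := by exact_mod_cast h4
        omega
      rw [h5] at hn
      push_cast at hn
      linarith
    -- The remaining arc from u' to s'+1 must carry θ on to θ s' + 1. In a wrong order, the
    -- intermediate value theorem yields a boundary point visited by both arcs other than at their
    -- ends.
    have hlt : θ s' < θ u' ∧ θ u' < θ s' + 1 := by
      have hne : ∀ x ∈ Set.Icc u' (s' + 1), ∀ y ∈ Set.Icc s' u', θ x = θ y →
          x = y ∨ x = y + 1 := by
        intro x hx y hy hxy
        have h1 : η x = η y := by rw [← hθ, ← hθ, hxy]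
        have hfr : ∀ z : ℝ, η (Int.fract z) = η z := fun z => by
          have := hηint ⌊z⌋ (Int.fract z)
          rw [Int.fract_add_floor] at this
          exact this.symm
        have h2 : Int.fract x = Int.fract y := hηi ⟨Int.fract_nonneg _, Int.fract_lt_one _⟩
          ⟨Int.fract_nonneg _, Int.fract_lt_one _⟩ (by rw [hfr, hfr, h1])
        obtain ⟨n, hn⟩ := Int.fract_eq_fract.1 h2
        have h3 : (n : ℝ) < 2 := by rw [← hn]; linarith [hx.1, hx.2, hy.1, hy.2]
        have h4 : (-1 : ℝ) < n := by rw [← hn]; linarith [hx.1, hx.2, hy.1, hy.2]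
        have h3' : n < 2 := by exact_mod_cast h3
        have h4' : -1 < n := by exact_mod_cast h4
        have h5 : n = 0 ∨ n = 1 := by omega
        rcases h5 with h5 | h5
        · left
          rw [h5] at hn
          push_cast at hn
          linarith
        · right
          rw [h5] at hn
          push_cast at hn
          linarith
      have hs1 := hθ1 s'
      have hu1 : θ u' ≠ θ s' := fun h => hsu'.ne' (hinj ⟨hsu'.le, le_rfl⟩ ⟨le_rfl, hsu'.le⟩ h)
      have hu2 : θ u' ≠ θ s' + 1 := by
        rw [← hs1]
        intro h
        rcases hne (s' + 1) ⟨hus'.le, le_rfl⟩ u' ⟨hsu'.le, le_rfl⟩ h.symm with h | h <;> linarith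
      constructor
      · by_contra! hle
        have hlt' : θ u' < θ s' := lt_of_le_of_ne hle hu1
        obtain ⟨x, hx, hxs⟩ := intermediate_value_Icc hus'.le hθc.continuousOn
          (show θ s' ∈ Set.Icc (θ u') (θ (s' + 1)) from ⟨hlt'.le, by rw [hs1]; linarith⟩)
        rcases hne x hx s' ⟨le_rfl, hsu'.le⟩ hxs with h | h
        · rw [h] at hx
          linarith [hx.1]
        · rw [h, hs1] at hxs
          linarith
      · by_contra! hle
        have hlt' : θ s' + 1 < θ u' := lt_of_le_of_ne hle (Ne.symm hu2)
        obtain ⟨x, hx, hxs⟩ := intermediate_value_Icc hsu'.le hθc.continuousOn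
          (show θ s' + 1 ∈ Set.Icc (θ s') (θ u') from ⟨by linarith, hle⟩)
        rw [← hs1] at hxs
        rcases hne (s' + 1) ⟨hus'.le, le_rfl⟩ x hx hxs.symm with h | h
        · linarith [hx.2]
        · have : x = s' := by linarith
          rw [this, hs1] at hxs
          linarith
    have himg : θ '' Set.Icc s' u' = Set.Icc (θ s') (θ u') := by
      have hmono : StrictMonoOn θ (Set.Icc s' u') :=
        hθc.continuousOn.strictMonoOn_of_injOn_Icc hsu'.le hlt.1.le hinj
      refine subset_antisymm ?_ (intermediate_value_Icc hsu'.le hθc.continuousOn)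
      rintro _ ⟨x, hx, rfl⟩
      exact ⟨hmono.monotoneOn ⟨le_rfl, hsu'.le⟩ hx hx.1, hmono.monotoneOn hx ⟨hsu'.le, le_rfl⟩ hx.2⟩
    have hee : γ '' Set.Icc (θ s') (θ u') = γ '' Set.Icc s u := by
      rw [← he, ← himg, Set.image_image]
      simp only [hθ]
    obtain ⟨n, h1, h2⟩ := hγ.image_Icc_injective hlt.1 hlt.2 hsu hus hee
    rw [h1, h2, hγ.add_int, hγ.add_int, hθ, hθ]
    exact ⟨rfl, rfl⟩
  · rintro ⟨rfl, rfl⟩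
    refine ⟨γ, hγ.continuous, fun t => by simpa using hγ.add_int t 1, ?_, hγ.range_eq, hγ.winds,
      s, u, hsu, hus, rfl, rfl, rfl⟩
    intro x hx y hy hxy
    obtain ⟨n, hn⟩ := (hγ.eq_iff x y).1 hxy
    have h3 : (n : ℝ) < 1 := by linarith [hx.1, hx.2, hy.1, hy.2]
    have h4 : (-1 : ℝ) < n := by linarith [hx.1, hx.2, hy.1, hy.2]
    have h3' : n < 1 := by exact_mod_cast h3
    have h4' : -1 < n := by exact_mod_cast h4
    have h5 : n = 0 := by omega
    rw [hn, h5]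
    simp

end IsBoundaryParam

end SubstTiling

/-! ### Combinatorics of the boundary of a planar tile -/

namespace SubstTiling

namespace Substitution

/-- The open tile is the complement of the union of the other tiles, closed by local finiteness, and
of the finite lower skeleton of the tile. -/
theorem IsTiling.isOpen_opn_tile {d : ℕ} {S : Substitution d} {T : Set S.Tile} (hT : S.IsTiling T)
    (hd : d ≤ 2) {t : S.Tile} (ht : t ∈ T) : IsOpen (S.opn T d (S.supp t)) := by
  have hcl1 := hT.isClosed_iUnion_supp (T \ {t}) Set.sdiff_subset
  have hcl2 : IsClosed (skel (S.cells {t}) d) := by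
    have : skel (S.cells {t}) d = ⋃ j ∈ Set.Iio d, ⋃ τ ∈ S.cells {t} j, τ := by
      ext z
      simp [skel]
    rw [this]
    exact (Set.finite_Iio d).isClosed_biUnion fun j _ =>
      (cells_finite (Set.finite_singleton t) j).isClosed_biUnion fun τ hτ =>
        ((isCellComplex_singleton t).isCompact hτ).isClosed
  have : S.opn T d (S.supp t) = (⋃ u ∈ T \ {t}, S.supp u)ᶜ ∩ (skel (S.cells {t}) d)ᶜ := by
    ext z
    constructor
    · intro hz
      refine ⟨?_, ?_⟩
      · simp only [Set.mem_compl_iff, Set.mem_iUnion, not_exists]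
        intro u hu hzu
        exact hu.2 (hT.tile_eq hd ht hu.1 hz hzu)
      · rw [hT.opn_eq hd ht (supp_mem_cells rfl)] at hz
        exact hz.2
    · rintro ⟨h1, h2⟩
      rw [hT.opn_eq hd ht (supp_mem_cells rfl)]
      refine ⟨?_, h2⟩
      obtain ⟨u, hu, hzu⟩ := hT.exists_mem_supp z
      by_cases hut : u = t
      · rwa [← hut]
      · exact absurd (Set.mem_biUnion (show u ∈ T \ {t} from ⟨hu, hut⟩) hzu) h1
  rw [this]
  exact hcl1.isOpen_compl.inter hcl2.isOpen_compl

theorem vertex_of_mem_skel_one {d : ℕ} {S : Substitution d} {P : Set S.Tile} {z : Eu d}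
    (h : z ∈ skel (S.cells P) 1) : {z} ∈ S.cells P 0 := by
  obtain ⟨j, hj, τ, hτ, hz⟩ := h
  obtain rfl : j = 0 := by omega
  obtain ⟨t, ht, hτt⟩ := mem_cells.1 hτ
  obtain ⟨v, rfl⟩ := (isCellComplex_singleton t).exists_vertex hτt
  rwa [Set.mem_singleton_iff.1 hz]

theorem mem_skel_one_iff {d : ℕ} {S : Substitution d} {P : Set S.Tile} {z : Eu d} :
    z ∈ skel (S.cells P) 1 ↔ {z} ∈ S.cells P 0 :=
  ⟨vertex_of_mem_skel_one, fun h => ⟨0, one_pos, _, h, rfl⟩⟩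

/-- A counterclockwise parametrization of the boundary of a tile, together with parameters of the
initial and final points of the edges. -/
structure TileBoundary (S : Substitution 2) (t : S.Tile) where
  γ : ℝ → Eu 2
  param : IsBoundaryParam (S.supp t) γ
  frontier_eq : frontier (S.supp t) = skel (S.cells {t}) 2
  interior_eq : interior (S.supp t) = S.opn {t} 2 (S.supp t)
  init : Set (Eu 2) → ℝ
  term : Set (Eu 2) → ℝ
  lt : ∀ e ∈ S.cells {t} 1, init e < term e
  lt_add_one : ∀ e ∈ S.cells {t} 1, term e < init e + 1
  image_Icc : ∀ e ∈ S.cells {t} 1, γ '' Set.Icc (init e) (term e) = e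
  image_Ioo : ∀ e ∈ S.cells {t} 1, γ '' Set.Ioo (init e) (term e) = S.opn {t} 1 e

variable {S : Substitution 2}

theorem edge_subset_skel {t : S.Tile} {e : Set (Eu 2)} (he : e ∈ S.cells {t} 1) :
    e ⊆ skel (S.cells {t}) 2 := fun _ hz => ⟨1, one_lt_two, e, he, hz⟩

theorem IsTiling.nonempty_tileBoundary {T : Set S.Tile} (hT : S.IsTiling T) {t : S.Tile}
    (ht : t ∈ T) : Nonempty (TileBoundary S t) := by
  have hK := isCellComplex_singleton t
  have hf : S.supp t ∈ S.cells {t} 2 := supp_mem_cells rfl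
  have ho : IsOpen (openCell (S.cells {t}) 2 (S.supp t)) := by
    have := hT.isOpen_opn_tile le_rfl ht
    rwa [hT.opn_eq le_rfl ht hf] at this
  have hint := interior_eq_openCell hK hf ho
  have hfront : frontier (S.supp t) = skel (S.cells {t}) 2 := by
    rw [(hK.isCompact hf).isClosed.frontier_eq, hint, openCell, Set.sdiff_sdiff_right_self]
    exact Set.inter_eq_right.2 (skel_subset_supp t 2)
  obtain ⟨γ, hγ⟩ := exists_isBoundaryParam hK hf ho
  have harc : ∀ e, ∃ s u : ℝ, e ∈ S.cells {t} 1 → s < u ∧ u < s + 1 ∧ γ '' Set.Icc s u = e ∧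
      γ '' Set.Ioo s u = S.opn {t} 1 e := by
    intro e
    by_cases he : e ∈ S.cells {t} 1
    swap
    · exact ⟨0, 0, fun h => absurd h he⟩
    obtain ⟨ψ₀, hψ₀c, hψ₀i, hψ₀r, hψ₀o⟩ := hK.exists_arc_param he
    have hrange : ∀ ψ : ℝ → Eu 2, ψ '' Set.Icc 0 1 = e → ∀ x ∈ Set.Icc (0 : ℝ) 1,
        ψ x ∈ frontier (S.supp t) := fun ψ hr x hx => by
      rw [hfront]
      exact edge_subset_skel he (hr ▸ ⟨x, hx, rfl⟩)
    obtain ⟨b₀, hb₀c, hb₀⟩ := hγ.lift _ (convex_Icc 0 1) ψ₀ hψ₀c.continuousOn (hrange ψ₀ hψ₀r)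
    have hb₀i : Set.InjOn b₀ (Set.Icc 0 1) := fun x hx y hy hxy =>
      hψ₀i hx hy (by rw [← hb₀ x hx, ← hb₀ y hy, hxy])
    -- An injective lift of an edge is strictly monotone. The increasing case gives counterclockwise
    -- parameters directly.
    have hmain : ∀ (ψ : ℝ → Eu 2) (b : ℝ → ℝ), Set.InjOn ψ (Set.Icc 0 1) →
        ψ '' Set.Icc 0 1 = e → ψ '' Set.Ioo 0 1 = S.opn {t} 1 e → ContinuousOn b (Set.Icc 0 1) →
        (∀ x ∈ Set.Icc (0 : ℝ) 1, γ (b x) = ψ x) → StrictMonoOn b (Set.Icc 0 1) →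
        ∃ s u : ℝ, e ∈ S.cells {t} 1 → s < u ∧ u < s + 1 ∧ γ '' Set.Icc s u = e ∧
          γ '' Set.Ioo s u = S.opn {t} 1 e := by
      intro ψ b hi hr ho hc hb hmono
      have h0 : (0 : ℝ) ∈ Set.Icc (0 : ℝ) 1 := by simp
      have h1 : (1 : ℝ) ∈ Set.Icc (0 : ℝ) 1 := by simp
      have himg : b '' Set.Icc 0 1 = Set.Icc (b 0) (b 1) := by
        refine subset_antisymm ?_ (intermediate_value_Icc zero_le_one hc)
        rintro _ ⟨x, hx, rfl⟩
        exact ⟨hmono.monotoneOn h0 hx hx.1, hmono.monotoneOn hx h1 hx.2⟩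
      have himg' : b '' Set.Ioo 0 1 = Set.Ioo (b 0) (b 1) := by
        refine subset_antisymm ?_ (intermediate_value_Ioo zero_le_one hc)
        rintro _ ⟨x, hx, rfl⟩
        exact ⟨hmono h0 (Set.Ioo_subset_Icc_self hx) hx.1,
          hmono (Set.Ioo_subset_Icc_self hx) h1 hx.2⟩
      refine ⟨b 0, b 1, fun _ => ⟨hmono h0 h1 one_pos, ?_, ?_, ?_⟩⟩
      · by_contra! hle
        obtain ⟨x, hx, hxs⟩ := intermediate_value_Icc zero_le_one hc
          (show b 0 + 1 ∈ Set.Icc (b 0) (b 1) from ⟨by linarith, hle⟩)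
        have h2 : ψ x = ψ 0 := by
          rw [← hb x hx, ← hb 0 h0, hxs]
          simpa using hγ.add_int (b 0) 1
        rw [hi hx h0 h2] at hxs
        linarith
      · rw [← himg, Set.image_image, ← hr]
        exact Set.image_congr hb
      · rw [← himg', Set.image_image, ← ho]
        exact Set.image_congr fun x hx => hb x (Set.Ioo_subset_Icc_self hx)
    rcases hb₀c.strictMonoOn_of_injOn_Icc' zero_le_one hb₀i with hmono | hanti
    · exact hmain ψ₀ b₀ hψ₀i hψ₀r hψ₀o hb₀c hb₀ hmono
    -- A decreasing lift means that the edge was parametrized clockwise, and reversing it reduces to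
    -- the increasing case.
    · have hflip : ∀ x ∈ Set.Icc (0 : ℝ) 1, 1 - x ∈ Set.Icc (0 : ℝ) 1 := fun x hx =>
        ⟨by linarith [hx.2], by linarith [hx.1]⟩
      have himgc : (fun x : ℝ => 1 - x) '' Set.Icc 0 1 = Set.Icc 0 1 := by simp
      have himgo : (fun x : ℝ => 1 - x) '' Set.Ioo 0 1 = Set.Ioo 0 1 := by simp
      refine hmain (fun x => ψ₀ (1 - x)) (fun x => b₀ (1 - x)) ?_ ?_ ?_ ?_ ?_ ?_
      · intro x hx y hy hxy
        have := hψ₀i (hflip x hx) (hflip y hy) hxy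
        linarith
      · rw [← hψ₀r]
        conv_rhs => rw [← himgc, Set.image_image]
      · change _ = openCell (S.cells {t}) 1 e
        rw [← hψ₀o]
        conv_rhs => rw [← himgo, Set.image_image]
      · exact hb₀c.comp (by fun_prop) hflip
      · exact fun x hx => hb₀ _ (hflip x hx)
      · exact fun x hx y hy hxy => hanti (hflip y hy) (hflip x hx) (by linarith)
  choose init term hit using harc
  exact ⟨⟨γ, hγ, hfront, hint, init, term, fun e he => (hit e he).1, fun e he => (hit e he).2.1,
    fun e he => (hit e he).2.2.1, fun e he => (hit e he).2.2.2⟩⟩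

namespace TileBoundary

variable {t : S.Tile} (B : TileBoundary S t)

theorem range_eq : Set.range B.γ = skel (S.cells {t}) 2 := by
  rw [B.param.range_eq, B.frontier_eq]

theorem mem_edge_iff {e : Set (Eu 2)} (he : e ∈ S.cells {t} 1) {x : ℝ} :
    B.γ x ∈ e ↔ ∃ n : ℤ, B.init e + n ≤ x ∧ x ≤ B.term e + n := by
  conv_lhs => rw [← B.image_Icc e he, B.param.mem_image_iff]
  exact exists_congr fun n => by rw [Set.mem_Icc, le_sub_iff_add_le, sub_le_iff_le_add]

theorem mem_opn_iff {e : Set (Eu 2)} (he : e ∈ S.cells {t} 1) {x : ℝ} :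
    B.γ x ∈ S.opn {t} 1 e ↔ ∃ n : ℤ, B.init e + n < x ∧ x < B.term e + n := by
  rw [← B.image_Ioo e he, B.param.mem_image_iff]
  exact exists_congr fun n => by rw [Set.mem_Ioo, lt_sub_iff_add_lt, sub_lt_iff_lt_add]

theorem not_vertex_iff {e : Set (Eu 2)} {x : ℝ} (hx : B.γ x ∈ e) :
    {B.γ x} ∈ S.cells {t} 0 ↔ B.γ x ∉ S.opn {t} 1 e := by
  rw [← mem_skel_one_iff, opn, openCell, Set.mem_sdiff]
  simp [hx]

theorem init_mem {e : Set (Eu 2)} (he : e ∈ S.cells {t} 1) : B.γ (B.init e) ∈ e := by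
  rw [B.mem_edge_iff he]
  exact ⟨0, by simp, by simpa using (B.lt e he).le⟩

theorem term_mem {e : Set (Eu 2)} (he : e ∈ S.cells {t} 1) : B.γ (B.term e) ∈ e := by
  rw [B.mem_edge_iff he]
  exact ⟨0, by simpa using (B.lt e he).le, by simp⟩

theorem int_le_of_lt_add_one {m k : ℤ} (h : (m : ℝ) < k + 1) : (m : ℝ) ≤ k := by
  exact_mod_cast Int.lt_add_one_iff.1 (by exact_mod_cast h)

theorem vertex_init {e : Set (Eu 2)} (he : e ∈ S.cells {t} 1) :
    {B.γ (B.init e)} ∈ S.cells {t} 0 := by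
  rw [B.not_vertex_iff (B.init_mem he), B.mem_opn_iff he]
  rintro ⟨n, h1, h2⟩
  have h3 := B.lt_add_one e he
  have := int_le_of_lt_add_one (m := n) (k := -1) (by push_cast; linarith)
  push_cast at this
  linarith

theorem vertex_term {e : Set (Eu 2)} (he : e ∈ S.cells {t} 1) :
    {B.γ (B.term e)} ∈ S.cells {t} 0 := by
  rw [B.not_vertex_iff (B.term_mem he), B.mem_opn_iff he]
  rintro ⟨n, h1, h2⟩
  have h3 := B.lt_add_one e he
  have := int_le_of_lt_add_one (m := n) (k := 0) (by push_cast; linarith)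
  push_cast at this
  linarith

/-- A boundary parameter of a vertex in an edge is the initial or the final parameter of the edge. -/
theorem param_vertex {e : Set (Eu 2)} (he : e ∈ S.cells {t} 1) {x : ℝ} (hx : B.γ x ∈ e)
    (hv : {B.γ x} ∈ S.cells {t} 0) : ∃ n : ℤ, x = B.init e + n ∨ x = B.term e + n := by
  rw [B.not_vertex_iff hx, B.mem_opn_iff he] at hv
  obtain ⟨n, h1, h2⟩ := (B.mem_edge_iff he).1 hx
  refine ⟨n, ?_⟩
  by_contra! h
  exact hv ⟨n, lt_of_le_of_ne h1 h.1.symm, lt_of_le_of_ne h2 h.2⟩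

theorem vertex_eq {e : Set (Eu 2)} (he : e ∈ S.cells {t} 1) {v : Eu 2} (hv : v ∈ e)
    (hv0 : {v} ∈ S.cells {t} 0) : v = B.γ (B.init e) ∨ v = B.γ (B.term e) := by
  have : v ∈ Set.range B.γ := by rw [B.range_eq]; exact edge_subset_skel he hv
  obtain ⟨x, rfl⟩ := this
  obtain ⟨n, rfl | rfl⟩ := B.param_vertex he hv hv0
  · exact Or.inl (B.param.add_int _ _)
  · exact Or.inr (B.param.add_int _ _)

theorem init_ne_term {e : Set (Eu 2)} (he : e ∈ S.cells {t} 1) :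
    B.γ (B.init e) ≠ B.γ (B.term e) := by
  intro h
  obtain ⟨n, hn⟩ := (B.param.eq_iff _ _).1 h
  have h1 := B.lt e he
  have h2 := B.lt_add_one e he
  have := int_le_of_lt_add_one (m := n) (k := -1) (by push_cast; linarith)
  push_cast at this
  linarith

theorem eventually_ne_vertex {v : Eu 2} (x : ℝ) : ∀ᶠ y in nhdsWithin x {x}ᶜ, B.γ y ≠ v := by
  by_cases hv : B.γ x = v
  · filter_upwards [self_mem_nhdsWithin,
      mem_nhdsWithin_of_mem_nhds (Ioo_mem_nhds (sub_one_lt x) (_root_.lt_add_one x))] with y hy1 hy2 h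
    rw [← hv] at h
    obtain ⟨n, hn⟩ := (B.param.eq_iff _ _).1 h
    have h1 := int_le_of_lt_add_one (m := n) (k := 0) (by push_cast; linarith [hy2.2])
    have h2 := int_le_of_lt_add_one (m := -n) (k := 0) (by push_cast; linarith [hy2.1])
    push_cast at h1 h2
    exact hy1 (by rw [Set.mem_singleton_iff, hn]; linarith)
  · exact mem_nhdsWithin_of_mem_nhds (B.param.continuous.continuousAt.eventually_ne hv)

/-- Boundary points lie in edges or vertices. Parameters near x avoid all vertices and all edges not
through γ x, so a one-sided filter avoiding the edges through γ x as well must be trivial. -/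
theorem eventually_mem_edge {x : ℝ} {F : Filter ℝ} (hF : F ≤ nhdsWithin x {x}ᶜ)
    (h : ∀ e ∈ S.cells {t} 1, B.γ x ∈ e → ∀ᶠ y in F, B.γ y ∉ e) : ∀ᶠ _ in F, False := by
  have h1 : ∀ᶠ y in F, ∀ e ∈ S.cells {t} 1, B.γ y ∉ e := by
    refine (cells_finite (Set.finite_singleton t) 1).eventually_all.2 fun e he => ?_
    by_cases hx : B.γ x ∈ e
    · exact h e he hx
    · have hcl : IsClosed e := ((isCellComplex_singleton t).isCompact he).isClosed
      exact hF.trans nhdsWithin_le_nhds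
        (B.param.continuous.continuousAt (hcl.isOpen_compl.mem_nhds hx))
  have h2 : ∀ᶠ y in F, ∀ τ ∈ S.cells {t} 0, B.γ y ∉ τ := by
    refine (cells_finite (Set.finite_singleton t) 0).eventually_all.2 fun τ hτ => ?_
    obtain ⟨v, rfl⟩ := (isCellComplex_singleton t).exists_vertex hτ
    exact hF (B.eventually_ne_vertex x)
  filter_upwards [h1, h2] with y h1 h2
  have : B.γ y ∈ skel (S.cells {t}) 2 := by rw [← B.range_eq]; exact ⟨y, rfl⟩
  obtain ⟨j, hj, τ, hτ, hy⟩ := this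
  interval_cases j
  · exact h2 τ hτ hy
  · exact h1 τ hτ hy

/-- If every edge through v ended there, the parameters just after v would lie in no edge. -/
theorem exists_init_eq {v : Eu 2} (hv : {v} ∈ S.cells {t} 0) :
    ∃ e ∈ S.cells {t} 1, B.γ (B.init e) = v := by
  have : v ∈ Set.range B.γ := by rw [B.range_eq]; exact ⟨0, two_pos, _, hv, rfl⟩
  obtain ⟨x, rfl⟩ := this
  by_contra! hno
  have := B.eventually_mem_edge (x := x) (F := nhdsWithin x (Set.Ioi x))
    (nhdsWithin_mono _ fun y hy => ne_of_gt hy) (fun e he hx => by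
      obtain ⟨n, hn⟩ := B.param_vertex he hx hv
      have hn' : x = B.term e + n := hn.resolve_left fun h => hno e he (by
        rw [h, B.param.add_int])
      have hlt : x < B.init e + n + 1 := by
        rw [hn']; linarith [B.lt_add_one e he]
      filter_upwards [Ioo_mem_nhdsGT hlt] with y hy hye
      obtain ⟨m, h1, h2⟩ := (B.mem_edge_iff he).1 hye
      have h3 := int_le_of_lt_add_one (m := m) (k := n) (by linarith [hy.2])
      linarith [hy.1])
  obtain ⟨y, hy⟩ := this.exists
  exact hy

theorem exists_term_eq {v : Eu 2} (hv : {v} ∈ S.cells {t} 0) :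
    ∃ e ∈ S.cells {t} 1, B.γ (B.term e) = v := by
  have : v ∈ Set.range B.γ := by rw [B.range_eq]; exact ⟨0, two_pos, _, hv, rfl⟩
  obtain ⟨x, rfl⟩ := this
  by_contra! hno
  have := B.eventually_mem_edge (x := x) (F := nhdsWithin x (Set.Iio x))
    (nhdsWithin_mono _ fun y hy => ne_of_lt hy) (fun e he hx => by
      obtain ⟨n, hn⟩ := B.param_vertex he hx hv
      have hn' : x = B.init e + n := hn.resolve_right fun h => hno e he (by
        rw [h, B.param.add_int])
      have hlt : B.term e + n - 1 < x := by
        rw [hn']; linarith [B.lt_add_one e he]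
      filter_upwards [Ioo_mem_nhdsLT hlt] with y hy hye
      obtain ⟨m, h1, h2⟩ := (B.mem_edge_iff he).1 hye
      have h3 := int_le_of_lt_add_one (m := n) (k := m) (by linarith [hy.1])
      linarith [hy.2])
  obtain ⟨y, hy⟩ := this.exists
  exact hy

theorem edge_eq_of_opn {e e' : Set (Eu 2)} (he : e ∈ S.cells {t} 1) (he' : e' ∈ S.cells {t} 1)
    {z : Eu 2} (h : z ∈ S.opn {t} 1 e) (h' : z ∈ S.opn {t} 1 e') : e = e' := by
  by_contra hne
  exact Set.disjoint_left.1 ((isCellComplex_singleton t).disjoint 1 e he e' he' hne) h h'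

/-- Edges with a common initial point share the parameters just after it, so their open cells meet.
-/
theorem init_injOn : Set.InjOn (fun e => B.γ (B.init e)) (S.cells {t} 1) := by
  intro e he e' he' h
  obtain ⟨n, hn⟩ := (B.param.eq_iff _ _).1 h
  have h1 := B.lt e he
  have h2 := B.lt e' he'
  have h3 : B.init e < min (B.term e) (B.term e' + n) := lt_min h1 (by rw [hn]; linarith)
  obtain ⟨x, hx1, hx2⟩ := exists_between h3
  have h4 := hx2.trans_le (min_le_left _ _)
  have h5 := hx2.trans_le (min_le_right _ _)
  refine edge_eq_of_opn he he' (z := B.γ x) ((B.mem_opn_iff he).2 ⟨0, by simpa, by simpa⟩)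
    ((B.mem_opn_iff he').2 ⟨n, by rw [← hn]; exact hx1, h5⟩)

theorem term_injOn : Set.InjOn (fun e => B.γ (B.term e)) (S.cells {t} 1) := by
  intro e he e' he' h
  obtain ⟨n, hn⟩ := (B.param.eq_iff _ _).1 h
  have h1 := B.lt e he
  have h2 := B.lt e' he'
  have h3 : max (B.init e) (B.init e' + n) < B.term e := max_lt h1 (by rw [hn]; linarith)
  obtain ⟨x, hx1, hx2⟩ := exists_between h3
  have h4 := (le_max_left _ _).trans_lt hx1
  have h5 := (le_max_right _ _).trans_lt hx1
  refine edge_eq_of_opn he he' (z := B.γ x) ((B.mem_opn_iff he).2 ⟨0, by simpa, by simpa⟩)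
    ((B.mem_opn_iff he').2 ⟨n, h5, by rw [← hn]; exact hx2⟩)

/-- The edges of a tile. -/
noncomputable def edges (t : S.Tile) : Finset (Set (Eu 2)) :=
  (cells_finite (S := S) (Set.finite_singleton t) 1).toFinset

theorem mem_edges {e : Set (Eu 2)} : e ∈ edges t ↔ e ∈ S.cells {t} 1 := by
  simp [edges]

/-- Every vertex is the initial point of exactly one edge and the final point of exactly one, so the
sum telescopes around the boundary. -/
theorem sum_sub_eq_zero {A : Type*} [AddCommGroup A] (g : Eu 2 → A) :
    ∑ e ∈ edges t, (g (B.γ (B.term e)) - g (B.γ (B.init e))) = 0 := by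
  classical
  rw [Finset.sum_sub_distrib, sub_eq_zero]
  let V : Finset (Eu 2) := (edges t).image fun e => B.γ (B.init e)
  have hV : V = (edges t).image fun e => B.γ (B.term e) := by
    ext v
    simp only [V, Finset.mem_image, mem_edges]
    constructor
    · rintro ⟨e, he, rfl⟩
      exact B.exists_term_eq (B.vertex_init he)
    · rintro ⟨e, he, rfl⟩
      exact B.exists_init_eq (B.vertex_term he)
  rw [← Finset.sum_image (f := g) (g := fun e => B.γ (B.term e)),
    ← Finset.sum_image (f := g) (g := fun e => B.γ (B.init e)), ← hV]
  · exact fun e he e' he' h => B.init_injOn (mem_edges.1 he) (mem_edges.1 he') h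
  · exact fun e he e' he' h => B.term_injOn (mem_edges.1 he) (mem_edges.1 he') h

theorem exists_edge (B : TileBoundary S t) : ∃ e, e ∈ S.cells {t} 1 := by
  have : B.γ 0 ∈ skel (S.cells {t}) 2 := by rw [← B.range_eq]; exact ⟨0, rfl⟩
  obtain ⟨j, hj, τ, hτ, hy⟩ := this
  interval_cases j
  · obtain ⟨v, rfl⟩ := (isCellComplex_singleton t).exists_vertex hτ
    obtain ⟨e, he, -⟩ := B.exists_init_eq hτ
    exact ⟨e, he⟩
  · exact ⟨τ, hτ⟩

/-- The number of integral translates of an interior parameter of `e₀` that an edge crosses. -/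
theorem floor_sub_floor {e₀ e : Set (Eu 2)} (he₀ : e₀ ∈ S.cells {t} 1) (he : e ∈ S.cells {t} 1)
    {p : ℝ} (hp : p ∈ Set.Ioo (B.init e₀) (B.term e₀)) :
    (⌊B.term e - p⌋ - ⌊B.init e - p⌋ : ℤ) = if e = e₀ then 1 else 0 := by
  have h1 := B.lt e he
  have h2 := B.lt_add_one e he
  split_ifs with h
  · subst h
    have h3 : ⌊B.term e - p⌋ = 0 := by
      rw [Int.floor_eq_iff]
      constructor <;> push_cast <;> linarith [hp.1, hp.2]
    have h4 : ⌊B.init e - p⌋ = -1 := by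
      rw [Int.floor_eq_iff]
      constructor <;> push_cast <;> linarith [hp.1, hp.2]
    rw [h3, h4]
    rfl
  · rw [sub_eq_zero]
    by_contra hne
    have hle : ⌊B.init e - p⌋ ≤ ⌊B.term e - p⌋ := Int.floor_le_floor (by linarith)
    have hlt : ⌊B.init e - p⌋ < ⌊B.term e - p⌋ := lt_of_le_of_ne hle (Ne.symm hne)
    set n := ⌊B.term e - p⌋
    have h3 : (n : ℝ) ≤ B.term e - p := Int.floor_le _
    have h4 : B.init e - p < n := Int.floor_lt.1 hlt
    have h5 : B.γ p ∈ e := (B.mem_edge_iff he).2 ⟨-n, by push_cast; linarith, by push_cast; linarith⟩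
    have h6 : B.γ p ∈ S.opn {t} 1 e₀ := (B.mem_opn_iff he₀).2 ⟨0, by simpa using hp.1,
      by simpa using hp.2⟩
    by_cases h7 : {B.γ p} ∈ S.cells {t} 0
    · exact h6.2 (mem_skel_one_iff.2 h7)
    · rw [B.not_vertex_iff h5, not_not] at h7
      exact h (edge_eq_of_opn he he₀ h7 h6)

/-- Subtracting c⌊x - p⌋, with p interior to one edge, leaves a 1-periodic function, that is, a
function on the boundary, whose increments cancel. The floor contributes c on that one edge. -/
theorem sum_increment {F : ℝ → ℤ} {c : ℤ} (hF : ∀ x, F (x + 1) = F x + c) :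
    ∑ e ∈ edges t, (F (B.term e) - F (B.init e)) = c := by
  classical
  obtain ⟨e₀, he₀⟩ := B.exists_edge
  obtain ⟨p, hp⟩ := exists_between (B.lt e₀ he₀)
  have hper : ∀ (n : ℤ) (x : ℝ), F (x + n) - c * ⌊x + n - p⌋ = F x - c * ⌊x - p⌋ := by
    intro n
    induction n using Int.induction_on with
    | zero => simp
    | succ n ih =>
      intro x
      have h1 := ih x
      have h2 := hF (x + n)
      have h3 : ⌊x + ((n : ℤ) + 1 : ℤ) - p⌋ = ⌊x + n - p⌋ + 1 := by
        rw [← Int.floor_add_one]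
        congr 1
        push_cast
        ring
      rw [h3]
      push_cast at h1 h2 ⊢
      rw [← add_assoc, h2]
      linear_combination h1
    | pred n ih =>
      intro x
      have h1 := ih x
      have h2 := hF (x + (-n - 1))
      have h3 : ⌊x + -n - p⌋ = ⌊x + (-(n : ℤ) - 1 : ℤ) - p⌋ + 1 := by
        rw [← Int.floor_add_one]
        congr 1
        push_cast
        ring
      push_cast at h1 h2 h3 ⊢
      rw [show x + (-(n : ℝ) - 1) + 1 = x + -n by ring] at h2
      rw [h3] at h1
      linear_combination h1 - h2
  -- By periodicity the value does not depend on the chosen parameter of z.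
  let g : Eu 2 → ℤ := fun z => if h : ∃ x, B.γ x = z then F h.choose - c * ⌊h.choose - p⌋ else 0
  have hg : ∀ x, g (B.γ x) = F x - c * ⌊x - p⌋ := by
    intro x
    have hex : ∃ y, B.γ y = B.γ x := ⟨x, rfl⟩
    simp only [g, dif_pos hex]
    obtain ⟨n, hn⟩ := (B.param.eq_iff _ _).1 hex.choose_spec
    rw [hn, hper]
  have h1 := B.sum_sub_eq_zero g
  simp only [hg] at h1
  have h2 : ∑ e ∈ edges t, (⌊B.term e - p⌋ - ⌊B.init e - p⌋ : ℤ) = 1 := by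
    rw [Finset.sum_congr rfl fun e he => B.floor_sub_floor he₀ (mem_edges.1 he) hp]
    rw [Finset.sum_ite_eq', if_pos (mem_edges.2 he₀)]
  have h3 : ∑ e ∈ edges t, (F (B.term e) - F (B.init e)) =
      ∑ e ∈ edges t, (F (B.term e) - c * ⌊B.term e - p⌋ - (F (B.init e) - c * ⌊B.init e - p⌋)) +
      c * ∑ e ∈ edges t, (⌊B.term e - p⌋ - ⌊B.init e - p⌋ : ℤ) := by
    rw [Finset.mul_sum, ← Finset.sum_add_distrib]
    exact Finset.sum_congr rfl fun e _ => by ring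
  rw [h3, h1, h2, zero_add, mul_one]

end TileBoundary

end Substitution

end SubstTiling

/-! ### Double sums, and the vanishing of δ¹δ⁰ -/

namespace SubstTiling

/-- Collecting coefficients reduces identities between composites of δ and `W` to integer identities
for each single cell, although the sums run over subsets of infinite sets of cells. -/
theorem finsum_mem_finsum_mem_smul {ι κ M : Type*} [AddCommGroup M] {s : Set ι} (hs : s.Finite)
    {t : ι → Set κ} (ht : ∀ i ∈ s, (t i).Finite) (m : ι → κ → ℤ) (x : κ → M) :
    ∑ᶠ i ∈ s, ∑ᶠ j ∈ t i, m i j • x j =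
      ∑ᶠ j, (∑ᶠ i ∈ {i ∈ s | j ∈ t i}, m i j) • x j := by
  classical
  have hU : (⋃ i ∈ s, t i).Finite := hs.biUnion ht
  have hC : ∀ j, ∑ᶠ i ∈ {i ∈ s | j ∈ t i}, m i j =
      ∑ i ∈ hs.toFinset, if j ∈ t i then m i j else 0 := by
    intro j
    rw [finsum_mem_eq_finite_toFinset_sum _ (hs.subset (Set.sep_subset _ _)), ← Finset.sum_filter]
    refine Finset.sum_congr ?_ fun _ _ => rfl
    ext i
    simp
  have hR : ∑ᶠ j, (∑ᶠ i ∈ {i ∈ s | j ∈ t i}, m i j) • x j =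
      ∑ j ∈ hU.toFinset, (∑ i ∈ hs.toFinset, if j ∈ t i then m i j else 0) • x j := by
    simp only [hC]
    refine finsum_eq_sum_of_support_subset _ fun j hj => ?_
    rw [Set.Finite.coe_toFinset]
    by_contra hjU
    simp only [Set.mem_iUnion, not_exists] at hjU
    refine hj ?_
    show _ • _ = _
    rw [Finset.sum_eq_zero, zero_smul]
    intro i hi
    rw [if_neg (hjU i (hs.mem_toFinset.1 hi))]
  rw [hR, finsum_mem_eq_finite_toFinset_sum _ hs]
  simp only [Finset.sum_smul]
  rw [Finset.sum_comm]
  refine Finset.sum_congr rfl fun i hi => ?_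
  have hi' := hs.mem_toFinset.1 hi
  rw [finsum_mem_eq_finite_toFinset_sum _ (ht i hi')]
  simp only [ite_smul, zero_smul]
  rw [← Finset.sum_filter]
  refine Finset.sum_congr ?_ fun _ _ => rfl
  ext j
  simp only [Set.Finite.mem_toFinset, Finset.mem_filter, Set.mem_iUnion]
  exact ⟨fun h => ⟨⟨i, hi', h⟩, h⟩, fun h => h.2⟩

theorem map_finsum_mem_smul {ι M N : Type*} [AddCommGroup M] [AddCommGroup N] (g : M →ₗ[ℤ] N)
    {s : Set ι} (hs : s.Finite) (a : ι → ℤ) (x : ι → M) :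
    g (∑ᶠ i ∈ s, a i • x i) = ∑ᶠ i ∈ s, a i • g (x i) := by
  rw [← LinearMap.toAddMonoidHom_coe, AddMonoidHom.map_finsum_mem _ _ hs]
  simp

theorem finsum_mem_smul_finsum_mem {ι κ M : Type*} [AddCommGroup M] {s : Set ι} (hs : s.Finite)
    {t : ι → Set κ} (ht : ∀ i ∈ s, (t i).Finite) (a : ι → ℤ) (c : ι → κ → ℤ) (x : κ → M) :
    ∑ᶠ i ∈ s, a i • ∑ᶠ j ∈ t i, c i j • x j =
      ∑ᶠ j, (∑ᶠ i ∈ {i ∈ s | j ∈ t i}, a i * c i j) • x j := by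
  rw [← finsum_mem_finsum_mem_smul hs ht]
  refine finsum_mem_congr rfl fun i hi => ?_
  have h := map_finsum_mem_smul (a i • LinearMap.id (R := ℤ) (M := M)) (ht i hi) (c i) x
  rw [LinearMap.smul_apply, LinearMap.id_apply] at h
  rw [h]
  simp only [LinearMap.smul_apply, LinearMap.id_apply, mul_smul]
  exact finsum_mem_congr rfl fun j _ => smul_comm _ _ _

namespace Substitution

section

variable {d : ℕ} {S : Substitution d}

/-- The `(k+1)`-cells that contain a given `k`-cell. -/
def cofaces (S : Substitution d) (T : Set S.Tile) (k : ℕ) (σ : Set (Eu d)) : Set (Set (Eu d)) :=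
  {τ ∈ S.cells T (k + 1) | σ ⊆ τ}

theorem IsTiling.finite_cofaces {T : Set S.Tile} (hT : S.IsTiling T) {k : ℕ} {σ : Set (Eu d)}
    (hσ : σ ∈ S.cells T k) : (S.cofaces T k σ).Finite := by
  have h1 := hT.patchAt_finite_of_isBounded (hT.isCompact_cell hσ).isBounded
  refine (cells_finite h1 (k + 1)).subset ?_
  rintro τ ⟨hτ, hsub⟩
  obtain ⟨t, ht, hτt⟩ := mem_cells.1 hτ
  refine mem_cells.2 ⟨t, ⟨ht, ?_⟩, hτt⟩
  obtain ⟨z, hz⟩ := hT.complex.openCell_nonempty hσ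
  exact ⟨z, cell_subset_supp hτt (hsub hz.1), hz.1⟩

theorem delta_cls_cofaces (hd : d = 1 ∨ d = 2) (hmaps : Set.MapsTo S.subst S.hull S.hull)
    (hprim : S.Primitive) (o : S.Orientation) {T T' : Set S.Tile} (hT : T ∈ S.hull)
    (hT' : T' ∈ S.hull) {k : ℕ} {σ : Set (Eu d)} (hσ : σ ∈ S.cells T' k) :
    S.delta o T k (S.cls T T' k σ) =
      ∑ᶠ τ ∈ S.cofaces T' k σ, S.inc o T' k τ σ • S.cls T T' (k + 1) τ := by
  rw [delta_cls hd hmaps hprim o hT hT' hσ]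
  refine (finsum_mem_inter_support_eq _ _ _ ?_)
  ext τ
  simp only [Set.mem_inter_iff, Function.mem_support, cofaces, Set.mem_sep_iff]
  refine ⟨fun h => ⟨⟨h.1, ?_⟩, h.2⟩, fun h => ⟨h.1.1, h.2⟩⟩
  exact subset_of_inc_ne_zero hT' h.1 fun h0 => h.2 (by rw [h0, zero_smul])

theorem inc_vertex (o : S.Orientation) {T : Set S.Tile} (hT : T ∈ S.hull) {e : Set (Eu d)}
    (he : e ∈ S.cells T 1) (v : Eu d) [Decidable (o.tgt T e = v)] [Decidable (o.src T e = v)] :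
    S.inc o T 0 e {v} = (if o.tgt T e = v then 1 else 0) - (if o.src T e = v then 1 else 0) := by
  have hne := o.src_ne_tgt T hT e he
  rw [inc_zero]
  simp only [Set.singleton_eq_singleton_iff]
  by_cases h1 : v = o.src T e
  · have h2 : ¬ o.tgt T e = v := fun h => hne (by rw [← h1, h])
    rw [if_pos h1, if_neg h2, if_pos h1.symm]
    rfl
  · rw [if_neg h1, if_neg (Ne.symm h1)]
    by_cases h2 : v = o.tgt T e
    · rw [if_pos h2, if_pos h2.symm]
      rfl
    · rw [if_neg h2, if_neg (Ne.symm h2)]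
      rfl

theorem IsTiling.mem_cells_zero (hd : d ≤ 2) {T : Set S.Tile} (hT : S.IsTiling T) {t : S.Tile}
    (ht : t ∈ T) {v : Eu d} (hv : {v} ∈ S.cells T 0) (hvt : v ∈ S.supp t) :
    {v} ∈ S.cells {t} 0 :=
  (hT.mem_cells_iff_subset hd ht hv).2 (Set.singleton_subset_iff.2 hvt)

end

namespace TileBoundary

variable {S : Substitution 2} {t : S.Tile} (B : TileBoundary S t) {T : Set S.Tile}

theorem ends_eq (o : S.Orientation) (hT : T ∈ S.hull) (ht : t ∈ T) {e : Set (Eu 2)}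
    (he : e ∈ S.cells {t} 1) :
    (o.src T e = B.γ (B.init e) ∧ o.tgt T e = B.γ (B.term e)) ∨
      (o.src T e = B.γ (B.term e) ∧ o.tgt T e = B.γ (B.init e)) := by
  have he' := cells_tile_subset ht 1 he
  have key : ∀ v ∈ e, {v} ∈ S.cells T 0 → v = B.γ (B.init e) ∨ v = B.γ (B.term e) :=
    fun v hv hv0 => B.vertex_eq he hv (hT.1.mem_cells_zero le_rfl ht hv0 (cell_subset_supp he hv))
  have h1 := key _ (o.src_mem T hT e he').1 (o.src_mem T hT e he').2
  have h2 := key _ (o.tgt_mem T hT e he').1 (o.tgt_mem T hT e he').2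
  have h3 := o.src_ne_tgt T hT e he'
  rcases h1 with h1 | h1 <;> rcases h2 with h2 | h2
  · exact absurd (h1.trans h2.symm) h3
  · exact Or.inl ⟨h1, h2⟩
  · exact Or.inr ⟨h1, h2⟩
  · exact absurd (h1.trans h2.symm) h3

theorem interior_nonempty (B : TileBoundary S t) : (interior (S.supp t)).Nonempty := by
  rw [B.interior_eq]
  exact (isCellComplex_singleton t).openCell_nonempty (supp_mem_cells rfl)

theorem counterclockwise_edge_iff {e : Set (Eu 2)} (he : e ∈ S.cells {t} 1) {a b : Eu 2} :
    Counterclockwise (S.supp t) e a b ↔ a = B.γ (B.init e) ∧ b = B.γ (B.term e) := by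
  conv_lhs => rw [← B.image_Icc e he]
  exact B.param.counterclockwise_iff B.interior_nonempty (B.lt e he) (B.lt_add_one e he)

theorem inc_eq_one {o : S.Orientation} {e : Set (Eu 2)} (he : e ∈ S.cells {t} 1)
    (h : o.src T e = B.γ (B.init e) ∧ o.tgt T e = B.γ (B.term e)) :
    S.inc o T 1 (S.supp t) e = 1 := by
  rw [inc_one, if_pos ((B.counterclockwise_edge_iff he).2 h)]

theorem inc_eq_neg_one {o : S.Orientation} {e : Set (Eu 2)} (he : e ∈ S.cells {t} 1)
    (h : o.src T e = B.γ (B.term e) ∧ o.tgt T e = B.γ (B.init e)) :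
    S.inc o T 1 (S.supp t) e = -1 := by
  rw [inc_one, if_neg, if_pos ((B.counterclockwise_edge_iff he).2 h.symm)]
  rw [B.counterclockwise_edge_iff he]
  exact fun h' => B.init_ne_term he (h'.1.symm.trans h.1)

/-- Reversing the orientation of e changes both factors, so the product only sees the
counterclockwise direction. -/
theorem inc_mul_sub (o : S.Orientation) (hT : T ∈ S.hull) (ht : t ∈ T) {e : Set (Eu 2)}
    (he : e ∈ S.cells {t} 1) (g : Eu 2 → ℤ) :
    S.inc o T 1 (S.supp t) e * (g (o.tgt T e) - g (o.src T e)) =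
      g (B.γ (B.term e)) - g (B.γ (B.init e)) := by
  rcases B.ends_eq o hT ht he with h | h
  · rw [B.inc_eq_one he h, h.1, h.2, one_mul]
  · rw [B.inc_eq_neg_one he h, h.1, h.2]
    ring

end TileBoundary

variable {S : Substitution 2}

theorem inc_eq_zero_of_notMem {o : S.Orientation} {T : Set S.Tile} (hT : T ∈ S.hull) {t : S.Tile}
    (ht : t ∈ T) {e : Set (Eu 2)} (he : e ∈ S.cells T 1) (h : e ∉ S.cells {t} 1) :
    S.inc o T 1 (S.supp t) e = 0 := by
  by_contra h0
  exact h ((hT.1.mem_cells_iff_subset le_rfl ht he).2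
    (subset_of_inc_ne_zero hT (supp_mem_cells ht) h0))

/-- Apply `sum_sub_eq_zero` to the indicator function of v. -/
theorem sum_inc_inc (o : S.Orientation) {T : Set S.Tile} (hT : T ∈ S.hull) {t : S.Tile}
    (ht : t ∈ T) (v : Eu 2) :
    ∑ e ∈ TileBoundary.edges t, S.inc o T 1 (S.supp t) e * S.inc o T 0 e {v} = 0 := by
  classical
  obtain ⟨B⟩ := hT.1.nonempty_tileBoundary ht
  rw [← B.sum_sub_eq_zero fun w => if w = v then (1 : ℤ) else 0]
  refine Finset.sum_congr rfl fun e he => ?_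
  have he' := TileBoundary.mem_edges.1 he
  rw [inc_vertex o hT (cells_tile_subset ht 1 he')]
  exact B.inc_mul_sub o hT ht he' fun w => if w = v then (1 : ℤ) else 0

theorem delta_one_delta_zero (hmaps : Set.MapsTo S.subst S.hull S.hull) (hprim : S.Primitive)
    (o : S.Orientation) {T : Set S.Tile} (hT : T ∈ S.hull) :
    S.delta o T 1 ∘ₗ S.delta o T 0 = 0 := by
  classical
  refine Finsupp.lhom_ext' fun c => LinearMap.ext_ring ?_
  have hv := rep_mem c
  obtain ⟨v, hveq⟩ := hT.1.complex.exists_vertex hv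
  simp only [LinearMap.comp_apply, Finsupp.lsingle_apply, LinearMap.zero_apply]
  rw [← cls_rep, delta_cls_cofaces (Or.inr rfl) hmaps hprim o hT hT hv,
    map_finsum_mem_smul _ (hT.1.finite_cofaces hv),
    finsum_mem_congr rfl fun e he => by
      rw [delta_cls_cofaces (Or.inr rfl) hmaps hprim o hT hT he.1],
    finsum_mem_smul_finsum_mem (hT.1.finite_cofaces hv) fun e he => hT.1.finite_cofaces he.1]
  refine finsum_eq_zero_of_forall_eq_zero fun f => ?_
  convert zero_smul ℤ _
  by_cases hf : f ∈ S.cells T 2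
  swap
  · rw [show {e ∈ S.cofaces T 0 (S.rep c) | f ∈ S.cofaces T 1 e} = ∅ from ?_, finsum_mem_empty]
    exact Set.eq_empty_of_forall_notMem fun e he => hf he.2.1
  obtain ⟨t, ht, rfl⟩ := mem_cells_top.1 hf
  rw [← sum_inc_inc o hT ht v, ← hveq, ← finsum_mem_coe_finset]
  simp only [mul_comm (S.inc o T 0 _ _)]
  refine finsum_mem_inter_support_eq _ _ _ ?_
  ext e
  simp only [Set.mem_inter_iff, Function.mem_support, Set.mem_sep_iff, Finset.mem_coe,
    TileBoundary.mem_edges, mul_ne_zero_iff]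
  constructor
  · rintro ⟨⟨h1, h2⟩, h3⟩
    exact ⟨(hT.1.mem_cells_iff_subset le_rfl ht h1.1).2 h2.2, h3⟩
  · rintro ⟨h1, h3⟩
    have h4 := cells_tile_subset ht 1 h1
    exact ⟨⟨⟨h4, subset_of_inc_ne_zero hT h4 h3.2⟩, hf, cell_subset_supp h1⟩, h3⟩

end Substitution

end SubstTiling

/-! ### The connecting maps in degree zero, and lifts of boundary maps -/

namespace SubstTiling

namespace Substitution

section

variable {d : ℕ} {S : Substitution d} {T : Set S.Tile}

namespace Homotopy

variable (H : S.Homotopy T)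

theorem continuous_one : Continuous (H.h 1) := by
  have h : Continuous fun z : Eu d => ((1 : ℝ), z) := by fun_prop
  have := H.continuous.comp h.continuousOn (s := Set.univ) fun z _ => by simp
  exact continuousOn_univ.1 this

theorem image_singleton (v : Eu d) : H.h 1 '' (S.lam⁻¹ • ({v} : Set (Eu d))) =
    {H.h 1 (S.lam⁻¹ • v)} := by
  rw [Set.smul_set_singleton, Set.image_singleton]

/-- The cells of `ω(T)` whose shrunk copies are mapped onto `σ`. -/
def fib (k : ℕ) (σ : Set (Eu d)) : Set (Set (Eu d)) :=
  {τ ∈ S.cells (S.subst T) k | H.h 1 '' (S.lam⁻¹ • τ) = σ}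

theorem finite_fib (hd : d ≤ 2) (hT : S.IsTiling T) {k : ℕ} {σ : Set (Eu d)}
    (hσ : σ ∈ S.cells T k) : (H.fib k σ).Finite := by
  rw [fib, ← H.cells_subst_patch hd hT hσ]
  refine (cells_finite (subst_finite ?_) k).subset (Set.sep_subset _ _)
  exact hT.patchAt_finite_of_isBounded
    ((hT.isCompact_cell hσ).isBounded.subset (Set.sdiff_subset))

end Homotopy

theorem W_cls_fib (hd : d ≤ 2) (hmaps : Set.MapsTo S.subst S.hull S.hull) (o : S.Orientation)
    (hT : T ∈ S.hull) (H : S.Homotopy T) {k : ℕ} {σ : Set (Eu d)} (hσ : σ ∈ S.cells T k) :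
    S.W o H k (S.cls T T k σ) =
      ∑ᶠ τ ∈ H.fib k σ, S.sgn o H k σ τ • S.cls T (S.subst T) k τ :=
  W_cls hd hmaps o hT H hσ

theorem sgn_eq_one {o : S.Orientation} {H : S.Homotopy T} {σ τ : Set (Eu d)}
    (h : H.h 1 (S.lam⁻¹ • o.src (S.subst T) τ) = o.src T σ ∧
      H.h 1 (S.lam⁻¹ • o.tgt (S.subst T) τ) = o.tgt T σ) : S.sgn o H 1 σ τ = 1 := by
  rw [sgn_one, if_pos h]

theorem sgn_eq_neg_one {o : S.Orientation} {H : S.Homotopy T} {σ τ : Set (Eu d)}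
    (hne : o.src T σ ≠ o.tgt T σ)
    (h : H.h 1 (S.lam⁻¹ • o.src (S.subst T) τ) = o.tgt T σ ∧
      H.h 1 (S.lam⁻¹ • o.tgt (S.subst T) τ) = o.src T σ) : S.sgn o H 1 σ τ = -1 := by
  rw [sgn_one, if_neg fun h' => hne (h'.1.symm.trans h.1), if_pos h]

theorem sgn_eq_zero {o : S.Orientation} {H : S.Homotopy T} {σ τ : Set (Eu d)}
    (hne : o.src T σ ≠ o.tgt T σ)
    (h : H.h 1 (S.lam⁻¹ • o.src (S.subst T) τ) = H.h 1 (S.lam⁻¹ • o.tgt (S.subst T) τ)) :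
    S.sgn o H 1 σ τ = 0 := by
  rw [sgn_one, if_neg fun h' => hne (h'.1.symm.trans (h.trans h'.2)),
    if_neg fun h' => hne (h'.2.symm.trans (h.symm.trans h'.1))]

/-- Both composites, applied to [σ], are sums over cells τ of ω(T), so it is enough to compare the
coefficients of [τ] over intermediate cells in T and in ω(T). -/
theorem W_delta_comm (hd : d = 1 ∨ d = 2) (hmaps : Set.MapsTo S.subst S.hull S.hull)
    (hprim : S.Primitive) (o : S.Orientation) (hT : T ∈ S.hull) (H : S.Homotopy T) (k : ℕ)
    (h : ∀ σ ∈ S.cells T k, ∀ τ ∈ S.cells (S.subst T) (k + 1),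
      ∑ᶠ ρ ∈ {ρ ∈ S.cofaces T k σ | τ ∈ H.fib (k + 1) ρ},
        S.inc o T k ρ σ * S.sgn o H (k + 1) ρ τ =
      ∑ᶠ ρ ∈ {ρ ∈ H.fib k σ | τ ∈ S.cofaces (S.subst T) k ρ},
        S.sgn o H k σ ρ * S.inc o (S.subst T) k τ ρ) :
    S.W o H (k + 1) ∘ₗ S.delta o T k = S.delta o T k ∘ₗ S.W o H k := by
  have hd2 : d ≤ 2 := by omega
  refine Finsupp.lhom_ext' fun c => LinearMap.ext_ring ?_
  have hσ := rep_mem c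
  have hfin := hT.1.finite_cofaces hσ
  have hωT := hmaps hT
  simp only [LinearMap.comp_apply, Finsupp.lsingle_apply]
  rw [← cls_rep, delta_cls_cofaces hd hmaps hprim o hT hT hσ, W_cls_fib hd2 hmaps o hT H hσ,
    map_finsum_mem_smul _ hfin, map_finsum_mem_smul _ (H.finite_fib hd2 hT.1 hσ),
    finsum_mem_congr rfl fun ρ hρ => by rw [W_cls_fib hd2 hmaps o hT H hρ.1],
    finsum_mem_congr (t := H.fib k (S.rep c)) rfl fun ρ hρ => by rw [delta_cls_cofaces hd hmaps hprim o hT hωT hρ.1],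
    finsum_mem_smul_finsum_mem hfin fun ρ hρ => H.finite_fib hd2 hT.1 hρ.1,
    finsum_mem_smul_finsum_mem (H.finite_fib hd2 hT.1 hσ) fun ρ hρ => hωT.1.finite_cofaces hρ.1]
  refine finsum_congr fun τ => ?_
  by_cases hτ : τ ∈ S.cells (S.subst T) (k + 1)
  · rw [h _ hσ τ hτ]
  · rw [show {ρ ∈ S.cofaces T k (S.rep c) | τ ∈ H.fib (k + 1) ρ} = ∅ from
        Set.eq_empty_of_forall_notMem fun ρ hρ => hτ hρ.2.1,
      show {ρ ∈ H.fib k (S.rep c) | τ ∈ S.cofaces (S.subst T) k ρ} = ∅ from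
        Set.eq_empty_of_forall_notMem fun ρ hρ => hτ hρ.2.1, finsum_mem_empty, finsum_mem_empty]

/-- A shrunk edge is either mapped onto an edge, ends to ends, or its ends are identified. -/
def EdgeDichotomy (o : S.Orientation) (H : S.Homotopy T) : Prop :=
  ∀ e' ∈ S.cells (S.subst T) 1,
    H.h 1 (S.lam⁻¹ • o.src (S.subst T) e') = H.h 1 (S.lam⁻¹ • o.tgt (S.subst T) e') ∨
    ∃ e ∈ S.cells T 1, H.h 1 '' (S.lam⁻¹ • e') = e ∧
      ((H.h 1 (S.lam⁻¹ • o.src (S.subst T) e') = o.src T e ∧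
        H.h 1 (S.lam⁻¹ • o.tgt (S.subst T) e') = o.tgt T e) ∨
      (H.h 1 (S.lam⁻¹ • o.src (S.subst T) e') = o.tgt T e ∧
        H.h 1 (S.lam⁻¹ • o.tgt (S.subst T) e') = o.src T e))

/-- For a vertex w of T and an edge of ω(T) from a to b, both coefficients count whether h₁ takes b
to w, minus whether it takes a to w. A collapsed edge has sign 0, and then the two ends cancel. -/
theorem W_delta_zero_comm (hd : d = 1 ∨ d = 2) (hmaps : Set.MapsTo S.subst S.hull S.hull)
    (hprim : S.Primitive) (o : S.Orientation) (hT : T ∈ S.hull) (H : S.Homotopy T)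
    (hdich : EdgeDichotomy o H) :
    S.W o H 1 ∘ₗ S.delta o T 0 = S.delta o T 0 ∘ₗ S.W o H 0 := by
  classical
  refine W_delta_comm hd hmaps hprim o hT H 0 fun σ hσ τ hτ => ?_
  have hωT := hmaps hT
  obtain ⟨w, rfl⟩ := hT.1.complex.exists_vertex hσ
  have hne := o.src_ne_tgt _ hωT τ hτ
  have hs := o.src_mem _ hωT τ hτ
  have ht := o.tgt_mem _ hωT τ hτ
  set a := o.src (S.subst T) τ
  set b := o.tgt (S.subst T) τ
  have hR : ∑ᶠ ρ ∈ {ρ ∈ H.fib 0 {w} | τ ∈ S.cofaces (S.subst T) 0 ρ},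
      S.sgn o H 0 {w} ρ * S.inc o (S.subst T) 0 τ ρ =
      (if H.h 1 (S.lam⁻¹ • b) = w then 1 else 0) - if H.h 1 (S.lam⁻¹ • a) = w then 1 else 0 := by
    have h1 : ∑ᶠ ρ ∈ {ρ ∈ H.fib 0 {w} | τ ∈ S.cofaces (S.subst T) 0 ρ},
        S.sgn o H 0 {w} ρ * S.inc o (S.subst T) 0 τ ρ =
        ∑ᶠ ρ ∈ {ρ ∈ H.fib 0 {w} | τ ∈ S.cofaces (S.subst T) 0 ρ},
          if H.h 1 '' (S.lam⁻¹ • ρ) = {w} then S.inc o (S.subst T) 0 τ ρ else 0 :=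
      finsum_mem_congr rfl fun ρ hρ => by
        rw [if_pos hρ.1.2, sgn_of_ne o H (by norm_num), one_mul]
    rw [h1, finsum_mem_inter_support_eq _ _ ({{a}, {b}} : Set (Set (Eu d))),
      finsum_mem_pair (by simpa using hne), H.image_singleton, H.image_singleton,
      inc_vertex o hωT hτ, inc_vertex o hωT hτ]
    · simp only [Set.singleton_eq_singleton_iff]
      simp only [show o.src (S.subst T) τ = a from rfl, show o.tgt (S.subst T) τ = b from rfl,
        if_true, if_neg hne, if_neg hne.symm]
      split_ifs <;> rfl
    · ext ρ
      simp only [Set.mem_inter_iff, Function.mem_support, Set.mem_insert_iff,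
        Set.mem_singleton_iff, Set.mem_sep_iff, ne_eq, ite_eq_right_iff, Classical.not_imp]
      constructor
      · rintro ⟨⟨h1, h2⟩, h3, h4⟩
        refine ⟨?_, h3, h4⟩
        rw [inc_zero] at h4
        by_contra! h5
        exact h4 (by rw [if_neg h5.1, if_neg h5.2])
      · rintro ⟨rfl | rfl, h3, h4⟩
        · exact ⟨⟨⟨hs.2, h3⟩, hτ, Set.singleton_subset_iff.2 hs.1⟩, h3, h4⟩
        · exact ⟨⟨⟨ht.2, h3⟩, hτ, Set.singleton_subset_iff.2 ht.1⟩, h3, h4⟩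
  rw [hR]
  rcases hdich τ hτ with h | ⟨e, he, himg, h⟩
  · rw [show H.h 1 (S.lam⁻¹ • b) = H.h 1 (S.lam⁻¹ • a) from h.symm, sub_self]
    refine finsum_mem_of_eqOn_zero fun ρ hρ => ?_
    have : S.sgn o H (0 + 1) ρ τ = 0 := sgn_eq_zero (o.src_ne_tgt T hT ρ hρ.1.1) h
    simp only [this, mul_zero, Pi.zero_apply]
  · rw [finsum_mem_inter_support_eq _ _ {e}, finsum_mem_singleton, inc_vertex o hT he]
    · rcases h with h | h
      · have : S.sgn o H (0 + 1) e τ = 1 := sgn_eq_one h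
        rw [this, mul_one, ← h.1, ← h.2]
      · have : S.sgn o H (0 + 1) e τ = -1 := sgn_eq_neg_one (o.src_ne_tgt T hT e he) h
        rw [this, ← h.1, ← h.2]
        ring
    · ext ρ
      simp only [Set.mem_inter_iff, Function.mem_support, Set.mem_singleton_iff, Set.mem_sep_iff,
        mul_ne_zero_iff]
      constructor
      · rintro ⟨⟨h1, h2⟩, h3⟩
        exact ⟨h2.2.symm.trans himg, h3⟩
      · rintro ⟨rfl, h3⟩
        exact ⟨⟨⟨he, subset_of_inc_ne_zero hT he h3.1⟩, hτ, himg⟩, h3⟩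

end

variable {S : Substitution 2} {t : S.Tile}

namespace TileBoundary

variable (B : TileBoundary S t)

theorem exists_edge_from {p q : ℝ} (hpq : p < q) (hp : {B.γ p} ∈ S.cells {t} 0)
    (hq : {B.γ q} ∈ S.cells {t} 0) :
    ∃ e ∈ S.cells {t} 1, ∃ n : ℤ, p = B.init e + n ∧ B.term e + n ≤ q := by
  obtain ⟨e, he, h⟩ := B.exists_init_eq hp
  obtain ⟨n, hn⟩ := (B.param.eq_iff _ _).1 h.symm
  refine ⟨e, he, n, hn, ?_⟩
  by_contra! hlt
  have h1 : B.γ q ∈ S.opn {t} 1 e := (B.mem_opn_iff he).2 ⟨n, by linarith, hlt⟩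
  exact h1.2 (mem_skel_one_iff.2 hq)

/-- Starting at a vertex parameter, the interval [p, q] contains a full edge e, so A = e. Were q
beyond the end of e, A would contain points outside e. -/
theorem exists_edge_eq {p q : ℝ} (hpq : p < q) (hp : {B.γ p} ∈ S.cells {t} 0)
    (hq : {B.γ q} ∈ S.cells {t} 0) {A : Set (Eu 2)} (hA : B.γ '' Set.Icc p q ⊆ A)
    (hedge : ∀ e ∈ S.cells {t} 1, e ⊆ A → A = e) :
    ∃ e ∈ S.cells {t} 1, ∃ n : ℤ, A = e ∧ p = B.init e + n ∧ q = B.term e + n := by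
  obtain ⟨e, he, n, hn, hle⟩ := B.exists_edge_from hpq hp hq
  have hAe : A = e := by
    refine hedge e he (subset_trans ?_ hA)
    rw [← B.image_Icc e he]
    rintro _ ⟨x, hx, rfl⟩
    exact ⟨x + n, ⟨by linarith [hx.1], by linarith [hx.2]⟩, B.param.add_int x n⟩
  refine ⟨e, he, n, hAe, hn, ?_⟩
  by_contra hne
  have h1 : B.term e + n < min q (B.init e + n + 1) :=
    lt_min (lt_of_le_of_ne hle (Ne.symm hne)) (by linarith [B.lt_add_one e he])
  obtain ⟨r, hr1, hr2⟩ := exists_between h1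
  have hr3 := hr2.trans_le (min_le_left _ _)
  have hr4 := hr2.trans_le (min_le_right _ _)
  have hre : B.γ r ∈ e := hAe ▸ hA ⟨r, ⟨by linarith [B.lt e he], hr3.le⟩, rfl⟩
  obtain ⟨m, h2, h3⟩ := (B.mem_edge_iff he).1 hre
  have h4 := int_le_of_lt_add_one (m := m) (k := n) (by linarith)
  linarith

/-- By the intermediate value theorem, a boundary path whose lift moves sweeps the whole parameter
interval between its end values. -/
theorem path_dichotomy {x y : ℝ} (hxy : x ≤ y) {b : ℝ → ℝ} (hb : ContinuousOn b (Set.Icc x y))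
    (hx : {B.γ (b x)} ∈ S.cells {t} 0) (hy : {B.γ (b y)} ∈ S.cells {t} 0)
    (hedge : ∀ e ∈ S.cells {t} 1, e ⊆ B.γ '' (b '' Set.Icc x y) →
      B.γ '' (b '' Set.Icc x y) = e) :
    b x = b y ∨ ∃ e ∈ S.cells {t} 1, ∃ n : ℤ, B.γ '' (b '' Set.Icc x y) = e ∧
      ((b x = B.init e + n ∧ b y = B.term e + n) ∨ (b x = B.term e + n ∧ b y = B.init e + n)) := by
  rcases lt_trichotomy (b x) (b y) with hlt | heq | hlt
  · obtain ⟨e, he, n, h1, h2⟩ := B.exists_edge_eq hlt hx hy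
      (Set.image_mono (intermediate_value_Icc hxy hb)) hedge
    exact Or.inr ⟨e, he, n, h1, Or.inl h2⟩
  · exact Or.inl heq
  · obtain ⟨e, he, n, h1, h2⟩ := B.exists_edge_eq hlt hy hx
      (Set.image_mono (intermediate_value_Icc' hxy hb)) hedge
    exact Or.inr ⟨e, he, n, h1, Or.inr h2.symm⟩

end TileBoundary

namespace Homotopy

variable {T : Set S.Tile} (H : S.Homotopy T) {u : S.Tile}

/-- By cellularity the boundary of the shrunk tile goes into the 1-skeleton of t, which is the
frontier of t. -/
theorem exists_boundary_lift (ht : t ∈ T) (hu : u ∈ S.subst {t}) (B : TileBoundary S t)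
    (C : TileBoundary S u) :
    ∃ b : ℝ → ℝ, Continuous b ∧ ∀ x, B.γ (b x) = H.h 1 (S.lam⁻¹ • C.γ x) := by
  obtain ⟨b, hb, h⟩ := B.param.lift Set.univ convex_univ (fun x => H.h 1 (S.lam⁻¹ • C.γ x))
    (H.continuous_one.comp' (C.param.continuous.const_smul S.lam⁻¹)).continuousOn (fun x _ => by
      have : C.γ x ∈ skel (S.cells {u}) 2 := by rw [← C.range_eq]; exact ⟨x, rfl⟩
      obtain ⟨j, hj, τ, hτ, hx⟩ := this
      rw [B.frontier_eq]
      exact skel_mono_right (by omega : j + 1 ≤ 2) (H.cellular t ht j τ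
        (cells_tile_subset hu j hτ) ⟨_, Set.smul_mem_smul_set hx, rfl⟩))
  exact ⟨b, continuousOn_univ.1 hb, fun x => h x trivial⟩

theorem image_edge_eq {B : TileBoundary S t} {C : TileBoundary S u} {b : ℝ → ℝ}
    (hb : ∀ x, B.γ (b x) = H.h 1 (S.lam⁻¹ • C.γ x)) {e' : Set (Eu 2)} (he' : e' ∈ S.cells {u} 1) :
    B.γ '' (b '' Set.Icc (C.init e') (C.term e')) = H.h 1 '' (S.lam⁻¹ • e') := by
  conv_rhs => rw [← C.image_Icc e' he', ← Set.image_smul, Set.image_image, Set.image_image]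
  rw [Set.image_image]
  exact Set.image_congr fun x _ => hb x

theorem edge_param_dichotomy (ht : t ∈ T) (hu : u ∈ S.subst {t}) {B : TileBoundary S t}
    {C : TileBoundary S u} {b : ℝ → ℝ} (hbc : Continuous b)
    (hb : ∀ x, B.γ (b x) = H.h 1 (S.lam⁻¹ • C.γ x)) {e' : Set (Eu 2)} (he' : e' ∈ S.cells {u} 1) :
    b (C.init e') = b (C.term e') ∨ ∃ e ∈ S.cells {t} 1, ∃ n : ℤ, H.h 1 '' (S.lam⁻¹ • e') = e ∧
      ((b (C.init e') = B.init e + n ∧ b (C.term e') = B.term e + n) ∨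
        (b (C.init e') = B.term e + n ∧ b (C.term e') = B.init e + n)) := by
  have hvert : ∀ x, {C.γ x} ∈ S.cells {u} 0 → {B.γ (b x)} ∈ S.cells {t} 0 := fun x hx => by
    rw [hb, ← mem_skel_one_iff]
    exact H.cellular t ht 0 _ (cells_tile_subset hu 0 hx)
      ⟨_, Set.smul_mem_smul_set (Set.mem_singleton _), rfl⟩
  have h := B.path_dichotomy (C.lt e' he').le (b := b) hbc.continuousOn
    (hvert _ (C.vertex_init he')) (hvert _ (C.vertex_term he')) (fun e he => by
      rw [H.image_edge_eq hb he']
      exact H.edge t ht e he e' (cells_tile_subset hu 1 he'))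
  rwa [H.image_edge_eq hb he'] at h

theorem edgeDichotomy (hmaps : Set.MapsTo S.subst S.hull S.hull) (o : S.Orientation)
    (hT : T ∈ S.hull) : EdgeDichotomy o H := by
  intro e' he'
  obtain ⟨u, hu, he'u⟩ := mem_cells.1 he'
  obtain ⟨t, ht, hut⟩ := mem_subst.1 hu
  obtain ⟨B⟩ := hT.1.nonempty_tileBoundary ht
  obtain ⟨C⟩ := (hmaps hT).1.nonempty_tileBoundary hu
  obtain ⟨b, hbc, hb⟩ := H.exists_boundary_lift ht hut B C
  have hends := C.ends_eq o (hmaps hT) hu he'u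
  rcases H.edge_param_dichotomy ht hut hbc hb he'u with h | ⟨e, he, n, himg, h⟩
  · left
    rcases hends with h' | h' <;> rw [h'.1, h'.2, ← hb, ← hb, h]
  · refine Or.inr ⟨e, cells_tile_subset ht 1 he, himg, ?_⟩
    have h1 : ∀ x y, b x = y + n → H.h 1 (S.lam⁻¹ • C.γ x) = B.γ y := fun x y hxy => by
      rw [← hb, hxy, B.param.add_int]
    rcases B.ends_eq o hT ht he with h2 | h2 <;> rcases hends with h' | h' <;>
      rcases h with h | h <;> rw [h2.1, h2.2, h'.1, h'.2, h1 _ _ h.1, h1 _ _ h.2] <;> simp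

end Homotopy

end Substitution

end SubstTiling

/-! ### Degrees of boundary maps, and the connecting maps in degree one -/

namespace SubstTiling

theorem planar_smul (a : ℝ) (x : Eu 2) : planar (a • x) = a * planar x := by
  rw [planar_eq, planar_eq, map_smul, Complex.real_smul]

namespace Substitution

variable {S : Substitution 2} {t u : S.Tile} {T : Set S.Tile}

namespace TileBoundary

theorem notMem_interior (B : TileBoundary S t) (x : ℝ) : B.γ x ∉ interior (S.supp t) := by
  have : B.γ x ∈ frontier (S.supp t) := by rw [← B.param.range_eq]; exact ⟨x, rfl⟩
  exact fun h => this.2 h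

end TileBoundary

namespace Homotopy

variable (H : S.Homotopy T)

/-- The homotopy from the identity moves the shrunk boundary loop and an interior point q together
without letting them meet. The winding number 1 at s = 0 thus survives to s = 1, where it is the
degree of the lift. -/
theorem lift_degree_one (ht : t ∈ T) (hu : u ∈ S.subst {t}) {B : TileBoundary S t}
    {C : TileBoundary S u} {b : ℝ → ℝ} (hbc : Continuous b)
    (hb : ∀ x, B.γ (b x) = H.h 1 (S.lam⁻¹ • C.γ x))
    (himg : H.h 1 '' (S.lam⁻¹ • S.supp u) = S.supp t) (x : ℝ) : b (x + 1) = b x + 1 := by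
  have hpi : (2 * Real.pi * Complex.I : ℂ) ≠ 0 := by simp [Real.pi_ne_zero]
  obtain ⟨-, hbij, -⟩ := H.tile_homeo t ht u hu himg
  -- The homeomorphism of interiors provides an interior point q of u whose shrunk copy is sent to
  -- an interior point of t.
  obtain ⟨p, hp⟩ := (isCellComplex_singleton t).openCell_nonempty (supp_mem_cells (P := {t}) rfl)
  obtain ⟨_, ⟨q, hq, rfl⟩, hqp⟩ := hbij.surjOn hp
  have hqi : q ∈ interior (S.supp u) := by
    rw [C.interior_eq]
    exact ⟨hq.1, fun h => hq.2 (skel_cells_mono (Set.singleton_subset_iff.2 hu) 2 h)⟩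
  have hpi' : H.h 1 (S.lam⁻¹ • q) ∈ interior (S.supp t) := by
    rw [B.interior_eq]
    simpa using hqp ▸ hp
  have hne : ∀ y, S.lam⁻¹ • C.γ y ≠ S.lam⁻¹ • q := fun y h => C.notMem_interior y
    (by rwa [smul_right_injective _ (inv_ne_zero S.lam_ne_zero) h])
  obtain ⟨n, L, hLc, hL⟩ := winding_homotopy (convex_Icc (0 : ℝ) 1)
    (g := fun z => planar (H.h z.1 (S.lam⁻¹ • C.γ z.2)) - planar (H.h z.1 (S.lam⁻¹ • q)))
    (by
      refine ContinuousOn.sub ?_ ?_ <;> refine continuous_planar.comp_continuousOn ?_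
      · refine H.continuous.comp (f := fun z : ℝ × ℝ => (z.1, S.lam⁻¹ • C.γ z.2)) ?_
          fun z hz => ⟨hz.1, trivial⟩
        have := C.param.continuous
        fun_prop
      · exact H.continuous.comp (f := fun z : ℝ × ℝ => (z.1, S.lam⁻¹ • q)) (by fun_prop)
          fun z hz => ⟨hz.1, trivial⟩)
    (by
      -- For s < 1 the map h_s is injective. At s = 1 the loop lies in the boundary of t, while q
      -- has gone to the interior.
      rintro ⟨s, y⟩ ⟨hs, -⟩ h0
      have h1 := planar_injective (sub_eq_zero.1 h0)
      rcases hs.1.eq_or_lt with rfl | h2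
      · simp only [H.zero, id] at h1
        exact hne y h1
      rcases hs.2.eq_or_lt with rfl | h3
      · rw [← h1, ← hb] at hpi'
        exact B.notMem_interior _ hpi'
      · exact hne y ((H.homeo s ⟨h2, h3⟩).injective h1))
    (by
      intro s _ y
      have := C.param.add_int y 1
      simp only [Int.cast_one] at this
      simp only [this])
  have hslice : ∀ s ∈ Set.Icc (0 : ℝ) 1, Continuous fun y => L (s, y) := fun s hs =>
    continuousOn_univ.1 (hLc.comp (f := fun y : ℝ => (s, y)) (by fun_prop)
      fun y _ => ⟨hs, trivial⟩)
  have hn : (n : ℂ) = 1 := by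
    obtain ⟨M, hM, hM'⟩ := C.param.winds q hqi
    have hlam : (S.lam : ℂ) ≠ 0 := Complex.ofReal_ne_zero.2 S.lam_ne_zero
    have h0 : (0 : ℝ) ∈ Set.Icc (0 : ℝ) 1 := by simp
    -- At s = 0 the loop is the boundary of u shrunk by λ. Adding the constant log λ gives a
    -- logarithm for u itself.
    have h1 := log_increment (g := fun y => planar (C.γ y) - planar q)
      (L := fun y => L (0, y) + Complex.log S.lam) ((hslice 0 h0).add continuous_const) hM
      (fun y => by
        rw [Complex.exp_add, (hL 0 h0 y).1, Complex.exp_log hlam]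
        simp only [H.zero, id, planar_smul]
        push_cast
        field_simp) (fun y => (hM' y).1.symm) 1 0
    have h2 := (hL 0 h0 0).2
    have h3 := (hM' 0).2
    rw [zero_add] at h2 h3
    rw [h2, h3] at h1
    have h4 : (n - 1 : ℂ) * (2 * Real.pi * Complex.I) = 0 := by linear_combination h1
    exact sub_eq_zero.1 ((mul_eq_zero.1 h4).resolve_right hpi)
  have h1 : (1 : ℝ) ∈ Set.Icc (0 : ℝ) 1 := by simp
  have := B.param.lift_add_one hpi' hbc (fun y => by
      rw [hb, hb]
      simpa using congrArg (fun z => H.h 1 (S.lam⁻¹ • z)) (C.param.add_int y 1))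
    (hslice 1 h1) (fun y => by rw [(hL 1 h1 y).1, hb]) (m := 1)
    (fun y => by rw [(hL 1 h1 y).2, hn]; push_cast; rfl) x
  simpa using this

/-- The image of the shrunk tile is compact and not all of t, so it misses an interior point p. Then
h₁ - p does not vanish on the disc, and the boundary loop does not wind around p. -/
theorem lift_degree_zero (ht : t ∈ T) (hu : u ∈ S.subst {t}) {B : TileBoundary S t}
    {C : TileBoundary S u} {b : ℝ → ℝ} (hbc : Continuous b)
    (hb : ∀ x, B.γ (b x) = H.h 1 (S.lam⁻¹ • C.γ x))
    (himg : H.h 1 '' (S.lam⁻¹ • S.supp u) ≠ S.supp t) (x : ℝ) : b (x + 1) = b x := by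
  have hsub : H.h 1 '' (S.lam⁻¹ • S.supp u) ⊆ S.supp t :=
    H.image_cell_subset ht hu (supp_mem_cells rfl)
  have hcl : IsClosed (H.h 1 '' (S.lam⁻¹ • S.supp u)) :=
    (((isCompact_supp u).smul S.lam⁻¹).image H.continuous_one).isClosed
  obtain ⟨z, hz, hzn⟩ := Set.not_subset.1 fun h => himg (subset_antisymm hsub h)
  obtain ⟨p, hpn, hp⟩ := mem_closure_iff.1 ((isCellComplex_singleton t).subset_closure_openCell
    (supp_mem_cells (P := {t}) rfl) hz) _ hcl.isOpen_compl hzn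
  have hp' : p ∈ interior (S.supp t) := by rw [B.interior_eq]; exact hp
  obtain ⟨M, hM, hM'⟩ := C.param.fill (fun z => planar (H.h 1 (S.lam⁻¹ • z)) - planar p)
    (((continuous_planar.comp (H.continuous_one.comp' (continuous_const_smul S.lam⁻¹))).sub
      continuous_const).continuousOn) (fun z hz h0 => hpn
        ⟨_, Set.smul_mem_smul_set hz, planar_injective (sub_eq_zero.1 h0)⟩)
  have := B.param.lift_add_one hp' hbc (fun y => by
      rw [hb, hb]
      simpa using congrArg (fun z => H.h 1 (S.lam⁻¹ • z)) (C.param.add_int y 1))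
    hM (fun y => by rw [(hM' y).1, hb]) (m := 0) (fun y => by rw [(hM' y).2]; simp) x
  simpa using this

-- The left side is the signed contribution of one edge e' of u over e. It equals the signed number
-- of integral translates of p that the lift b crosses along e', and so becomes an increment that
-- can be summed around u.
open Classical in
theorem sgn_mul_inc (hmaps : Set.MapsTo S.subst S.hull S.hull) (o : S.Orientation)
    (hT : T ∈ S.hull) (ht : t ∈ T) (hu : u ∈ S.subst {t}) {B : TileBoundary S t}
    {C : TileBoundary S u} {b : ℝ → ℝ} (hbc : Continuous b)
    (hb : ∀ x, B.γ (b x) = H.h 1 (S.lam⁻¹ • C.γ x)) {e e' : Set (Eu 2)} (he : e ∈ S.cells {t} 1)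
    (he' : e' ∈ S.cells {u} 1) {p : ℝ} (hp : p ∈ Set.Ioo (B.init e) (B.term e)) :
    (if H.h 1 '' (S.lam⁻¹ • e') = e then
        S.sgn o H 1 e e' * S.inc o (S.subst T) 1 (S.supp u) e' else 0) =
      S.inc o T 1 (S.supp t) e * (⌊b (C.term e') - p⌋ - ⌊b (C.init e') - p⌋) := by
  have huT : u ∈ S.subst T := mem_subst.2 ⟨t, ht, hu⟩
  have hωT := hmaps hT
  have hne := o.src_ne_tgt T hT e (cells_tile_subset ht 1 he)
  have hends := C.ends_eq o hωT huT he'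
  rcases H.edge_param_dichotomy ht hu hbc hb he' with h | ⟨e₁, he₁, n, himg, h⟩
  · rw [h, sub_self, mul_zero]
    split_ifs
    · rw [sgn_eq_zero hne, zero_mul]
      rcases hends with h' | h' <;> rw [h'.1, h'.2, ← hb, ← hb, h]
    · rfl
  · have hfl := B.floor_sub_floor he he₁ hp
    have hn : ∀ y : ℝ, ⌊y + n - p⌋ = ⌊y - p⌋ + n := fun y => by
      rw [← Int.floor_add_intCast]
      congr 1
      ring
    rw [himg]
    by_cases hee : e₁ = e
    · subst hee
      rw [if_pos rfl] at hfl ⊢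
      have h1 : ∀ x y, b x = y + n → H.h 1 (S.lam⁻¹ • C.γ x) = B.γ y := fun x y hxy => by
        rw [← hb, hxy, B.param.add_int]
      rcases hends with h' | h'
      · rw [C.inc_eq_one he' h']
        rcases B.ends_eq o hT ht he with h2 | h2 <;> rcases h with h | h
        · rw [B.inc_eq_one he h2, sgn_eq_one (by
            rw [h'.1, h'.2, h1 _ _ h.1, h1 _ _ h.2, h2.1, h2.2]; simp), h.1, h.2, hn, hn]
          linarith
        · rw [B.inc_eq_one he h2, sgn_eq_neg_one hne (by
            rw [h'.1, h'.2, h1 _ _ h.1, h1 _ _ h.2, h2.1, h2.2]; simp), h.1, h.2, hn, hn]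
          linarith
        · rw [B.inc_eq_neg_one he h2, sgn_eq_neg_one hne (by
            rw [h'.1, h'.2, h1 _ _ h.1, h1 _ _ h.2, h2.1, h2.2]; simp), h.1, h.2, hn, hn]
          linarith
        · rw [B.inc_eq_neg_one he h2, sgn_eq_one (by
            rw [h'.1, h'.2, h1 _ _ h.1, h1 _ _ h.2, h2.1, h2.2]; simp), h.1, h.2, hn, hn]
          linarith
      · rw [C.inc_eq_neg_one he' h']
        rcases B.ends_eq o hT ht he with h2 | h2 <;> rcases h with h | h
        · rw [B.inc_eq_one he h2, sgn_eq_neg_one hne (by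
            rw [h'.1, h'.2, h1 _ _ h.1, h1 _ _ h.2, h2.1, h2.2]; simp), h.1, h.2, hn, hn]
          linarith
        · rw [B.inc_eq_one he h2, sgn_eq_one (by
            rw [h'.1, h'.2, h1 _ _ h.1, h1 _ _ h.2, h2.1, h2.2]; simp), h.1, h.2, hn, hn]
          linarith
        · rw [B.inc_eq_neg_one he h2, sgn_eq_one (by
            rw [h'.1, h'.2, h1 _ _ h.1, h1 _ _ h.2, h2.1, h2.2]; simp), h.1, h.2, hn, hn]
          linarith
        · rw [B.inc_eq_neg_one he h2, sgn_eq_neg_one hne (by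
            rw [h'.1, h'.2, h1 _ _ h.1, h1 _ _ h.2, h2.1, h2.2]; simp), h.1, h.2, hn, hn]
          linarith
    · rw [if_neg hee] at hfl ⊢
      symm
      rw [mul_eq_zero]
      right
      rcases h with h | h <;> rw [h.1, h.2, hn, hn] <;> linarith

-- The crossings along the edges of u add up to the degree of the boundary loop, which is 1 or 0.
open Classical in
theorem sum_sgn_mul_inc (hmaps : Set.MapsTo S.subst S.hull S.hull) (o : S.Orientation)
    (hT : T ∈ S.hull) (ht : t ∈ T) (hu : u ∈ S.subst {t}) {e : Set (Eu 2)}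
    (he : e ∈ S.cells {t} 1) :
    ∑ e' ∈ TileBoundary.edges u, (if H.h 1 '' (S.lam⁻¹ • e') = e then
        S.sgn o H 1 e e' * S.inc o (S.subst T) 1 (S.supp u) e' else 0) =
      if H.h 1 '' (S.lam⁻¹ • S.supp u) = S.supp t then S.inc o T 1 (S.supp t) e else 0 := by
  obtain ⟨B⟩ := hT.1.nonempty_tileBoundary ht
  obtain ⟨C⟩ := (hmaps hT).1.nonempty_tileBoundary (mem_subst.2 ⟨t, ht, hu⟩)
  obtain ⟨b, hbc, hb⟩ := H.exists_boundary_lift ht hu B C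
  obtain ⟨p, hp⟩ := exists_between (B.lt e he)
  rw [Finset.sum_congr rfl fun e' he' =>
    H.sgn_mul_inc hmaps o hT ht hu hbc hb he (TileBoundary.mem_edges.1 he') hp, ← Finset.mul_sum]
  split_ifs with himg
  · rw [C.sum_increment (F := fun x => ⌊b x - p⌋) (c := 1), mul_one]
    intro x
    rw [H.lift_degree_one ht hu hbc hb himg, ← Int.floor_add_one]
    congr 1
    ring
  · rw [C.sum_increment (F := fun x => ⌊b x - p⌋) (c := 0), mul_zero]
    intro x
    rw [H.lift_degree_zero ht hu hbc hb himg, add_zero]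

end Homotopy

theorem W_delta_one_comm (hmaps : Set.MapsTo S.subst S.hull S.hull)
    (hprim : S.Primitive) (o : S.Orientation) (hT : T ∈ S.hull) (H : S.Homotopy T) :
    S.W o H 2 ∘ₗ S.delta o T 1 = S.delta o T 1 ∘ₗ S.W o H 1 := by
  classical
  refine W_delta_comm (Or.inr rfl) hmaps hprim o hT H 1 fun e he f hf => ?_
  obtain ⟨u, hu, rfl⟩ := mem_cells_top.1 hf
  obtain ⟨t, ht, hut⟩ := mem_subst.1 hu
  have hωT := hmaps hT
  have hfsub : H.h 1 '' (S.lam⁻¹ • S.supp u) ⊆ S.supp t :=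
    H.image_cell_subset ht hut (supp_mem_cells rfl)
  have hft : ∀ ρ ∈ S.cells T 2, H.h 1 '' (S.lam⁻¹ • S.supp u) = ρ → ρ = S.supp t := by
    intro ρ hρ h
    obtain ⟨v, hv, rfl⟩ := mem_cells_top.1 hρ
    rw [hT.1.eq_of_supp_subset le_rfl hv ht (h ▸ hfsub)]
  have hL : ∑ᶠ ρ ∈ {ρ ∈ S.cofaces T 1 e | S.supp u ∈ H.fib (1 + 1) ρ},
      S.inc o T 1 ρ e * S.sgn o H (1 + 1) ρ (S.supp u) =
      if H.h 1 '' (S.lam⁻¹ • S.supp u) = S.supp t then S.inc o T 1 (S.supp t) e else 0 := by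
    rw [finsum_mem_congr rfl fun ρ _ => by rw [sgn_of_ne o H (by norm_num), mul_one]]
    split_ifs with himg
    · rw [finsum_mem_inter_support_eq _ _ {S.supp t}, finsum_mem_singleton]
      ext ρ
      simp only [Set.mem_inter_iff, Function.mem_support, Set.mem_singleton_iff, Set.mem_sep_iff]
      constructor
      · rintro ⟨⟨h1, h2⟩, h3⟩
        exact ⟨hft ρ h1.1 h2.2, h3⟩
      · rintro ⟨rfl, h3⟩
        exact ⟨⟨⟨supp_mem_cells ht, subset_of_inc_ne_zero hT (supp_mem_cells ht) h3⟩, hf, himg⟩, h3⟩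
    · refine finsum_mem_of_eqOn_zero fun ρ hρ => ?_
      have := hft ρ hρ.1.1 hρ.2.2
      exact absurd (this ▸ hρ.2.2) himg
  rw [hL]
  have hR : ∑ᶠ ρ ∈ {ρ ∈ H.fib 1 e | S.supp u ∈ S.cofaces (S.subst T) 1 ρ},
      S.sgn o H 1 e ρ * S.inc o (S.subst T) 1 (S.supp u) ρ =
      ∑ e' ∈ TileBoundary.edges u, (if H.h 1 '' (S.lam⁻¹ • e') = e then
        S.sgn o H 1 e e' * S.inc o (S.subst T) 1 (S.supp u) e' else 0) := by
    rw [← finsum_mem_coe_finset, finsum_mem_congr rfl fun ρ (hρ : ρ ∈ {ρ ∈ H.fib 1 e |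
      S.supp u ∈ S.cofaces (S.subst T) 1 ρ}) => (if_pos hρ.1.2).symm]
    refine finsum_mem_inter_support_eq _ _ _ ?_
    ext ρ
    simp only [Set.mem_inter_iff, Function.mem_support, Set.mem_sep_iff, Finset.mem_coe,
      TileBoundary.mem_edges, ne_eq, ite_eq_right_iff, Classical.not_imp, mul_eq_zero, not_or]
    constructor
    · rintro ⟨⟨h1, h2⟩, h3⟩
      exact ⟨(hωT.1.mem_cells_iff_subset le_rfl hu h1.1).2 h2.2, h3⟩
    · rintro ⟨h1, h3⟩
      exact ⟨⟨⟨cells_tile_subset hu 1 h1, h3.1⟩, hf, cell_subset_supp h1⟩, h3⟩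
  rw [hR]
  -- If e is not an edge of t, both sides vanish, since shrunk cells of t are mapped into t.
  by_cases het : e ∈ S.cells {t} 1
  · rw [H.sum_sgn_mul_inc hmaps o hT ht hut het]
  · rw [inc_eq_zero_of_notMem hT ht he het, ite_self, Finset.sum_eq_zero]
    intro e' he'
    rw [if_neg]
    intro himg
    have := H.mem_patch_of_image le_rfl hT.1 ht hut he (TileBoundary.mem_edges.1 he') himg
    exact het ((hT.1.mem_patchAt_iff le_rfl he).1 this).2

end Substitution

end SubstTiling

/-! ### Adjacent tiles of the plane -/

namespace SubstTiling

/-- Two closed curves with a common arc: the difference of their winding numbers around `q` is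
determined by the logarithms along the complementary arcs. -/
theorem increment_sub_increment {γ η : ℝ → ℂ} {s u s' u' : ℝ}
    (hus : u ≤ s + 1) (hsu' : s' ≤ u') (hus' : u' ≤ s' + 1) {θ : ℝ → ℝ}
    (hθ : ContinuousOn θ (Set.Icc s' u')) (hθη : ∀ y ∈ Set.Icc s' u', γ (θ y) = η y)
    (hθs : θ s' = s) (hθu : θ u' = u) {L M : ℝ → ℂ} (hL : Continuous L) (hM : Continuous M)
    (hLγ : ∀ x, Complex.exp (L x) = γ x) (hMη : ∀ x, Complex.exp (M x) = η x) {a b : ℂ}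
    (ha : ∀ x, L (x + 1) = L x + a) (hb : ∀ x, M (x + 1) = M x + b) {P Q : ℝ → ℂ}
    (hP : ContinuousOn P (Set.Icc u (s + 1))) (hQ : ContinuousOn Q (Set.Icc u' (s' + 1)))
    (hPγ : ∀ x ∈ Set.Icc u (s + 1), Complex.exp (P x) = γ x)
    (hQη : ∀ x ∈ Set.Icc u' (s' + 1), Complex.exp (Q x) = η x) :
    P (s + 1) - P u - (Q (s' + 1) - Q u') = a - b := by
  obtain ⟨n, hn⟩ := log_unique isPreconnected_Icc hP hL.continuousOn
    fun x hx => (hPγ x hx).trans (hLγ x).symm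
  obtain ⟨m, hm⟩ := log_unique isPreconnected_Icc hQ hM.continuousOn
    fun x hx => (hQη x hx).trans (hMη x).symm
  obtain ⟨k, hk⟩ := log_unique isPreconnected_Icc (hL.comp_continuousOn hθ) hM.continuousOn
    fun x hx => ((hLγ _).trans (hθη x hx)).trans (hMη x).symm
  have h1 := hk s' (Set.left_mem_Icc.2 hsu')
  have h2 := hk u' (Set.right_mem_Icc.2 hsu')
  simp only [Function.comp, hθs, hθu] at h1 h2
  rw [hn _ (Set.left_mem_Icc.2 hus), hn _ (Set.right_mem_Icc.2 hus),
    hm _ (Set.left_mem_Icc.2 hus'), hm _ (Set.right_mem_Icc.2 hus'), ha, hb]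
  linear_combination h1 - h2

/-- A continuous logarithm along an arc, jointly in the base point from a ball missing the arc. -/
theorem exists_log_increment {γ : ℝ → Eu 2} (hγ : Continuous γ) {a b r : ℝ} {z : Eu 2}
    (hab : a ≤ b) (h : ∀ x ∈ Set.Icc a b, γ x ∉ Metric.ball z r) :
    ∃ P : Eu 2 × ℝ → ℂ, ContinuousOn P (Metric.ball z r ×ˢ Set.Icc a b) ∧
      (∀ q ∈ Metric.ball z r, ∀ x ∈ Set.Icc a b,
        Complex.exp (P (q, x)) = planar (γ x) - planar q) ∧
      ContinuousOn (fun q => P (q, b) - P (q, a)) (Metric.ball z r) := by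
  have hg : Continuous fun y : Eu 2 × ℝ => planar (γ y.2) - planar y.1 := by
    have := continuous_planar
    fun_prop
  have hconv : Convex ℝ (Metric.ball z r ×ˢ Set.Icc a b) := by
    have h1 : Convex ℝ (Metric.ball z r) := convex_ball z r
    have h2 : Convex ℝ (Set.Icc a b) := convex_Icc a b
    exact h1.prod h2
  obtain ⟨P, hP, hP'⟩ := exists_log (E := Eu 2 × ℝ) hconv hg.continuousOn
    (by
      rintro ⟨q, x⟩ ⟨hq, hx⟩ h0
      have h1 : γ x = q := planar_injective (sub_eq_zero.1 h0)
      exact h x hx (h1 ▸ hq))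
  refine ⟨P, hP, fun q hq x hx => hP' (q, x) ⟨hq, hx⟩, ContinuousOn.sub ?_ ?_⟩
  · exact hP.comp (f := fun q => (q, b)) (by fun_prop) fun q hq => ⟨hq, Set.right_mem_Icc.2 hab⟩
  · exact hP.comp (f := fun q => (q, a)) (by fun_prop) fun q hq => ⟨hq, Set.left_mem_Icc.2 hab⟩

namespace Substitution

variable {S : Substitution 2} {t u : S.Tile} {T : Set S.Tile}

namespace TileBoundary

theorem eq_of_subset {e e' : Set (Eu 2)} (he : e ∈ S.cells {t} 1)
    (he' : e' ∈ S.cells {t} 1) (h : e ⊆ e') : e' = e := by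
  obtain ⟨z, hz⟩ := (isCellComplex_singleton t).openCell_nonempty he
  exact edge_eq_of_opn he' he ⟨h hz.1, hz.2⟩ hz

/-- The rest of the boundary stays away from an interior point of an edge. -/
theorem exists_ball_disjoint (B : TileBoundary S t) {e : Set (Eu 2)} (he : e ∈ S.cells {t} 1)
    {z : Eu 2} (hz : z ∈ S.opn {t} 1 e) :
    ∃ r > 0, ∀ x ∈ Set.Icc (B.term e) (B.init e + 1), B.γ x ∉ Metric.ball z r := by
  have hK : IsCompact (B.γ '' Set.Icc (B.term e) (B.init e + 1)) :=
    isCompact_Icc.image B.param.continuous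
  have hzK : z ∉ B.γ '' Set.Icc (B.term e) (B.init e + 1) := by
    rintro ⟨x, hx, rfl⟩
    obtain ⟨n, h1, h2⟩ := (B.mem_opn_iff he).1 hz
    have h3 := int_le_of_lt_add_one (m := n) (k := 0) (by push_cast; linarith [hx.2])
    have h4 := int_le_of_lt_add_one (m := 1) (k := n) (by push_cast; linarith [hx.1])
    push_cast at h3 h4
    linarith
  obtain ⟨r, hr, hsub⟩ := Metric.isOpen_iff.1 hK.isClosed.isOpen_compl z hzK
  exact ⟨r, hr, fun x hx hxr => hsub hxr ⟨x, hx, rfl⟩⟩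

theorem exists_interior_mem_ball (B : TileBoundary S t) {z : Eu 2} (hz : z ∈ S.supp t) {r : ℝ}
    (hr : 0 < r) : ∃ q ∈ interior (S.supp t), q ∈ Metric.ball z r := by
  rw [B.interior_eq]
  obtain ⟨q, h1, h2⟩ := mem_closure_iff.1 ((isCellComplex_singleton t).subset_closure_openCell
    (supp_mem_cells (P := {t}) rfl) hz) _ Metric.isOpen_ball (Metric.mem_ball_self hr)
  exact ⟨q, h2, h1⟩

theorem exists_log_inside (B : TileBoundary S t) {q : Eu 2} (hq : q ∈ interior (S.supp t)) :
    ∃ L : ℝ → ℂ, Continuous L ∧ (∀ x, Complex.exp (L x) = planar (B.γ x) - planar q) ∧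
      ∀ x, L (x + 1) = L x + 2 * Real.pi * Complex.I := by
  obtain ⟨L, hL, h⟩ := B.param.winds q hq
  exact ⟨L, hL, fun x => (h x).1.symm, fun x => (h x).2⟩

theorem exists_log_outside (B : TileBoundary S t) {q : Eu 2} (hq : q ∉ S.supp t) :
    ∃ L : ℝ → ℂ, Continuous L ∧ (∀ x, Complex.exp (L x) = planar (B.γ x) - planar q) ∧
      ∀ x, L (x + 1) = L x + 0 := by
  obtain ⟨L, hL, h⟩ := B.param.fill (fun z => planar z - planar q)
    (continuous_planar.sub continuous_const).continuousOn
    (fun z hz h0 => hq (planar_injective (sub_eq_zero.1 h0) ▸ hz))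
  exact ⟨L, hL, fun x => (h x).1, fun x => by rw [(h x).2, add_zero]⟩

end TileBoundary

theorem IsTiling.notMem_supp_of_interior (hT : S.IsTiling T) (ht : t ∈ T) (hu : u ∈ T)
    (hne : u ≠ t) (B : TileBoundary S t) {q : Eu 2} (hq : q ∈ interior (S.supp t)) :
    q ∉ S.supp u := fun h => hne (hT.tile_eq le_rfl ht hu (by
      rw [hT.opn_eq le_rfl ht (supp_mem_cells rfl), ← B.interior_eq]; exact hq) h)

/-- Two tiles with a common edge run through it in opposite directions. -/
theorem IsTiling.ends_ne (hT : S.IsTiling T) (ht : t ∈ T) (hu : u ∈ T) (hne : u ≠ t)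
    (B : TileBoundary S t) (C : TileBoundary S u) {e : Set (Eu 2)} (het : e ∈ S.cells {t} 1)
    (heu : e ∈ S.cells {u} 1) :
    ¬ (B.γ (B.init e) = C.γ (C.init e) ∧ B.γ (B.term e) = C.γ (C.term e)) := by
  rintro ⟨hinit, hterm⟩
  have hIcc : ∀ y ∈ Set.Icc (C.init e) (C.term e), C.γ y ∈ e := fun y hy =>
    C.image_Icc e heu ▸ ⟨y, hy, rfl⟩
  obtain ⟨θ₀, hθ₀, hθ₀'⟩ := B.param.lift _ (convex_Icc (C.init e) (C.term e)) C.γ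
    C.param.continuous.continuousOn
    (fun y hy => by rw [B.frontier_eq]; exact edge_subset_skel het (hIcc y hy))
  have himg : B.γ '' (θ₀ '' Set.Icc (C.init e) (C.term e)) = e := by
    rw [Set.image_image]
    exact (Set.image_congr hθ₀').trans (C.image_Icc e heu)
  have h0 := hθ₀' _ (Set.left_mem_Icc.2 (C.lt e heu).le)
  have h1 := hθ₀' _ (Set.right_mem_Icc.2 (C.lt e heu).le)
  have hθn : ∃ n : ℤ, θ₀ (C.init e) = B.init e + n ∧ θ₀ (C.term e) = B.term e + n := by
    rcases B.path_dichotomy (C.lt e heu).le hθ₀ (by rw [h0, ← hinit]; exact B.vertex_init het)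
      (by rw [h1, ← hterm]; exact B.vertex_term het)
      (fun e' he' hsub => by
        rw [himg] at hsub ⊢
        exact TileBoundary.eq_of_subset he' het hsub) with h | ⟨e', he', n, h2, h3⟩
    · rw [h, h1] at h0
      exact absurd h0.symm (C.init_ne_term heu)
    · rw [himg] at h2
      subst h2
      rcases h3 with h3 | h3
      · exact ⟨n, h3⟩
      · rw [h3.1, B.param.add_int, ← hinit] at h0
        exact absurd h0.symm (B.init_ne_term het)
  -- If both tiles traverse e in the same direction, the lift of the arc can be normalized to start
  -- and end at the parameters of e in t.
  obtain ⟨n, hn0, hn1⟩ := hθn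
  have hθ : ContinuousOn (fun y => θ₀ y - n) (Set.Icc (C.init e) (C.term e)) :=
    hθ₀.sub continuousOn_const
  have hθ' : ∀ y ∈ Set.Icc (C.init e) (C.term e), B.γ (θ₀ y - n) = C.γ y := fun y hy => by
    rw [← hθ₀' y hy, ← B.param.add_int (θ₀ y - n) n, sub_add_cancel]
  obtain ⟨z, hz⟩ := hT.complex.openCell_nonempty (cells_tile_subset ht 1 het)
  change z ∈ S.opn T 1 e at hz
  have hzt : z ∈ S.opn {t} 1 e := by rwa [← hT.opn_eq le_rfl ht het]
  have hzu : z ∈ S.opn {u} 1 e := by rwa [← hT.opn_eq le_rfl hu heu]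
  obtain ⟨r₁, hr₁, h₁⟩ := B.exists_ball_disjoint het hzt
  obtain ⟨r₂, hr₂, h₂⟩ := C.exists_ball_disjoint heu hzu
  have hr : 0 < min r₁ r₂ := lt_min hr₁ hr₂
  obtain ⟨P, hPc, hP, hPd⟩ := exists_log_increment B.param.continuous (r := min r₁ r₂) (z := z)
    (B.lt_add_one e het).le fun x hx h =>
      h₁ x hx (Metric.ball_subset_ball (min_le_left _ _) h)
  obtain ⟨Q, hQc, hQ, hQd⟩ := exists_log_increment C.param.continuous (r := min r₁ r₂) (z := z)
    (C.lt_add_one e heu).le fun x hx h =>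
      h₂ x hx (Metric.ball_subset_ball (min_le_right _ _) h)
  have hB1 : B.γ (B.init e + 1) = B.γ (B.init e) := by simpa using B.param.add_int (B.init e) 1
  have hC1 : C.γ (C.init e + 1) = C.γ (C.init e) := by simpa using C.param.add_int (C.init e) 1
  -- Near an interior point z of e both complementary arcs stay away. The difference of their
  -- logarithmic increments is then a continuous multiple of 2πi in q, hence constant on the ball.
  obtain ⟨k, hk⟩ := log_unique (convex_ball z (min r₁ r₂)).isPreconnected hPd hQd (fun q hq => by
    rw [Complex.exp_sub, Complex.exp_sub, hP q hq _ (Set.left_mem_Icc.2 (B.lt_add_one e het).le),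
      hP q hq _ (Set.right_mem_Icc.2 (B.lt_add_one e het).le),
      hQ q hq _ (Set.left_mem_Icc.2 (C.lt_add_one e heu).le),
      hQ q hq _ (Set.right_mem_Icc.2 (C.lt_add_one e heu).le), hB1, hC1, hinit, hterm])
  have key : ∀ q ∈ Metric.ball z (min r₁ r₂), ∀ (L M : ℝ → ℂ) (a b : ℂ), Continuous L →
      Continuous M → (∀ x, Complex.exp (L x) = planar (B.γ x) - planar q) →
      (∀ x, Complex.exp (M x) = planar (C.γ x) - planar q) → (∀ x, L (x + 1) = L x + a) →
      (∀ x, M (x + 1) = M x + b) → (k : ℂ) * (2 * Real.pi * Complex.I) = a - b := by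
    intro q hq L M a b hL hM hLq hMq ha hb
    have h := increment_sub_increment (γ := fun x => planar (B.γ x) - planar q)
      (η := fun x => planar (C.γ x) - planar q)
      (B.lt_add_one e het).le (C.lt e heu).le
      (C.lt_add_one e heu).le hθ (fun y hy => by simp only [hθ' y hy])
      (by rw [hn0, add_sub_cancel_right]) (by rw [hn1, add_sub_cancel_right]) hL hM hLq hMq ha hb
      (P := fun x => P (q, x)) (Q := fun x => Q (q, x))
      (hPc.comp (f := fun x => (q, x)) (by fun_prop) fun x hx => ⟨hq, hx⟩)
      (hQc.comp (f := fun x => (q, x)) (by fun_prop) fun x hx => ⟨hq, hx⟩)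
      (fun x hx => hP q hq x hx) (fun x hx => hQ q hq x hx)
    rw [← h, hk q hq]
    ring
  obtain ⟨q₁, hq₁, hq₁r⟩ := B.exists_interior_mem_ball (cell_subset_supp het hzt.1) hr
  obtain ⟨q₂, hq₂, hq₂r⟩ := C.exists_interior_mem_ball (cell_subset_supp heu hzu.1) hr
  obtain ⟨L₁, hL₁, hL₁', hL₁''⟩ := B.exists_log_inside hq₁
  obtain ⟨M₁, hM₁, hM₁', hM₁''⟩ :=
    C.exists_log_outside (hT.notMem_supp_of_interior ht hu hne B hq₁)
  obtain ⟨L₂, hL₂, hL₂', hL₂''⟩ :=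
    B.exists_log_outside (hT.notMem_supp_of_interior hu ht hne.symm C hq₂)
  obtain ⟨M₂, hM₂, hM₂', hM₂''⟩ := C.exists_log_inside hq₂
  -- A point q₁ inside t lies outside u and gives k = 1. A point q₂ inside u lies outside t and
  -- gives k = -1.
  have e1 := key q₁ hq₁r L₁ M₁ _ _ hL₁ hM₁ hL₁' hM₁' hL₁'' hM₁''
  have e2 := key q₂ hq₂r L₂ M₂ _ _ hL₂ hM₂ hL₂' hM₂' hL₂'' hM₂''
  have hpi : (2 * Real.pi * Complex.I : ℂ) ≠ 0 := by simp [Real.pi_ne_zero]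
  have e3 : (2 : ℂ) * (2 * Real.pi * Complex.I) = 0 := by linear_combination e2 - e1
  exact hpi ((mul_eq_zero.1 e3).resolve_left two_ne_zero)

theorem inc_eq_or (o : S.Orientation) (hT : T ∈ S.hull) (ht : t ∈ T) {e : Set (Eu 2)}
    (he : e ∈ S.cells {t} 1) :
    S.inc o T 1 (S.supp t) e = 1 ∨ S.inc o T 1 (S.supp t) e = -1 := by
  obtain ⟨B⟩ := hT.1.nonempty_tileBoundary ht
  rcases B.ends_eq o hT ht he with h | h
  · exact Or.inl (B.inc_eq_one he h)
  · exact Or.inr (B.inc_eq_neg_one he h)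

theorem inc_add_inc (o : S.Orientation) (hT : T ∈ S.hull) (ht : t ∈ T) (hu : u ∈ T) (hne : u ≠ t)
    {e : Set (Eu 2)} (het : e ∈ S.cells {t} 1) (heu : e ∈ S.cells {u} 1) :
    S.inc o T 1 (S.supp t) e = - S.inc o T 1 (S.supp u) e := by
  obtain ⟨B⟩ := hT.1.nonempty_tileBoundary ht
  obtain ⟨C⟩ := hT.1.nonempty_tileBoundary hu
  have h := hT.1.ends_ne ht hu hne B C het heu
  rcases B.ends_eq o hT ht het with h1 | h1 <;> rcases C.ends_eq o hT hu heu with h2 | h2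
  · exact absurd ⟨h1.1.symm.trans h2.1, h1.2.symm.trans h2.2⟩ h
  · rw [B.inc_eq_one het h1, C.inc_eq_neg_one heu h2, neg_neg]
  · rw [B.inc_eq_neg_one het h1, C.inc_eq_one heu h2]
  · exact absurd ⟨h1.2.symm.trans h2.2, h1.1.symm.trans h2.1⟩ h

/-- Otherwise an interior point of e would have a neighbourhood covered by t alone, although it lies
on the frontier of t. -/
theorem IsTiling.exists_adjacent (hT : S.IsTiling T) (ht : t ∈ T) {e : Set (Eu 2)}
    (he : e ∈ S.cells {t} 1) : ∃ u ∈ T, u ≠ t ∧ e ∈ S.cells {u} 1 := by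
  obtain ⟨B⟩ := hT.nonempty_tileBoundary ht
  have he' := cells_tile_subset ht 1 he
  obtain ⟨z, hz⟩ := hT.complex.openCell_nonempty he'
  by_contra! hno
  have hzf : z ∉ interior (S.supp t) := by
    have : z ∈ frontier (S.supp t) := by rw [B.frontier_eq]; exact edge_subset_skel he hz.1
    exact fun h => this.2 h
  refine hzf (mem_interior.2 ⟨_, ?_, (hT.isClosed_iUnion_supp (T \ {t})
    Set.sdiff_subset).isOpen_compl, ?_⟩)
  · intro y hy
    obtain ⟨u, hu, hyu⟩ := hT.exists_mem_supp y
    by_cases hut : u = t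
    · rwa [← hut]
    · exact absurd (Set.mem_biUnion (show u ∈ T \ {t} from ⟨hu, hut⟩) hyu) hy
  · simp only [Set.mem_compl_iff, Set.mem_iUnion, not_exists]
    rintro u ⟨hu, hut⟩ hzu
    exact hno u hu hut (hT.mem_cells_of_inter le_rfl hu he' ⟨z, hzu, hz⟩)

/-- Tiles of `T` that share an edge. -/
def Adjacent (T : Set S.Tile) (t u : S.Tile) : Prop :=
  ∃ e, t ∈ T ∧ u ∈ T ∧ u ≠ t ∧ e ∈ S.cells {t} 1 ∧ e ∈ S.cells {u} 1

theorem delta_one_cls (hmaps : Set.MapsTo S.subst S.hull S.hull) (hprim : S.Primitive)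
    (o : S.Orientation) (hT : T ∈ S.hull) (ht : t ∈ T) (hu : u ∈ T) (hne : u ≠ t)
    {e : Set (Eu 2)} (het : e ∈ S.cells {t} 1) (heu : e ∈ S.cells {u} 1) :
    S.delta o T 1 (S.cls T T 1 e) = S.inc o T 1 (S.supp t) e •
      (S.cls T T 2 (S.supp t) - S.cls T T 2 (S.supp u)) := by
  have he := cells_tile_subset ht 1 het
  have hcof : S.cofaces T 1 e = {S.supp t, S.supp u} := by
    ext f
    constructor
    · rintro ⟨hf, hsub⟩
      obtain ⟨v, hv, rfl⟩ := mem_cells_top.1 hf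
      have hev := (hT.1.mem_cells_iff_subset le_rfl hv he).2 hsub
      by_contra h
      simp only [Set.mem_insert_iff, Set.mem_singleton_iff, not_or] at h
      -- Three tiles at one edge would have pairwise opposite signs.
      have h1 := inc_add_inc o hT ht hu hne het heu
      have h2 := inc_add_inc o hT ht hv (fun h' => h.1 (by rw [h'])) het hev
      have h3 := inc_add_inc o hT hu hv (fun h' => h.2 (by rw [h'])) heu hev
      rcases inc_eq_or o hT hv hev with h4 | h4 <;> rw [h4] at h2 h3 <;> rw [h2, h3] at h1 <;>
        norm_num at h1
    · rintro (rfl | rfl)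
      · exact ⟨supp_mem_cells ht, cell_subset_supp het⟩
      · exact ⟨supp_mem_cells hu, cell_subset_supp heu⟩
  rw [delta_cls_cofaces (Or.inr rfl) hmaps hprim o hT hT he, hcof,
    finsum_mem_pair (fun h => hne (hT.1.inj hu ht h.symm)), inc_add_inc o hT hu ht hne.symm heu het,
    neg_smul, smul_sub, sub_eq_add_neg]

theorem cls_sub_cls_mem_of_adjacent (hmaps : Set.MapsTo S.subst S.hull S.hull)
    (hprim : S.Primitive) (o : S.Orientation) (hT : T ∈ S.hull) (h : Adjacent T t u) :
    S.cls T T 2 (S.supp t) - S.cls T T 2 (S.supp u) ∈ LinearMap.range (S.delta o T 1) := by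
  obtain ⟨e, ht, hu, hne, het, heu⟩ := h
  have h := delta_one_cls hmaps hprim o hT ht hu hne het heu
  refine ⟨S.inc o T 1 (S.supp t) e • S.cls T T 1 e, ?_⟩
  rw [map_smul, h, smul_smul]
  rcases inc_eq_or o hT ht het with h1 | h1 <;> rw [h1] <;> simp

theorem IsTiling.countable {d : ℕ} {S : Substitution d} {T : Set S.Tile} (hT : S.IsTiling T) :
    T.Countable := by
  have : T ⊆ ⋃ n : ℕ, S.patchAt T (Metric.closedBall 0 n) := by
    intro t ht
    obtain ⟨z, hz⟩ := supp_nonempty t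
    obtain ⟨n, hn⟩ := exists_nat_ge ‖z‖
    exact Set.mem_iUnion.2 ⟨n, ht, z, hz, by simpa using hn⟩
  exact (Set.countable_iUnion fun n : ℕ => (hT.patchAt_finite 0 n).countable).mono this

/-- The plane without the countably many vertices is connected. If the tiles reachable from t and
the others were both present, their closed unions would meet away from the vertices, on an edge
shared by a tile of each kind. -/
theorem IsTiling.adjacent_connected (hT : S.IsTiling T) (ht : t ∈ T) (hu : u ∈ T) :
    Relation.ReflTransGen (Adjacent T) t u := by
  by_contra hno
  let A : Set S.Tile := {v ∈ T | Relation.ReflTransGen (Adjacent T) t v}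
  let V : Set (Eu 2) := {v | {v} ∈ S.cells T 0}
  have hV : V.Countable := by
    have : (S.cells T 0).Countable := by
      have : S.cells T 0 = ⋃ v ∈ T, S.cells {v} 0 := by
        ext σ
        rw [mem_cells]
        simp
      rw [this]
      exact hT.countable.biUnion fun v _ => (cells_finite (Set.finite_singleton v) 0).countable
    exact this.preimage_of_injOn Set.singleton_injective.injOn
  have hconn : IsPreconnected Vᶜ := (hV.isPathConnected_compl_of_one_lt_rank (by
    rw [← Module.finrank_eq_rank, finrank_euclideanSpace_fin]
    norm_num)).isConnected.isPreconnected
  have hne : ∀ v ∈ T, (Vᶜ ∩ S.supp v).Nonempty := by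
    intro v hv
    obtain ⟨z, hz⟩ := hT.complex.openCell_nonempty (supp_mem_cells hv)
    exact ⟨z, fun h => hz.2 ⟨0, two_pos, _, h, rfl⟩, hz.1⟩
  have hA : A ⊆ T := Set.sep_subset _ _
  obtain ⟨z, hzV, hz1, hz2⟩ := isPreconnected_closed_iff.1 hconn _ _
    (hT.isClosed_iUnion_supp A hA) (hT.isClosed_iUnion_supp (T \ A) Set.sdiff_subset)
    (by
      intro z _
      obtain ⟨v, hv, hzv⟩ := hT.exists_mem_supp z
      by_cases hvA : v ∈ A
      · exact Or.inl (Set.mem_biUnion hvA hzv)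
      · exact Or.inr (Set.mem_biUnion (show v ∈ T \ A from ⟨hv, hvA⟩) hzv))
    ((hne t ht).mono fun z hz => ⟨hz.1, Set.mem_biUnion (show t ∈ A from ⟨ht, .refl⟩) hz.2⟩)
    ((hne u hu).mono fun z hz => ⟨hz.1,
      Set.mem_biUnion (show u ∈ T \ A from ⟨hu, fun h => hno h.2⟩) hz.2⟩)
  simp only [Set.mem_iUnion, exists_prop] at hz1 hz2
  obtain ⟨a, ha, hza⟩ := hz1
  obtain ⟨b, hb, hzb⟩ := hz2
  have hba : b ≠ a := fun h => hb.2 (h ▸ ha)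
  have hzopn : z ∉ S.opn T 2 (S.supp a) := fun h => hba (hT.tile_eq le_rfl ha.1 hb.1 h hzb)
  rw [hT.opn_eq le_rfl ha.1 (supp_mem_cells rfl)] at hzopn
  have hzs : z ∈ skel (S.cells {a}) 2 := by
    by_contra h
    exact hzopn ⟨hza, h⟩
  obtain ⟨j, hj, e, he, hze⟩ := hzs
  interval_cases j
  · obtain ⟨v, rfl⟩ := (isCellComplex_singleton a).exists_vertex he
    rw [Set.mem_singleton_iff.1 hze] at hzV
    exact hzV (cells_tile_subset ha.1 0 he)
  · have hzo : z ∈ S.opn T 1 e := ⟨hze, fun h => hzV (vertex_of_mem_skel_one h)⟩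
    have heb := hT.mem_cells_of_inter le_rfl hb.1 (cells_tile_subset ha.1 1 he) ⟨z, hzb, hzo⟩
    exact hb.2 ⟨hb.1, ha.2.tail ⟨e, ha.1, hb.1, hba, he, heb⟩⟩

end Substitution

end SubstTiling

/-! ### Coboundaries in the top degree -/

namespace SubstTiling

/-- A subgroup generated by signed differences of basis elements is the kernel of the signed
augmentation. -/
theorem mem_iff_linearCombination_eq_zero {X : Type} {R : Submodule ℤ (X →₀ ℤ)} {ε : X → ℤ}
    (hε : ∀ x, ε x * ε x = 1) (h1 : ∀ z ∈ R, Finsupp.linearCombination ℤ ε z = 0)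
    (h2 : ∀ x y, ε x • Finsupp.single x (1 : ℤ) - ε y • Finsupp.single y 1 ∈ R) (z : X →₀ ℤ) :
    z ∈ R ↔ Finsupp.linearCombination ℤ ε z = 0 := by
  refine ⟨h1 z, fun hz => ?_⟩
  rcases isEmpty_or_nonempty X with hX | ⟨⟨y⟩⟩
  · rw [Subsingleton.elim z 0]
    exact R.zero_mem
  -- Modulo R, every element is its signed augmentation times one fixed signed basis element.
  have key : ∀ z : X →₀ ℤ,
      z - Finsupp.linearCombination ℤ ε z • ε y • Finsupp.single y (1 : ℤ) ∈ R := by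
    intro z
    induction z using Finsupp.induction_linear with
    | zero => simp
    | add a b ha hb =>
      have := R.add_mem ha hb
      rw [map_add, add_smul]
      convert this using 1
      abel
    | single x n =>
      have := R.smul_mem (n * ε x) (h2 x y)
      rw [Finsupp.linearCombination_single, smul_eq_mul]
      convert this using 1
      rw [smul_sub, smul_smul (n * ε x) (ε x), mul_assoc, hε, mul_one, Finsupp.smul_single,
        smul_eq_mul, mul_one, Finsupp.smul_single n, smul_eq_mul, mul_one]
  have := key z
  rwa [hz, zero_smul, sub_zero] at this

namespace Substitution

theorem exists_cls_eq_single {d : ℕ} {S : Substitution d} (hd : d = 1 ∨ d = 2)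
    (hmaps : Set.MapsTo S.subst S.hull S.hull) (hprim : S.Primitive) {T T' : Set S.Tile}
    (hT : T ∈ S.hull) (hT' : T' ∈ S.hull) {k : ℕ} {σ : Set (Eu d)} (hσ : σ ∈ S.cells T' k) :
    ∃ c, S.cls T T' k σ = Finsupp.single c 1 := by
  obtain ⟨ρ, hρ⟩ := exists_stableEq hd hmaps hprim hT hT' hσ
  exact ⟨_, cls_eq_single ρ hρ⟩

section

variable {S : Substitution 2} {T : Set S.Tile}

theorem linearCombination_delta_one (hmaps : Set.MapsTo S.subst S.hull S.hull)
    (hprim : S.Primitive) (o : S.Orientation) (hT : T ∈ S.hull) (z : StableCell S T 1 →₀ ℤ) :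
    Finsupp.linearCombination ℤ (fun _ => (1 : ℤ)) (S.delta o T 1 z) = 0 := by
  induction z using Finsupp.induction_linear with
  | zero => simp
  | add a b ha hb => rw [map_add, map_add, ha, hb, add_zero]
  | single c n =>
    have hc := rep_mem c
    obtain ⟨t, ht, het⟩ := mem_cells.1 hc
    obtain ⟨u, hu, hne, heu⟩ := hT.1.exists_adjacent ht het
    obtain ⟨a, ha⟩ := exists_cls_eq_single (Or.inr rfl) hmaps hprim hT hT (supp_mem_cells ht)
    obtain ⟨b, hb⟩ := exists_cls_eq_single (Or.inr rfl) hmaps hprim hT hT (supp_mem_cells hu)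
    rw [← mul_one n, ← smul_eq_mul, ← Finsupp.smul_single, ← cls_rep, map_smul,
      delta_one_cls hmaps hprim o hT ht hu hne het heu, ha, hb]
    simp

theorem cls_sub_cls_mem (hmaps : Set.MapsTo S.subst S.hull S.hull)
    (hprim : S.Primitive) (o : S.Orientation) (hT : T ∈ S.hull) {t u : S.Tile} (ht : t ∈ T)
    (hu : u ∈ T) : S.cls T T 2 (S.supp t) - S.cls T T 2 (S.supp u) ∈
      LinearMap.range (S.delta o T 1) := by
  have h := hT.1.adjacent_connected ht hu
  induction h with
  | refl => simp
  | tail _ hbc ih =>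
    have := Submodule.add_mem _ (ih hbc.choose_spec.1)
      (cls_sub_cls_mem_of_adjacent hmaps hprim o hT hbc)
    rwa [sub_add_sub_cancel] at this

theorem mem_range_delta_one_iff (hmaps : Set.MapsTo S.subst S.hull S.hull) (hprim : S.Primitive)
    (o : S.Orientation) (hT : T ∈ S.hull) (z : StableCell S T 2 →₀ ℤ) :
    z ∈ LinearMap.range (S.delta o T 1) ↔
      Finsupp.linearCombination ℤ (fun _ => (1 : ℤ)) z = 0 := by
  refine mem_iff_linearCombination_eq_zero (fun _ => one_mul 1) ?_ ?_ z
  · rintro _ ⟨y, rfl⟩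
    exact linearCombination_delta_one hmaps hprim o hT y
  · intro x y
    obtain ⟨t, ht, hxt⟩ := mem_cells_top.1 (rep_mem x)
    obtain ⟨u, hu, hyu⟩ := mem_cells_top.1 (rep_mem y)
    rw [one_smul, one_smul, ← cls_rep, ← cls_rep, hxt, hyu]
    exact cls_sub_cls_mem hmaps hprim o hT ht hu

/-- Exactly one tile of ω(T) is mapped onto t. A shrunk tile from another tile v cannot be, since
its image stays in v. So `W` sends basis elements to basis elements. -/
theorem linearCombination_W (hmaps : Set.MapsTo S.subst S.hull S.hull) (hprim : S.Primitive)
    (o : S.Orientation) (hT : T ∈ S.hull) (H : S.Homotopy T) (z : StableCell S T 2 →₀ ℤ) :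
    Finsupp.linearCombination ℤ (fun _ => (1 : ℤ)) (S.W o H 2 z) =
      Finsupp.linearCombination ℤ (fun _ => (1 : ℤ)) z := by
  induction z using Finsupp.induction_linear with
  | zero => simp
  | add a b ha hb => rw [map_add, map_add, map_add, ha, hb]
  | single c n =>
    have hc := rep_mem c
    obtain ⟨t, ht, hct⟩ := mem_cells_top.1 hc
    obtain ⟨t', ⟨ht', himg⟩, huniq⟩ := H.tile t ht
    have huT : t' ∈ S.subst T := mem_subst.2 ⟨t, ht, ht'⟩
    have hfib : H.fib 2 (S.supp t) = {S.supp t'} := by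
      ext τ
      constructor
      · rintro ⟨hτ, h⟩
        obtain ⟨u, hu, rfl⟩ := mem_cells_top.1 hτ
        obtain ⟨v, hv, huv⟩ := mem_subst.1 hu
        have hsub := H.image_cell_subset hv huv (supp_mem_cells (P := {u}) rfl)
        obtain rfl := hT.1.eq_of_supp_subset le_rfl ht hv (h ▸ hsub)
        rw [huniq u ⟨huv, h⟩]
        rfl
      · rintro rfl
        exact ⟨supp_mem_cells huT, himg⟩
    obtain ⟨a, ha⟩ := exists_cls_eq_single (Or.inr rfl) hmaps hprim hT (hmaps hT)
      (supp_mem_cells huT)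
    have hW : S.W o H 2 (Finsupp.single c 1) = Finsupp.single a 1 := by
      rw [← cls_rep, W_cls_fib le_rfl hmaps o hT H hc, hct, hfib, finsum_mem_singleton,
        sgn_of_ne o H (by norm_num), one_smul, ha]
    rw [← mul_one n, ← smul_eq_mul, ← Finsupp.smul_single, map_smul, hW]
    simp

end

/-! ### Tilings of the line -/

section

variable {S : Substitution 1}

theorem eq_iff_coord (z w : Eu 1) : z = w ↔ z 0 = w 0 := by
  refine ⟨fun h => by rw [h], fun h => ?_⟩
  ext i
  rwa [Subsingleton.elim i 0]

/-- The coordinate of an arc parametrization is continuous and injective, hence strictly monotone.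
-/
theorem exists_interval (t : S.Tile) : ∃ a b : ℝ, a < b ∧ S.supp t = {z | z 0 ∈ Set.Icc a b} ∧
    S.opn {t} 1 (S.supp t) = {z | z 0 ∈ Set.Ioo a b} := by
  have hK := isCellComplex_singleton t
  obtain ⟨ψ, hψ, hi, hr, ho⟩ := hK.exists_arc_param (supp_mem_cells (P := {t}) rfl)
  have hc : Continuous fun x => ψ x 0 := by fun_prop
  have hinj : Set.InjOn (fun x => ψ x 0) (Set.Icc 0 1) := fun x hx y hy h =>
    hi hx hy ((eq_iff_coord _ _).2 h)
  have h0 : (0 : ℝ) ∈ Set.Icc (0 : ℝ) 1 := by simp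
  have h1 : (1 : ℝ) ∈ Set.Icc (0 : ℝ) 1 := by simp
  have hset : ∀ (A B : Set ℝ), (fun x => ψ x 0) '' A = B → ψ '' A = {z | z 0 ∈ B} := by
    rintro A _ rfl
    ext z
    constructor
    · rintro ⟨x, hx, rfl⟩
      exact ⟨x, hx, rfl⟩
    · rintro ⟨x, hx, h⟩
      exact ⟨x, hx, (eq_iff_coord _ _).2 h⟩
  rcases hc.continuousOn.strictMonoOn_of_injOn_Icc' zero_le_one hinj with hm | hm
  · refine ⟨ψ 0 0, ψ 1 0, hm h0 h1 one_pos, ?_, ?_⟩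
    · rw [← hr]
      refine hset _ _ (subset_antisymm ?_ (intermediate_value_Icc zero_le_one hc.continuousOn))
      rintro _ ⟨x, hx, rfl⟩
      exact ⟨hm.monotoneOn h0 hx hx.1, hm.monotoneOn hx h1 hx.2⟩
    · refine ho.symm.trans ?_
      refine hset _ _ (subset_antisymm ?_ (intermediate_value_Ioo zero_le_one hc.continuousOn))
      rintro _ ⟨x, hx, rfl⟩
      exact ⟨hm h0 (Set.Ioo_subset_Icc_self hx) hx.1, hm (Set.Ioo_subset_Icc_self hx) h1 hx.2⟩
  · refine ⟨ψ 1 0, ψ 0 0, hm h0 h1 one_pos, ?_, ?_⟩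
    · rw [← hr]
      refine hset _ _ (subset_antisymm ?_ (intermediate_value_Icc' zero_le_one hc.continuousOn))
      rintro _ ⟨x, hx, rfl⟩
      exact ⟨hm.antitoneOn hx h1 hx.2, hm.antitoneOn h0 hx hx.1⟩
    · refine ho.symm.trans ?_
      refine hset _ _ (subset_antisymm ?_ (intermediate_value_Ioo' zero_le_one hc.continuousOn))
      rintro _ ⟨x, hx, rfl⟩
      exact ⟨hm (Set.Ioo_subset_Icc_self hx) h1 hx.2, hm h0 (Set.Ioo_subset_Icc_self hx) hx.1⟩

/-- The left end of a one-dimensional tile. -/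
noncomputable def left (t : S.Tile) : ℝ := (exists_interval t).choose

/-- The right end of a one-dimensional tile. -/
noncomputable def right (t : S.Tile) : ℝ := (exists_interval t).choose_spec.choose

theorem left_lt_right (t : S.Tile) : left t < right t :=
  (exists_interval t).choose_spec.choose_spec.1

theorem mem_supp_iff {t : S.Tile} {z : Eu 1} : z ∈ S.supp t ↔ left t ≤ z 0 ∧ z 0 ≤ right t := by
  conv_lhs => rw [(exists_interval t).choose_spec.choose_spec.2.1]
  rfl

theorem mem_opn_tile_iff {t : S.Tile} {z : Eu 1} :
    z ∈ S.opn {t} 1 (S.supp t) ↔ left t < z 0 ∧ z 0 < right t := by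
  conv_lhs => rw [(exists_interval t).choose_spec.choose_spec.2.2]
  rfl

theorem vertex_iff {t : S.Tile} {v : Eu 1} :
    {v} ∈ S.cells {t} 0 ↔ v 0 = left t ∨ v 0 = right t := by
  have hlt := left_lt_right t
  rw [← mem_skel_one_iff]
  constructor
  · intro h
    have h1 := mem_supp_iff.1 (skel_subset_supp t 1 h)
    have h2 : v ∉ S.opn {t} 1 (S.supp t) := fun h' => h'.2 h
    rw [mem_opn_tile_iff] at h2
    by_contra! h3
    exact h2 ⟨lt_of_le_of_ne h1.1 h3.1.symm, lt_of_le_of_ne h1.2 h3.2⟩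
  · intro h
    have h1 : v ∈ S.supp t := by
      rw [mem_supp_iff]
      rcases h with h | h <;> rw [h] <;> simp [hlt.le]
    by_contra h2
    have h3 := mem_opn_tile_iff.1 (show v ∈ S.opn {t} 1 (S.supp t) from ⟨h1, h2⟩)
    rcases h with h | h <;> rw [h] at h3
    · exact lt_irrefl _ h3.1
    · exact lt_irrefl _ h3.2

variable {T : Set S.Tile}

/-- The sign of the orientation of an edge of the line. -/
noncomputable def edgeSign (o : S.Orientation) (T : Set S.Tile) (e : Set (Eu 1)) : ℤ :=
  if o.src T e 0 < o.tgt T e 0 then 1 else -1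

theorem edgeSign_mul_self (o : S.Orientation) (T : Set S.Tile) (e : Set (Eu 1)) :
    edgeSign o T e * edgeSign o T e = 1 := by
  rw [edgeSign]
  split_ifs <;> rfl

theorem ends_eq_line (o : S.Orientation) (hT : T ∈ S.hull) {t : S.Tile} (ht : t ∈ T) :
    (o.src T (S.supp t) 0 = left t ∧ o.tgt T (S.supp t) 0 = right t) ∨
      (o.src T (S.supp t) 0 = right t ∧ o.tgt T (S.supp t) 0 = left t) := by
  have he := supp_mem_cells ht
  have key : ∀ v ∈ S.supp t, {v} ∈ S.cells T 0 → v 0 = left t ∨ v 0 = right t :=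
    fun v hv hv0 => vertex_iff.1 (hT.1.mem_cells_zero (by norm_num) ht hv0 hv)
  have h1 := key _ (o.src_mem T hT _ he).1 (o.src_mem T hT _ he).2
  have h2 := key _ (o.tgt_mem T hT _ he).1 (o.tgt_mem T hT _ he).2
  have h3 := o.src_ne_tgt T hT _ he
  rw [ne_eq, eq_iff_coord] at h3
  rcases h1 with h1 | h1 <;> rcases h2 with h2 | h2
  · exact absurd (h1.trans h2.symm) h3
  · exact Or.inl ⟨h1, h2⟩
  · exact Or.inr ⟨h1, h2⟩
  · exact absurd (h1.trans h2.symm) h3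

theorem inc_line (o : S.Orientation) (hT : T ∈ S.hull) {t : S.Tile} (ht : t ∈ T) (v : Eu 1)
    [Decidable (right t = v 0)] [Decidable (left t = v 0)] :
    S.inc o T 0 (S.supp t) {v} = edgeSign o T (S.supp t) *
      ((if right t = v 0 then 1 else 0) - if left t = v 0 then 1 else 0) := by
  classical
  have hlt := left_lt_right t
  rw [inc_vertex o hT (supp_mem_cells ht), edgeSign]
  simp only [eq_iff_coord]
  rcases ends_eq_line o hT ht with h | h
  · simp only [h.1, h.2]
    rw [if_pos hlt, one_mul]
  · simp only [h.1, h.2]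
    rw [if_neg hlt.not_gt]
    ring

theorem IsTiling.right_injOn (hT : S.IsTiling T) : Set.InjOn (right : S.Tile → ℝ) T := by
  intro t ht u hu h
  obtain ⟨x, hx1, hx2⟩ := exists_between (max_lt (left_lt_right t) (h ▸ left_lt_right u))
  refine (hT.tile_eq (by norm_num) ht hu (y := EuclideanSpace.single 0 x) ?_ ?_).symm
  · rw [hT.opn_eq (by norm_num) ht (supp_mem_cells rfl), mem_opn_tile_iff]
    simpa using ⟨(le_max_left _ _).trans_lt hx1, hx2⟩
  · rw [mem_supp_iff]
    simpa using ⟨((le_max_right _ _).trans_lt hx1).le, by rw [← h]; exact hx2.le⟩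

theorem IsTiling.left_injOn (hT : S.IsTiling T) : Set.InjOn (left : S.Tile → ℝ) T := by
  intro t ht u hu h
  obtain ⟨x, hx1, hx2⟩ := exists_between (lt_min (left_lt_right t) (h.symm ▸ left_lt_right u))
  refine (hT.tile_eq (by norm_num) ht hu (y := EuclideanSpace.single 0 x) ?_ ?_).symm
  · rw [hT.opn_eq (by norm_num) ht (supp_mem_cells rfl), mem_opn_tile_iff]
    simpa using ⟨hx1, hx2.trans_le (min_le_left _ _)⟩
  · rw [mem_supp_iff]
    simpa using ⟨by rw [← h]; exact hx1.le, (hx2.trans_le (min_le_right _ _)).le⟩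

theorem IsTiling.meet (hT : S.IsTiling T) {t u : S.Tile} (ht : t ∈ T) (hu : u ∈ T) (hne : u ≠ t)
    {z : Eu 1} (hzt : z ∈ S.supp t) (hzu : z ∈ S.supp u) :
    {z} ∈ S.cells T 0 ∧ ((right t = z 0 ∧ left u = z 0) ∨ (right u = z 0 ∧ left t = z 0)) := by
  have h1 : {z} ∈ S.cells {t} 0 := by
    rw [← mem_skel_one_iff]
    by_contra h
    refine hne (hT.tile_eq (by norm_num) ht hu (y := z) ?_ hzu)
    rw [hT.opn_eq (by norm_num) ht (supp_mem_cells rfl)]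
    exact ⟨hzt, h⟩
  have h2 := cells_tile_subset ht 0 h1
  have h3 := hT.mem_cells_zero (by norm_num) hu h2 hzu
  refine ⟨h2, ?_⟩
  rcases vertex_iff.1 h1 with h4 | h4 <;> rcases vertex_iff.1 h3 with h5 | h5
  · exact absurd (hT.left_injOn hu ht (h5.symm.trans h4)) hne
  · exact Or.inr ⟨h5.symm, h4.symm⟩
  · exact Or.inl ⟨h4.symm, h5.symm⟩
  · exact absurd (hT.right_injOn hu ht (h5.symm.trans h4)) hne

/-- If only t contained v, a neighbourhood of v would be covered by t alone, but v is an end of t.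
-/
theorem IsTiling.exists_right_left (hT : S.IsTiling T) {v : Eu 1} (hv : {v} ∈ S.cells T 0) :
    ∃ t ∈ T, ∃ u ∈ T, right t = v 0 ∧ left u = v 0 := by
  obtain ⟨t, ht, hvt⟩ := mem_cells.1 hv
  have hvs : v ∈ S.supp t := cell_subset_supp hvt rfl
  have hex : ∃ u ∈ T, u ≠ t ∧ v ∈ S.supp u := by
    by_contra! hno
    have hmem : v ∈ (⋃ u ∈ T \ {t}, S.supp u)ᶜ := by
      simp only [Set.mem_compl_iff, Set.mem_iUnion, not_exists]
      exact fun u hu => hno u hu.1 hu.2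
    have hopen := (hT.isClosed_iUnion_supp (T \ {t}) Set.sdiff_subset).isOpen_compl
    have hc : Continuous fun x : ℝ => (EuclideanSpace.single 0 x : Eu 1) :=
      by
      refine (Isometry.of_dist_eq fun x y => ?_).continuous
      simp
    have hv0 : (EuclideanSpace.single 0 (v 0) : Eu 1) = v := by
      rw [eq_iff_coord]
      simp
    obtain ⟨r, hr, hball⟩ := Metric.isOpen_iff.1 (hopen.preimage hc) (v 0)
      (by rw [Set.mem_preimage, hv0]; exact hmem)
    have hin : ∀ x ∈ Metric.ball (v 0) r, left t ≤ x ∧ x ≤ right t := by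
      intro x hx
      obtain ⟨u, hu, hxu⟩ := hT.exists_mem_supp (EuclideanSpace.single 0 x)
      by_cases hut : u = t
      · rw [hut, mem_supp_iff] at hxu
        simpa using hxu
      · exact absurd (Set.mem_biUnion (show u ∈ T \ {t} from ⟨hu, hut⟩) hxu) (hball hx)
    have h1 := hin (v 0 - r / 2) (by simp [abs_of_pos hr]; linarith)
    have h2 := hin (v 0 + r / 2) (by simp [abs_of_pos hr]; linarith)
    rcases vertex_iff.1 hvt with h | h <;> linarith [h1.1, h2.2]
  obtain ⟨u, hu, hne, hvu⟩ := hex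
  rcases (hT.meet ht hu hne hvs hvu).2 with h | h
  · exact ⟨t, ht, u, hu, h⟩
  · exact ⟨u, hu, t, ht, h⟩

theorem delta_zero_cls (hmaps : Set.MapsTo S.subst S.hull S.hull) (hprim : S.Primitive)
    (o : S.Orientation) (hT : T ∈ S.hull) {t u : S.Tile} (ht : t ∈ T) (hu : u ∈ T) {v : Eu 1}
    (hv : {v} ∈ S.cells T 0) (hr : right t = v 0) (hl : left u = v 0) :
    S.delta o T 0 (S.cls T T 0 {v}) = edgeSign o T (S.supp t) • S.cls T T 1 (S.supp t) -
      edgeSign o T (S.supp u) • S.cls T T 1 (S.supp u) := by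
  classical
  have htlt := left_lt_right t
  have hult := left_lt_right u
  have hcof : S.cofaces T 0 {v} = {S.supp t, S.supp u} := by
    ext f
    constructor
    · rintro ⟨hf, hsub⟩
      obtain ⟨w, hw, rfl⟩ := mem_cells_top.1 hf
      rcases vertex_iff.1 (hT.1.mem_cells_zero (by norm_num) hw hv (hsub rfl)) with h | h
      · exact Or.inr (by rw [hT.1.left_injOn hw hu (h.symm.trans hl.symm)]; rfl)
      · exact Or.inl (by rw [hT.1.right_injOn hw ht (h.symm.trans hr.symm)])
    · rintro (rfl | rfl)
      · exact ⟨supp_mem_cells ht, Set.singleton_subset_iff.2 (mem_supp_iff.2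
          ⟨by linarith, by linarith⟩)⟩
      · exact ⟨supp_mem_cells hu, Set.singleton_subset_iff.2 (mem_supp_iff.2
          ⟨by linarith, by linarith⟩)⟩
  rw [delta_cls_cofaces (Or.inl rfl) hmaps hprim o hT hT hv, hcof,
    finsum_mem_pair (fun h => by
      have := hT.1.inj ht hu h
      subst this
      linarith), inc_line o hT ht, inc_line o hT hu, if_pos hr, if_neg (by linarith),
    if_neg (by linarith), if_pos hl, sub_zero, mul_one, zero_sub, mul_neg, mul_one, neg_smul,
    ← sub_eq_add_neg]

/-- Consecutive tiles of a tiling of the line. -/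
def Consecutive (T : Set S.Tile) (t u : S.Tile) : Prop :=
  t ∈ T ∧ u ∈ T ∧ ∃ v : Eu 1, {v} ∈ S.cells T 0 ∧
    ((right t = v 0 ∧ left u = v 0) ∨ (right u = v 0 ∧ left t = v 0))

theorem IsTiling.consecutive_connected (hT : S.IsTiling T) {t u : S.Tile} (ht : t ∈ T)
    (hu : u ∈ T) : Relation.ReflTransGen (Consecutive T) t u := by
  by_contra hno
  let A : Set S.Tile := {v ∈ T | Relation.ReflTransGen (Consecutive T) t v}
  have hA : A ⊆ T := Set.sep_subset _ _
  obtain ⟨z, -, hz1, hz2⟩ := isPreconnected_closed_iff.1 (isPreconnected_univ (α := Eu 1)) _ _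
    (hT.isClosed_iUnion_supp A hA) (hT.isClosed_iUnion_supp (T \ A) Set.sdiff_subset)
    (by
      intro z _
      obtain ⟨v, hv, hzv⟩ := hT.exists_mem_supp z
      by_cases hvA : v ∈ A
      · exact Or.inl (Set.mem_biUnion hvA hzv)
      · exact Or.inr (Set.mem_biUnion (show v ∈ T \ A from ⟨hv, hvA⟩) hzv))
    ((supp_nonempty t).mono fun z hz => ⟨trivial,
      Set.mem_biUnion (show t ∈ A from ⟨ht, .refl⟩) hz⟩)
    ((supp_nonempty u).mono fun z hz => ⟨trivial,
      Set.mem_biUnion (show u ∈ T \ A from ⟨hu, fun h => hno h.2⟩) hz⟩)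
  simp only [Set.mem_iUnion, exists_prop] at hz1 hz2
  obtain ⟨a, ha, hza⟩ := hz1
  obtain ⟨b, hb, hzb⟩ := hz2
  have hba : b ≠ a := fun h => hb.2 (h ▸ ha)
  have h := hT.meet ha.1 hb.1 hba hza hzb
  exact hb.2 ⟨hb.1, ha.2.tail ⟨ha.1, hb.1, z, h⟩⟩

theorem edgeSign_stable (o : S.Orientation) {T T' : Set S.Tile} (hT : T ∈ S.hull)
    (hT' : T' ∈ S.hull) {e e' : Set (Eu 1)} (he : e ∈ S.cells T 1) (he' : e' ∈ S.cells T' 1)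
    (h : S.StableEq 1 T e T' e') : edgeSign o T' e' = edgeSign o T e := by
  obtain ⟨x, rfl, hx⟩ := h
  have := o.equivariant T hT T' hT' e he x he' hx
  rw [edgeSign, edgeSign, this.1, this.2]
  simp

/-- After changing the basis by the signs that turn all edges to the right, δ[v] is the tile left of
v minus the tile right of v. Consecutive tiles connect the line, so these differences generate the
kernel of the signed sum. -/
theorem exists_sign_range_delta_zero (hmaps : Set.MapsTo S.subst S.hull S.hull)
    (hprim : S.Primitive) (o : S.Orientation) (hT : T ∈ S.hull) :
    ∃ ε : StableCell S T 1 → ℤ, (∀ c, ε c * ε c = 1) ∧ ∀ z,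
      z ∈ LinearMap.range (S.delta o T 0) ↔ Finsupp.linearCombination ℤ ε z = 0 := by
  let ε : StableCell S T 1 → ℤ := fun c => edgeSign o T (S.rep c)
  have hε : ∀ c, ε c * ε c = 1 := fun c => edgeSign_mul_self o T _
  -- The sign depends only on the stable class, by equivariance of the orientation.
  have hcls : ∀ t ∈ T, Finsupp.linearCombination ℤ ε (S.cls T T 1 (S.supp t)) =
      edgeSign o T (S.supp t) := by
    intro t ht
    let σ : S.Cell T 1 := ⟨S.supp t, supp_mem_cells ht⟩
    have h := stableEq_rep σ
    rw [cls_eq_single σ (StableEq.refl _ _ _), Finsupp.linearCombination_single, one_smul]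
    exact (edgeSign_stable o hT hT (rep_mem _) (supp_mem_cells ht) h).symm
  refine ⟨ε, hε, mem_iff_linearCombination_eq_zero hε ?_ ?_⟩
  · rintro _ ⟨y, rfl⟩
    induction y using Finsupp.induction_linear with
    | zero => simp
    | add a b ha hb => rw [map_add, map_add, ha, hb, add_zero]
    | single c n =>
      have hc := rep_mem c
      obtain ⟨v, hv⟩ := hT.1.complex.exists_vertex hc
      rw [hv] at hc
      obtain ⟨t, ht, u, hu, hr, hl⟩ := hT.1.exists_right_left hc
      rw [← mul_one n, ← smul_eq_mul, ← Finsupp.smul_single, ← cls_rep, map_smul, hv,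
        delta_zero_cls hmaps hprim o hT ht hu hc hr hl, map_smul, map_sub, map_smul, map_smul,
        hcls t ht, hcls u hu, smul_eq_mul (a := edgeSign _ _ _), smul_eq_mul (a := edgeSign _ _ _),
        edgeSign_mul_self, edgeSign_mul_self, sub_self, smul_zero]
  · intro x y
    obtain ⟨t, ht, hxt⟩ := mem_cells_top.1 (rep_mem x)
    obtain ⟨u, hu, hyu⟩ := mem_cells_top.1 (rep_mem y)
    simp only [ε]
    rw [← cls_rep, ← cls_rep, hxt, hyu]
    have h := hT.1.consecutive_connected ht hu
    clear hyu
    induction h with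
    | refl => simp
    | tail _ hbc ih =>
      obtain ⟨hb, hc, v, hv, h⟩ := hbc
      have key : ∀ a ∈ T, ∀ b ∈ T, right a = v 0 → left b = v 0 →
          edgeSign o T (S.supp a) • S.cls T T 1 (S.supp a) -
          edgeSign o T (S.supp b) • S.cls T T 1 (S.supp b) ∈ LinearMap.range (S.delta o T 0) :=
        fun a ha b hb h1 h2 => ⟨_, delta_zero_cls hmaps hprim o hT ha hb hv h1 h2⟩
      rw [← sub_add_sub_cancel]
      refine Submodule.add_mem _ (ih hb) ?_
      rcases h with h | h
      · exact key _ hb _ hc h.1 h.2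
      · rw [← neg_sub]
        exact Submodule.neg_mem _ (key _ hc _ hb h.1 h.2)

/-- Ends of shrunk edges go to ends of t. If they go to different ones, the image is all of t by
connectedness. -/
theorem Homotopy.edgeDichotomy_line (H : S.Homotopy T)
    (hmaps : Set.MapsTo S.subst S.hull S.hull) (o : S.Orientation) (hT : T ∈ S.hull) :
    EdgeDichotomy o H := by
  intro e' he'
  obtain ⟨u, hu, rfl⟩ := mem_cells_top.1 he'
  obtain ⟨t, ht, hut⟩ := mem_subst.1 hu
  have hωT := hmaps hT
  have hsub : H.h 1 '' (S.lam⁻¹ • S.supp u) ⊆ S.supp t :=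
    H.image_cell_subset ht hut (supp_mem_cells rfl)
  have hvert : ∀ v ∈ S.supp u, {v} ∈ S.cells (S.subst T) 0 →
      H.h 1 (S.lam⁻¹ • v) 0 = left t ∨ H.h 1 (S.lam⁻¹ • v) 0 = right t := by
    intro v hvu hv
    rw [← vertex_iff, ← mem_skel_one_iff]
    exact H.cellular t ht 0 _ (cells_tile_subset hut 0
      (hωT.1.mem_cells_zero (by norm_num) hu hv hvu))
      ⟨_, Set.smul_mem_smul_set (Set.mem_singleton _), rfl⟩
  have hs := o.src_mem _ hωT _ he'
  have hg := o.tgt_mem _ hωT _ he'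
  have hs' := hvert _ hs.1 hs.2
  have hg' := hvert _ hg.1 hg.2
  set a := o.src (S.subst T) (S.supp u)
  set b := o.tgt (S.subst T) (S.supp u)
  by_cases hab : H.h 1 (S.lam⁻¹ • a) 0 = H.h 1 (S.lam⁻¹ • b) 0
  · exact Or.inl ((eq_iff_coord _ _).2 hab)
  right
  have hpre : IsPreconnected ((fun z : Eu 1 => H.h 1 (S.lam⁻¹ • z) 0) '' S.supp u) := by
    have hconv : Convex ℝ (S.supp u) := by
      have : S.supp u = (fun z : Eu 1 => z 0) ⁻¹' Set.Icc (left u) (right u) := by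
        ext z
        exact mem_supp_iff
      rw [this]
      exact (convex_Icc _ _).linear_preimage
        (LinearMap.proj (R := ℝ) (0 : Fin 1) ∘ₗ (WithLp.linearEquiv 2 ℝ (Fin 1 → ℝ)).toLinearMap)
    have := H.continuous_one
    exact hconv.isPreconnected.image _ (by fun_prop)
  have hlr : (∃ z ∈ S.supp u, H.h 1 (S.lam⁻¹ • z) 0 = left t) ∧
      ∃ z ∈ S.supp u, H.h 1 (S.lam⁻¹ • z) 0 = right t := by
    rcases hs' with h1 | h1 <;> rcases hg' with h2 | h2
    · exact absurd (h1.trans h2.symm) hab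
    · exact ⟨⟨a, hs.1, h1⟩, b, hg.1, h2⟩
    · exact ⟨⟨b, hg.1, h2⟩, a, hs.1, h1⟩
    · exact absurd (h1.trans h2.symm) hab
  have himg : H.h 1 '' (S.lam⁻¹ • S.supp u) = S.supp t := by
    refine subset_antisymm hsub fun z hz => ?_
    have hz' := mem_supp_iff.1 hz
    obtain ⟨⟨p, hp, hp'⟩, q, hq, hq'⟩ := hlr
    obtain ⟨w, hw, hwz⟩ := hpre.Icc_subset ⟨p, hp, hp'⟩ ⟨q, hq, hq'⟩ ⟨hz'.1, hz'.2⟩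
    exact ⟨_, Set.smul_mem_smul_set hw, (eq_iff_coord _ _).2 hwz⟩
  refine ⟨_, supp_mem_cells ht, himg, ?_⟩
  simp only [eq_iff_coord]
  rcases ends_eq_line o hT ht with h | h <;> rw [h.1, h.2] <;>
    rcases hs' with h1 | h1 <;> rcases hg' with h2 | h2 <;> rw [h1, h2] <;>
    first | exact absurd (h1.trans h2.symm) hab | simp

end

end Substitution

end SubstTiling

/-! ### Ext¹ from a projective presentation -/

namespace SubstTiling

open CategoryTheory in
/-- The connecting homomorphism `Hom(B, ℤ) → Ext¹(M, ℤ)` of a presentation `0 → B → Z → M → 0` of `M`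
by a projective module: it is onto, its kernel consists of the restrictions of homomorphisms
`Z → ℤ`, and it is natural for endomorphisms of the presentation. -/
theorem exists_connecting {B Z M : Type} [AddCommGroup B] [AddCommGroup Z] [AddCommGroup M]
    [Module.Projective ℤ Z] (f : B →ₗ[ℤ] Z) (g : Z →ₗ[ℤ] M) (hf : Function.Injective f)
    (hg : Function.Surjective g) (hfg : Function.Exact f g) :
    ∃ D : (B →ₗ[ℤ] ℤ) →+ Ext1 M, Function.Surjective D ∧
      (∀ x, D x = 0 ↔ ∃ y : Z →ₗ[ℤ] ℤ, x = y ∘ₗ f) ∧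
      ∀ (φ : B →ₗ[ℤ] B) (ψ : Z →ₗ[ℤ] Z) (A : AddMonoid.End M), f ∘ₗ φ = ψ ∘ₗ f →
        (∀ z, g (ψ z) = A (g z)) → ∀ x, D (x ∘ₗ φ) = ext1Map A (D x) := by
  let K : ShortComplex (ModuleCat.{0} ℤ) :=
    ShortComplex.mk (ModuleCat.ofHom f) (ModuleCat.ofHom g) (by
      ext b
      exact hfg.apply_apply_eq_zero b)
  have hK : K.ShortExact :=
    { exact := (ShortComplex.ShortExact.moduleCat_exact_iff_function_exact K).2 hfg
      mono_f := (ModuleCat.mono_iff_injective _).2 hf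
      epi_g := (ModuleCat.epi_iff_surjective _).2 hg }
  have hproj : Projective K.X₂ := inferInstanceAs (Projective (ModuleCat.of ℤ Z))
  let N : ModuleCat.{0} ℤ := ModuleCat.of ℤ ℤ
  let D : (B →ₗ[ℤ] ℤ) →+ Ext1 M := AddMonoidHom.mk'
    (fun x => hK.extClass.comp (Abelian.Ext.mk₀ (ModuleCat.ofHom x : K.X₁ ⟶ N)) (add_zero 1))
    (fun x y => by
      rw [ModuleCat.ofHom_add, Abelian.Ext.mk₀_add, Abelian.Ext.comp_add])
  refine ⟨D, ?_, ?_, ?_⟩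
  · intro e
    -- Ext¹ of the projective middle term vanishes, so the connecting map is onto.
    obtain ⟨x, hx⟩ := Abelian.Ext.contravariant_sequence_exact₃ hK N e
      (Abelian.Ext.eq_zero_of_projective _) (add_zero 1)
    obtain ⟨x, rfl⟩ := (Abelian.Ext.mk₀_bijective _ _).2 x
    exact ⟨x.hom, hx⟩
  · intro x
    constructor
    · intro hx
      obtain ⟨y, hy⟩ := Abelian.Ext.contravariant_sequence_exact₁ hK N _ (add_zero 1) hx
      obtain ⟨y, rfl⟩ := (Abelian.Ext.mk₀_bijective _ _).2 y
      rw [Abelian.Ext.mk₀_comp_mk₀] at hy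
      have := (Abelian.Ext.mk₀_bijective _ _).1 hy
      exact ⟨y.hom, (congrArg ModuleCat.Hom.hom this).symm⟩
    · rintro ⟨y, rfl⟩
      change hK.extClass.comp (Abelian.Ext.mk₀ (K.f ≫ (ModuleCat.ofHom y : K.X₂ ⟶ N))) (add_zero 1) = 0
      rw [← Abelian.Ext.mk₀_comp_mk₀]
      exact hK.extClass_comp_assoc (h := add_zero 1) _
  · intro φ ψ A h1 h2 x
    let F : K ⟶ K :=
      { τ₁ := ModuleCat.ofHom φ
        τ₂ := ModuleCat.ofHom ψ
        τ₃ := ModuleCat.ofHom A.toIntLinearMap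
        comm₁₂ := by
          ext b
          exact LinearMap.congr_fun h1 b
        comm₂₃ := by
          ext z
          exact h2 z }
    have hnat := ShortComplex.ShortExact.extClass_naturality hK hK F
    change hK.extClass.comp (Abelian.Ext.mk₀ (F.τ₁ ≫ (ModuleCat.ofHom x : K.X₁ ⟶ N))) (add_zero 1) =
      (Abelian.Ext.mk₀ F.τ₃).comp (hK.extClass.comp
        (Abelian.Ext.mk₀ (ModuleCat.ofHom x : K.X₁ ⟶ N)) (add_zero 1)) (zero_add 1)
    rw [← Abelian.Ext.mk₀_comp_mk₀]
    rw [← Abelian.Ext.comp_assoc _ _ _ (add_zero 1) (zero_add 0) (by rfl), hnat]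
    rw [Abelian.Ext.comp_assoc _ _ _ (zero_add 1) (add_zero 1) (by rfl)]

end SubstTiling

/-! ### The universal coefficient sequence -/

namespace SubstTiling

theorem projective_submodule {Y : Type} [Finite Y] (N : Submodule ℤ (Y →₀ ℤ)) :
    Module.Projective ℤ N := by
  have : Module.Free ℤ N := Module.free_of_finite_type_torsion_free'
  infer_instance

section Complex

variable {X : ℕ → Type} (δ : ∀ k, (X k →₀ ℤ) →ₗ[ℤ] (X (k + 1) →₀ ℤ))

/-- Homomorphisms on the kernel of a map with projective image extend. -/
theorem exists_extension_ker {P Q : Type} [AddCommGroup P] [AddCommGroup Q]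
    (A : P →ₗ[ℤ] Q) [Module.Projective ℤ (LinearMap.range A)] (y : LinearMap.ker A →ₗ[ℤ] ℤ) :
    ∃ y' : P →ₗ[ℤ] ℤ, y' ∘ₗ (LinearMap.ker A).subtype = y := by
  -- A section of A onto its image makes 1 - sA a projection onto the kernel.
  obtain ⟨s, hs⟩ := Module.projective_lifting_property A.rangeRestrict LinearMap.id
    A.surjective_rangeRestrict
  have hA : ∀ x, A (x - s (A.rangeRestrict x)) = 0 := by
    intro x
    have h : A (s (A.rangeRestrict x)) = A x :=
      congrArg Subtype.val (LinearMap.congr_fun hs (A.rangeRestrict x))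
    rw [map_sub, h, sub_self]
  let r : P →ₗ[ℤ] LinearMap.ker A :=
    LinearMap.codRestrict _ (LinearMap.id - s ∘ₗ A.rangeRestrict) hA
  refine ⟨y ∘ₗ r, ?_⟩
  ext z
  have h : A.rangeRestrict z = 0 := Subtype.ext z.2
  have hr : r z = z := Subtype.ext (show z.1 - s (A.rangeRestrict z) = z by
    rw [h, map_zero, sub_zero])
  simp only [LinearMap.comp_apply, Submodule.subtype_apply, hr]

theorem linearCombination_eq {Y : Type} (y : (Y →₀ ℤ) →ₗ[ℤ] ℤ) :
    Finsupp.linearCombination ℤ (fun c => y (Finsupp.single c 1)) = y := by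
  refine Finsupp.lhom_ext' fun c => LinearMap.ext_ring ?_
  simp

variable {δ}

theorem coboundaries_le_ker (hδ : ∀ k, δ (k + 1) ∘ₗ δ k = 0) (k : ℕ) :
    coboundaries δ k ≤ LinearMap.ker (δ k) := by
  cases k with
  | zero => exact bot_le
  | succ k =>
    rintro _ ⟨y, rfl⟩
    exact LinearMap.congr_fun (hδ k) y

/-- Cycles are the functionals that vanish on coboundaries. This form covers degree 0 as well, where
the condition is empty. -/
theorem mem_cycles_iff {k : ℕ} {g : X k → ℤ} :
    g ∈ cycles δ k ↔ ∀ b ∈ coboundaries δ k, Finsupp.linearCombination ℤ g b = 0 := by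
  cases k with
  | zero => simp [cycles, coboundaries]
  | succ k =>
    simp only [cycles, coboundaries, LinearMap.mem_ker, LinearMap.mem_range,
      forall_exists_index, forall_apply_eq_imp_iff, ← pairing_transpose]
    constructor
    · intro h y
      rw [h]
      simp
    · intro h
      ext c
      simpa using h (Finsupp.single c 1)

/-- The evaluation of cycles on cocycles. -/
noncomputable def evalCycle (k : ℕ) (g : cycles δ k) : Coh δ k →+ ℤ :=
  (Submodule.liftQ ((coboundaries δ k).submoduleOf (LinearMap.ker (δ k)))
    (Finsupp.linearCombination ℤ g.1 ∘ₗ (LinearMap.ker (δ k)).subtype)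
    (fun z hz => mem_cycles_iff.1 g.2 z.1 hz)).toAddMonoidHom

theorem evalCycle_mk (k : ℕ) (g : cycles δ k) (z : LinearMap.ker (δ k)) :
    evalCycle k g (Submodule.Quotient.mk z) = Finsupp.linearCombination ℤ g.1 z.1 := rfl

theorem exists_eval (k : ℕ) : ∃ p : Hml δ k →+ (Coh δ k →+ ℤ), ∀ g : cycles δ k,
    p (Submodule.Quotient.mk g) = evalCycle k g := by
  let P : cycles δ k →+ (Coh δ k →+ ℤ) := AddMonoidHom.mk' (evalCycle k) (fun g g' => by
    ext z
    obtain ⟨z, rfl⟩ := Submodule.Quotient.mk_surjective _ z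
    simp only [AddMonoidHom.add_apply, evalCycle_mk]
    simp [Finsupp.linearCombination_apply, Finsupp.sum, mul_add, Finset.sum_add_distrib])
  refine ⟨(Submodule.liftQ ((LinearMap.range (transpose (δ k))).submoduleOf (cycles δ k))
    P.toIntLinearMap ?_).toAddMonoidHom, fun g => rfl⟩
  rintro ⟨g, hg⟩ ⟨h, rfl⟩
  ext z
  obtain ⟨z, rfl⟩ := Submodule.Quotient.mk_surjective _ z
  change evalCycle k _ (Submodule.Quotient.mk z) = 0
  rw [evalCycle_mk]
  change Finsupp.linearCombination ℤ (transpose (δ k) h) z.1 = 0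
  rw [pairing_transpose, z.2, map_zero]

/-- The cycle `g ∘ δ^k` of a homomorphism `g` on the image of `δ^k`. -/
noncomputable def rangeCycle (hδ : ∀ k, δ (k + 1) ∘ₗ δ k = 0) (k : ℕ)
    (g : LinearMap.range (δ k) →ₗ[ℤ] ℤ) : cycles δ k :=
  ⟨fun c => g ((δ k).rangeRestrict (Finsupp.single c 1)), by
    rw [mem_cycles_iff]
    intro b hb
    have h := linearCombination_eq (g ∘ₗ (δ k).rangeRestrict)
    simp only [LinearMap.comp_apply] at h
    rw [h, LinearMap.comp_apply, show (δ k).rangeRestrict b = 0 from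
      Subtype.ext (coboundaries_le_ker hδ k hb), map_zero]⟩

theorem linearCombination_rangeCycle (hδ : ∀ k, δ (k + 1) ∘ₗ δ k = 0) (k : ℕ)
    (g : LinearMap.range (δ k) →ₗ[ℤ] ℤ) (z : X k →₀ ℤ) :
    Finsupp.linearCombination ℤ (rangeCycle hδ k g).1 z = g ((δ k).rangeRestrict z) :=
  LinearMap.congr_fun (linearCombination_eq (g ∘ₗ (δ k).rangeRestrict)) z

theorem eq_of_linearCombination_eq {Y : Type} {g h : Y → ℤ}
    (H : ∀ z, Finsupp.linearCombination ℤ g z = Finsupp.linearCombination ℤ h z) : g = h := by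
  ext c
  simpa using H (Finsupp.single c 1)

theorem hml_mk_eq_zero_iff {k : ℕ} (g : cycles δ k) :
    (Submodule.Quotient.mk g : Hml δ k) = 0 ↔ ∃ h, g.1 = transpose (δ k) h := by
  rw [Submodule.Quotient.mk_eq_zero]
  exact ⟨fun ⟨h, hh⟩ => ⟨h, hh.symm⟩, fun ⟨h, hh⟩ => ⟨h, hh.symm⟩⟩

/-- Forms on the image B of δ^k map onto Ext¹ by the connecting homomorphism, and to homology by
composition with δ^k. Both maps have the same kernel, and the induced map on Ext¹ is the required
injection. -/
theorem exists_sequence [∀ k, Finite (X k)] {f : ∀ k, (X k →₀ ℤ) →ₗ[ℤ] (X k →₀ ℤ)}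
    (hδ : ∀ k, δ (k + 1) ∘ₗ δ k = 0) (hf : IsCochainMap δ f) (k : ℕ) :
    ∃ (i : Ext1 (Coh δ (k + 1)) →+ Hml δ k) (p : Hml δ k →+ (Coh δ k →+ ℤ)),
      (∀ g : cycles δ k, p (Submodule.Quotient.mk g) = evalCycle k g) ∧
      (∀ x, i (ext1Map (cohMap hf (k + 1)) x) = hmlMap hf k (i x)) ∧
      Function.Injective i ∧ Function.Exact i p ∧ Function.Surjective p := by
  obtain ⟨p, hp⟩ := exists_eval (δ := δ) k
  let ι : LinearMap.range (δ k) →ₗ[ℤ] LinearMap.ker (δ (k + 1)) :=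
    Submodule.inclusion (coboundaries_le_ker hδ (k + 1))
  let q : LinearMap.ker (δ (k + 1)) →ₗ[ℤ] Coh δ (k + 1) := Submodule.mkQ _
  have hproj : ∀ (k : ℕ) (N : Submodule ℤ (X k →₀ ℤ)), Module.Projective ℤ N :=
    fun k N => projective_submodule N
  obtain ⟨D, hDs, hDk, hDn⟩ := exists_connecting ι q (Submodule.inclusion_injective _)
    (Submodule.mkQ_surjective _) (fun z => by
      rw [← LinearMap.mem_ker, Submodule.ker_mkQ]
      constructor
      · intro h
        exact ⟨⟨z.1, h⟩, rfl⟩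
      · rintro ⟨b, rfl⟩
        exact b.2)
  let Ψ : (LinearMap.range (δ k) →ₗ[ℤ] ℤ) →+ Hml δ k := AddMonoidHom.mk'
    (fun g => Submodule.Quotient.mk (rangeCycle hδ k g)) (fun g h => rfl)
  -- A form that extends from B to the cocycles extends further to all cochains, since the cocycles
  -- are the kernel of a map with projective image. It then exhibits the cycle as a boundary.
  have hker : ∀ x, D x = 0 ↔ Ψ x = 0 := by
    intro x
    rw [hDk]
    change _ ↔ (Submodule.Quotient.mk (rangeCycle hδ k x) : Hml δ k) = 0
    rw [hml_mk_eq_zero_iff]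
    constructor
    · rintro ⟨y, rfl⟩
      obtain ⟨y', rfl⟩ := exists_extension_ker (δ (k + 1)) y
      refine ⟨fun c => y' (Finsupp.single c 1), eq_of_linearCombination_eq fun z => ?_⟩
      rw [linearCombination_rangeCycle, pairing_transpose, linearCombination_eq]
      rfl
    · rintro ⟨h, hh⟩
      refine ⟨Finsupp.linearCombination ℤ h ∘ₗ (LinearMap.ker (δ (k + 1))).subtype, ?_⟩
      ext ⟨_, z, rfl⟩
      have := linearCombination_rangeCycle hδ k x z
      rw [hh, pairing_transpose] at this
      exact this.symm
  let i : Ext1 (Coh δ (k + 1)) →+ Hml δ k := D.liftOfSurjective hDs ⟨Ψ, fun x hx => (hker x).1 hx⟩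
  have hi : ∀ x, i (D x) = Ψ x := fun x =>
    AddMonoidHom.liftOfRightInverse_comp_apply _ _ _ ⟨Ψ, fun x hx => (hker x).1 hx⟩ x
  refine ⟨i, p, hp, ?_, ?_, ?_, ?_⟩
  · intro e
    obtain ⟨x, rfl⟩ := hDs e
    have hfr : ∀ b ∈ LinearMap.range (δ k), f (k + 1) b ∈ LinearMap.range (δ k) := by
      rintro _ ⟨y, rfl⟩
      exact ⟨f k y, (LinearMap.congr_fun (hf k) y).symm⟩
    have hfk : ∀ b ∈ LinearMap.ker (δ (k + 1)), f (k + 1) b ∈ LinearMap.ker (δ (k + 1)) := by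
      intro b hb
      have h := LinearMap.congr_fun (hf (k + 1)) b
      simp only [LinearMap.comp_apply] at h
      rw [LinearMap.mem_ker, ← h, hb, map_zero]
    rw [← hDn ((f (k + 1)).restrict hfr) ((f (k + 1)).restrict hfk) (cohMap hf (k + 1)) rfl
      (fun z => rfl) x, hi, hi]
    change (Submodule.Quotient.mk (rangeCycle hδ k _) : Hml δ k) =
      Submodule.Quotient.mk ((transpose (f k)).restrict _ (rangeCycle hδ k x))
    congr 1
    ext1
    refine eq_of_linearCombination_eq fun z => ?_
    rw [linearCombination_rangeCycle]
    change _ = Finsupp.linearCombination ℤ (transpose (f k) (rangeCycle hδ k x).1) z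
    rw [pairing_transpose, linearCombination_rangeCycle]
    exact congrArg x (Subtype.ext (LinearMap.congr_fun (hf k) z))
  · rw [injective_iff_map_eq_zero]
    intro e he
    obtain ⟨x, rfl⟩ := hDs e
    rw [hi] at he
    exact (hker x).2 he
  · intro c
    constructor
    · intro hc
      obtain ⟨g, rfl⟩ := Submodule.Quotient.mk_surjective _ c
      rw [hp] at hc
      have hg : LinearMap.ker (δ k) ≤ LinearMap.ker (Finsupp.linearCombination ℤ g.1) := by
        intro z hz
        exact DFunLike.congr_fun hc (Submodule.Quotient.mk ⟨z, hz⟩)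
      -- A cycle that vanishes on cocycles factors through δ^k.
      let x : LinearMap.range (δ k) →ₗ[ℤ] ℤ :=
        (LinearMap.ker (δ k)).liftQ _ hg ∘ₗ (δ k).quotKerEquivRange.symm.toLinearMap
      refine ⟨D x, ?_⟩
      rw [hi]
      change Submodule.Quotient.mk (rangeCycle hδ k x) = _
      congr 1
      ext1
      refine eq_of_linearCombination_eq fun z => ?_
      rw [linearCombination_rangeCycle]
      simp only [x, LinearMap.comp_apply, LinearEquiv.coe_coe]
      rw [show (δ k).rangeRestrict z = (δ k).quotKerEquivRange (Submodule.Quotient.mk z) from rfl,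
        LinearEquiv.symm_apply_apply]
      rfl
    · rintro ⟨e, rfl⟩
      obtain ⟨x, rfl⟩ := hDs e
      rw [hi]
      change p (Submodule.Quotient.mk (rangeCycle hδ k x)) = 0
      rw [hp]
      ext z
      obtain ⟨z, rfl⟩ := Submodule.Quotient.mk_surjective _ z
      rw [evalCycle_mk, linearCombination_rangeCycle,
        show (δ k).rangeRestrict z.1 = 0 from Subtype.ext z.2, map_zero]
      rfl
  · intro e
    -- A form on cohomology, pulled back to cocycles and extended to all cochains, is a cycle
    -- because it vanishes on coboundaries.
    obtain ⟨y', hy'⟩ := exists_extension_ker (δ k) (e.toIntLinearMap ∘ₗ Submodule.mkQ _)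
    have hval : ∀ z : LinearMap.ker (δ k), y' z.1 = e (Submodule.Quotient.mk z) := fun z =>
      LinearMap.congr_fun hy' z
    refine ⟨Submodule.Quotient.mk ⟨fun c => y' (Finsupp.single c 1), ?_⟩, ?_⟩
    · rw [mem_cycles_iff]
      intro b hb
      rw [linearCombination_eq]
      have := hval ⟨b, coboundaries_le_ker hδ k hb⟩
      have h0 : (Submodule.Quotient.mk ⟨b, coboundaries_le_ker hδ k hb⟩ : Coh δ k) = 0 :=
        (Submodule.Quotient.mk_eq_zero _).2 hb
      rw [h0, map_zero] at this
      exact this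
    · rw [hp]
      ext z
      obtain ⟨z, rfl⟩ := Submodule.Quotient.mk_surjective _ z
      rw [evalCycle_mk, linearCombination_eq, hval]

end Complex

end SubstTiling

/-! ### Torsion subgroups, and Ext¹ of finitely generated groups -/

namespace SubstTiling

theorem isAddTorsionFree_of_nsmul {G : Type*} [AddCommGroup G]
    (h : ∀ n : ℕ, 0 < n → ∀ x : G, n • x = 0 → x = 0) : IsAddTorsionFree G := by
  rw [isAddTorsionFree_iff_not_isOfFinAddOrder]
  intro a ha hfin
  obtain ⟨n, hn, hna⟩ := isOfFinAddOrder_iff_nsmul_eq_zero.1 hfin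
  exact ha (h n hn a hna)

theorem eq_zero_of_nsmul {G : Type*} [AddCommGroup G] [IsAddTorsionFree G] {n : ℕ} (hn : 0 < n)
    {x : G} (h : n • x = 0) : x = 0 :=
  IsAddTorsionFree.nsmul_right_injective hn.ne' (by simpa using h)

instance instIsAddTorsionFreeHom {M : Type} [AddCommGroup M] : IsAddTorsionFree (M →+ ℤ) :=
  isAddTorsionFree_of_nsmul fun n hn x hx => by
    ext m
    exact eq_zero_of_nsmul hn (DFunLike.congr_fun hx m)

/-- In an extension of a torsion-free group by a torsion group, the torsion group is the torsion
subgroup. -/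
theorem nonempty_equiv_torsion {A B C : Type} [AddCommGroup A] [AddCommGroup B] [AddCommGroup C]
    {i : A →+ B} {p : B →+ C} (hi : Function.Injective i) (hip : Function.Exact i p)
    (hA : IsAddTorsion A) [IsAddTorsionFree C] : Nonempty (A ≃+ AddCommGroup.torsion B) := by
  have hmem : ∀ a, i a ∈ AddCommGroup.torsion B := fun a => i.isOfFinAddOrder (hA a)
  refine ⟨AddEquiv.ofBijective (i.codRestrict (AddCommGroup.torsion B) hmem) ⟨?_, ?_⟩⟩
  · intro a b h
    exact hi (congrArg Subtype.val h)
  · rintro ⟨b, hb⟩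
    obtain ⟨n, hn, hnb⟩ := isOfFinAddOrder_iff_nsmul_eq_zero.1 hb
    have hp : p b = 0 := eq_zero_of_nsmul hn (by rw [← map_nsmul, hnb, map_zero])
    obtain ⟨a, rfl⟩ := (hip b).1 hp
    exact ⟨a, rfl⟩

theorem isAddTorsionFree_of_exact {A B C : Type} [AddCommGroup A] [AddCommGroup B] [AddCommGroup C]
    [Subsingleton A] {i : A →+ B} {p : B →+ C} (hip : Function.Exact i p)
    [IsAddTorsionFree C] : IsAddTorsionFree B :=
  isAddTorsionFree_of_nsmul fun n hn x hx => by
    obtain ⟨a, rfl⟩ := (hip x).1 (eq_zero_of_nsmul hn (by rw [← map_nsmul, hx, map_zero]))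
    rw [Subsingleton.elim a 0, map_zero]

theorem nonempty_equiv_of_ker_eq {G A B : Type} [AddCommGroup G] [AddCommGroup A] [AddCommGroup B]
    {a : G →+ A} {b : G →+ B} (ha : Function.Surjective a) (hb : Function.Surjective b)
    (h : ∀ x, a x = 0 ↔ b x = 0) : Nonempty (A ≃+ B) :=
  ⟨(QuotientAddGroup.quotientKerEquivOfSurjective a ha).symm.trans
    ((QuotientAddGroup.quotientAddEquivOfEq (AddSubgroup.ext fun x => h x)).trans
      (QuotientAddGroup.quotientKerEquivOfSurjective b hb))⟩

/-- The `Ext` group of a finitely generated abelian group is isomorphic to its torsion subgroup, and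
finite. -/
theorem nonempty_ext1_equiv_torsion (M : Type) [AddCommGroup M] [Module.Finite ℤ M] :
    Nonempty (Ext1 M ≃+ AddCommGroup.torsion M) ∧ IsAddTorsion (Ext1 M) := by
  classical
  have hfg : AddGroup.FG M := Module.Finite.iff_addGroup_fg.1 inferInstance
  obtain ⟨n, ι, _, p, hp, e, ⟨E₀⟩⟩ := AddCommGroup.equiv_free_prod_directSum_zmod M
  let N : ι → ℕ := fun i => p i ^ e i
  have hN : ∀ i, NeZero (N i) := fun i => ⟨pow_ne_zero _ (hp i).ne_zero⟩
  let E : M ≃+ (Fin n →₀ ℤ) × (∀ i, ZMod (N i)) :=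
    E₀.trans ((AddEquiv.refl _).prodCongr (DirectSum.addEquivProd _))
  -- The free presentation of M has relation module ℤ^ι, embedded by the diagonal matrix of the
  -- orders N i.
  let f : (ι → ℤ) →ₗ[ℤ] (Fin n →₀ ℤ) × (ι → ℤ) :=
    LinearMap.inr ℤ _ _ ∘ₗ LinearMap.pi fun i => (N i : ℤ) • LinearMap.proj i
  let c : ((Fin n →₀ ℤ) × (ι → ℤ)) →+ (Fin n →₀ ℤ) × (∀ i, ZMod (N i)) :=
    (AddMonoidHom.id _).prodMap
      (AddMonoidHom.mk' (fun b i => (b i : ZMod (N i))) fun b b' => by ext i; simp)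
  let g : (Fin n →₀ ℤ) × (ι → ℤ) →ₗ[ℤ] M := (E.symm.toAddMonoidHom.comp c).toIntLinearMap
  have hf : Function.Injective f := by
    intro x y h
    ext i
    have h1 := congrFun (congrArg Prod.snd h) i
    have h2 : (N i : ℤ) * x i = N i * y i := h1
    exact mul_left_cancel₀ (Nat.cast_ne_zero.2 (hN i).ne) h2
  have hlift : ∀ y : ∀ i, ZMod (N i), ∃ b : ι → ℤ, ∀ i, (b i : ZMod (N i)) = y i := fun y =>
    ⟨fun i => (ZMod.intCast_surjective (y i)).choose, fun i =>
      (ZMod.intCast_surjective (y i)).choose_spec⟩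
  have hg : Function.Surjective g := by
    intro m
    obtain ⟨b, hb⟩ := hlift (E m).2
    refine ⟨((E m).1, b), ?_⟩
    change E.symm ((E m).1, fun i => (b i : ZMod (N i))) = m
    rw [funext hb]
    exact E.symm_apply_apply m
  have hfg' : Function.Exact f g := by
    rintro ⟨a, b⟩
    have h1 : g (a, b) = 0 ↔ a = 0 ∧ ∀ i, (b i : ZMod (N i)) = 0 := by
      change E.symm (a, fun i => (b i : ZMod (N i))) = 0 ↔ _
      rw [EmbeddingLike.map_eq_zero_iff, Prod.mk_eq_zero, funext_iff]
      rfl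
    rw [h1]
    constructor
    · rintro ⟨rfl, hb⟩
      choose x hx using fun i => (ZMod.intCast_zmod_eq_zero_iff_dvd _ _).1 (hb i)
      exact ⟨x, Prod.ext rfl (funext fun i => (hx i).symm)⟩
    · rintro ⟨x, hx⟩
      obtain ⟨rfl, rfl⟩ := Prod.mk.inj hx.symm
      refine ⟨rfl, fun i => ?_⟩
      exact (ZMod.intCast_zmod_eq_zero_iff_dvd _ _).2 ⟨x i, rfl⟩
  obtain ⟨D, hDs, hDk, -⟩ := exists_connecting f g hf hg hfg'
  -- A form on the relations extends iff its value on the i-th basis vector is divisible by N i, so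
  -- Ext¹ is the product of the groups ℤ/N i.
  let Θ : ((ι → ℤ) →ₗ[ℤ] ℤ) →+ ∀ i, ZMod (N i) :=
    AddMonoidHom.mk' (fun x i => (x (Pi.single i 1) : ZMod (N i))) fun x y => by ext i; simp
  have hrep : ∀ x : (ι → ℤ) →ₗ[ℤ] ℤ, ∀ z, x z = ∑ i, z i * x (Pi.single i 1) := by
    intro x z
    conv_lhs => rw [← Finset.univ_sum_single z, map_sum]
    refine Finset.sum_congr rfl fun i _ => ?_
    rw [← smul_eq_mul, ← map_smul, ← Pi.single_smul, smul_eq_mul, mul_one]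
  have hΘ : Function.Surjective Θ := by
    intro y
    obtain ⟨b, hb⟩ := hlift y
    refine ⟨∑ i, b i • LinearMap.proj i, funext fun i => ?_⟩
    change ((∑ j, b j • LinearMap.proj j : (ι → ℤ) →ₗ[ℤ] ℤ) (Pi.single i 1) : ZMod (N i)) = y i
    simp [LinearMap.sum_apply, Pi.single_apply, hb]
  have hker : ∀ x, D x = 0 ↔ Θ x = 0 := by
    intro x
    rw [hDk, funext_iff]
    constructor
    · rintro ⟨y, rfl⟩ i
      refine (ZMod.intCast_zmod_eq_zero_iff_dvd _ _).2 ⟨y (0, Pi.single i 1), ?_⟩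
      rw [← smul_eq_mul, ← map_smul]
      change y (f _) = _
      congr 1
      refine Prod.ext (by simp [f]) (funext fun j => ?_)
      by_cases h : j = i
      · subst h
        simp [f]
      · simp [f, h]
    · intro h
      choose b hb using fun i => (ZMod.intCast_zmod_eq_zero_iff_dvd _ _).1 (h i)
      refine ⟨(∑ i, b i • LinearMap.proj i) ∘ₗ LinearMap.snd ℤ _ _, LinearMap.ext fun z => ?_⟩
      rw [hrep]
      simp only [LinearMap.comp_apply, LinearMap.sum_apply, LinearMap.smul_apply, f,
        LinearMap.snd_apply, LinearMap.inr_apply, LinearMap.pi_apply, LinearMap.proj_apply,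
        smul_eq_mul]
      refine Finset.sum_congr rfl fun i _ => ?_
      rw [hb i]
      ring
  obtain ⟨e₁⟩ := nonempty_equiv_of_ker_eq hDs hΘ hker
  have htor : IsAddTorsion (∀ i, ZMod (N i)) := isAddTorsion_of_finite
  obtain ⟨e₂⟩ := nonempty_equiv_torsion (i := E.symm.toAddMonoidHom.comp (AddMonoidHom.inr _ _))
    (p := (AddMonoidHom.fst _ _).comp E.toAddMonoidHom)
    (E.symm.injective.comp fun x y h => (Prod.mk.inj h).2) (fun m => by
      constructor
      · intro h
        refine ⟨(E m).2, ?_⟩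
        change E.symm (0, (E m).2) = m
        rw [← show (E m).1 = 0 from h]
        exact E.symm_apply_apply m
      · rintro ⟨x, rfl⟩
        change (E (E.symm (0, x))).1 = 0
        rw [E.apply_symm_apply]) htor
  refine ⟨⟨e₁.trans e₂⟩, fun x => ?_⟩
  rw [← e₁.symm_apply_apply x]
  exact e₁.symm.toAddMonoidHom.isOfFinAddOrder (htor _)

theorem subsingleton_ext1 (M : Type) [AddCommGroup M] [Module.Finite ℤ M] [IsAddTorsionFree M] :
    Subsingleton (Ext1 M) := by
  obtain ⟨⟨e⟩, -⟩ := nonempty_ext1_equiv_torsion M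
  have : Subsingleton (AddCommGroup.torsion M) := ⟨fun x y => by
    have h : ∀ z : AddCommGroup.torsion M, z = 0 := fun z => by
      obtain ⟨n, hn, hz⟩ := isOfFinAddOrder_iff_nsmul_eq_zero.1 z.2
      exact Subtype.ext (eq_zero_of_nsmul hn hz)
    rw [h x, h y]⟩
  exact e.toEquiv.subsingleton

/-- The quotient C is finitely generated and torsion free, hence free, and the sequence splits. -/
theorem nonempty_equiv_prod {A B C : Type} [AddCommGroup A] [AddCommGroup B] [AddCommGroup C]
    [Module.Finite ℤ B] {i : A →+ B} {p : B →+ C} (hi : Function.Injective i)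
    (hip : Function.Exact i p) (hp : Function.Surjective p) [IsAddTorsionFree C] :
    Nonempty (B ≃+ A × C) := by
  have hfin : Module.Finite ℤ C := Module.Finite.of_surjective p.toIntLinearMap hp
  have hfree : Module.Free ℤ C := Module.free_of_finite_type_torsion_free'
  obtain ⟨s, hs⟩ := Module.projective_lifting_property p.toIntLinearMap LinearMap.id hp
  have hs' : ∀ c, p (s c) = c := LinearMap.congr_fun hs
  have hpi : ∀ a, p (i a) = 0 := hip.apply_apply_eq_zero
  refine ⟨(AddEquiv.ofBijective (i.coprod s.toAddMonoidHom) ⟨?_, ?_⟩).symm⟩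
  · rw [injective_iff_map_eq_zero]
    rintro ⟨a, c⟩ h
    have h' : i a + s c = 0 := h
    have h1 := congrArg p h'
    rw [map_add, hpi, hs', zero_add, map_zero] at h1
    subst h1
    rw [map_zero, add_zero] at h'
    rw [(injective_iff_map_eq_zero i).1 hi a h']
    rfl
  · intro b
    obtain ⟨a, ha⟩ := (hip (b - s (p b))).1 (by rw [map_sub, hs', sub_self])
    refine ⟨(a, p b), ?_⟩
    change i a + s (p b) = b
    rw [ha, sub_add_cancel]

/-! ### Sequential direct limits of an endomorphism -/

namespace Lim

variable {G G' G'' : Type} [AddCommGroup G] [AddCommGroup G'] [AddCommGroup G'']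
  {A : AddMonoid.End G} {A' : AddMonoid.End G'} {A'' : AddMonoid.End G''}

theorem directedSystem (A : AddMonoid.End G) : DirectedSystem (fun _ : ℕ => G)
    (fun i j _ => ⇑((A ^ (j - i) : AddMonoid.End G) : G →+ G)) where
  map_self i x := by simp
  map_map k j i hij hjk x := by
    change (A ^ (k - j) * A ^ (j - i)) x = _
    rw [← pow_add, show k - j + (j - i) = k - i by omega]

theorem of_pow (A : AddMonoid.End G) (n m : ℕ) (x : G) : of A (n + m) ((A ^ m) x) = of A n x := by
  have := AddCommGroup.DirectLimit.of_f (G := fun _ : ℕ => G)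
    (f := fun i j _ => (A ^ (j - i) : AddMonoid.End G)) (Nat.le_add_right n m) x
  rw [Nat.add_sub_cancel_left] at this
  exact this

theorem exists_of (z : Lim A) : ∃ n x, of A n x = z :=
  AddCommGroup.DirectLimit.induction_on (C := fun z => ∃ n x, of A n x = z) z
    fun n x => ⟨n, x, rfl⟩

theorem of_eq_zero {n : ℕ} {x : G} (h : of A n x = 0) : ∃ m, (A ^ m) x = 0 := by
  have : DirectedSystem (fun _ : ℕ => G) (fun i j (_ : i ≤ j) =>
      DFunLike.coe (F := G →+ G) (A ^ (j - i) : AddMonoid.End G)) := directedSystem A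
  obtain ⟨j, hj, hx⟩ := AddCommGroup.DirectLimit.of.zero_exact (G := fun _ : ℕ => G)
    (f := fun i j _ => (A ^ (j - i) : AddMonoid.End G)) n x h
  exact ⟨j - n, hx⟩

theorem pow_comm {φ : G →+ G'} (h : ∀ x, φ (A x) = A' (φ x)) (m : ℕ) (x : G) :
    φ ((A ^ m) x) = (A' ^ m) (φ x) := by
  induction m generalizing x with
  | zero => rfl
  | succ m ih =>
    rw [pow_succ, pow_succ]
    change φ ((A ^ m) (A x)) = (A' ^ m) (A' (φ x))
    rw [ih, h]

theorem exists_map (φ : G →+ G') (h : ∀ x, φ (A x) = A' (φ x)) :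
    ∃ Φ : Lim A →+ Lim A', ∀ n x, Φ (of A n x) = of A' n (φ x) :=
  ⟨AddCommGroup.DirectLimit.map (fun _ => φ) (fun i j _ => AddMonoidHom.ext fun x =>
    pow_comm h (j - i) x), fun _ _ => AddCommGroup.DirectLimit.map_apply_of _ _ _⟩

/-- An element of a stage vanishes in the limit iff some power of the endomorphism kills it.
Exactness thus reduces to a later stage of the original sequence. -/
theorem exists_exact {i : G →+ G'} {p : G' →+ G''} (hi : ∀ x, i (A x) = A' (i x))
    (hp : ∀ x, p (A' x) = A'' (p x)) (hinj : Function.Injective i) (hip : Function.Exact i p)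
    (hsurj : Function.Surjective p) :
    ∃ (I : Lim A →+ Lim A') (P : Lim A' →+ Lim A''), (∀ n x, I (of A n x) = of A' n (i x)) ∧
      (∀ n x, P (of A' n x) = of A'' n (p x)) ∧ Function.Injective I ∧ Function.Exact I P ∧
      Function.Surjective P := by
  obtain ⟨I, hI⟩ := exists_map i hi
  obtain ⟨P, hP⟩ := exists_map p hp
  refine ⟨I, P, hI, hP, ?_, ?_, ?_⟩
  · rw [injective_iff_map_eq_zero]
    intro z hz
    obtain ⟨n, x, rfl⟩ := exists_of z
    rw [hI] at hz
    obtain ⟨m, hm⟩ := of_eq_zero hz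
    rw [← pow_comm hi] at hm
    rw [← of_pow A n m x, (injective_iff_map_eq_zero i).1 hinj _ hm, map_zero]
  · intro z
    constructor
    · intro hz
      obtain ⟨n, y, rfl⟩ := exists_of z
      rw [hP] at hz
      obtain ⟨m, hm⟩ := of_eq_zero hz
      rw [← pow_comm hp] at hm
      obtain ⟨x, hx⟩ := (hip _).1 hm
      exact ⟨of A (n + m) x, by rw [hI, hx, of_pow]⟩
    · rintro ⟨w, rfl⟩
      obtain ⟨n, x, rfl⟩ := exists_of w
      rw [hI, hP, hip.apply_apply_eq_zero, map_zero]
  · intro z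
    obtain ⟨n, x, rfl⟩ := exists_of z
    obtain ⟨y, rfl⟩ := hsurj x
    exact ⟨of A' n y, hP n y⟩

theorem isAddTorsionFree (A : AddMonoid.End G) [IsAddTorsionFree G] : IsAddTorsionFree (Lim A) :=
  isAddTorsionFree_of_nsmul fun k hk z hz => by
    obtain ⟨n, x, rfl⟩ := exists_of z
    rw [← map_nsmul] at hz
    obtain ⟨m, hm⟩ := of_eq_zero hz
    rw [map_nsmul] at hm
    rw [← of_pow A n m x, eq_zero_of_nsmul hk hm, map_zero]

theorem isAddTorsion (A : AddMonoid.End G) (hG : IsAddTorsion G) : IsAddTorsion (Lim A) := by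
  intro z
  obtain ⟨n, x, rfl⟩ := exists_of z
  exact (of A n).isOfFinAddOrder (hG x)

theorem nonempty_equiv (hA : A = 1) : Nonempty (Lim A ≃+ G) := by
  subst hA
  refine ⟨(AddEquiv.ofBijective (of (1 : AddMonoid.End G) 0) ⟨?_, ?_⟩).symm⟩
  · rw [injective_iff_map_eq_zero]
    intro x hx
    obtain ⟨m, hm⟩ := of_eq_zero hx
    rwa [one_pow] at hm
  · intro z
    obtain ⟨n, x, rfl⟩ := exists_of z
    refine ⟨x, ?_⟩
    rw [← of_pow 1 0 n x, one_pow, zero_add]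
    rfl

end Lim

end SubstTiling

/-! ### Torsion of the cohomology and of its limits -/

namespace SubstTiling

section Complex

variable {X : ℕ → Type} {δ : ∀ k, (X k →₀ ℤ) →ₗ[ℤ] (X (k + 1) →₀ ℤ)}
  {f : ∀ k, (X k →₀ ℤ) →ₗ[ℤ] (X k →₀ ℤ)}

/-- Evaluation turns the transpose of `f` into composition with `f`. -/
theorem eval_hmlMap (hf : IsCochainMap δ f) {k : ℕ} {p : Hml δ k →+ (Coh δ k →+ ℤ)}
    (hp : ∀ g : cycles δ k, p (Submodule.Quotient.mk g) = evalCycle k g) (x : Hml δ k) :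
    p (hmlMap hf k x) = homMap (cohMap hf k) (p x) := by
  obtain ⟨g, rfl⟩ := Submodule.Quotient.mk_surjective _ x
  ext z
  obtain ⟨z, rfl⟩ := Submodule.Quotient.mk_surjective _ z
  rw [hp]
  refine (DFunLike.congr_fun (hp _) (Submodule.Quotient.mk z)).trans ?_
  exact pairing_transpose (f k) g.1 z.1

/-- There are no coboundaries in degree 0, so H^0 is a subgroup of a free group. -/
theorem isAddTorsionFree_coh_zero : IsAddTorsionFree (Coh δ 0) :=
  isAddTorsionFree_of_nsmul fun n hn x hx => by
    obtain ⟨z, rfl⟩ := Submodule.Quotient.mk_surjective _ x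
    have h : n • z.1 = 0 := (Submodule.Quotient.mk_eq_zero _).1 hx
    rw [show z = 0 from Subtype.ext ((smul_eq_zero_iff_right hn.ne').1 h)]
    rfl

theorem subsingleton_coh {k : ℕ} (h : IsEmpty (X k)) : Subsingleton (Coh δ k) :=
  (Submodule.mkQ_surjective _).subsingleton

theorem isAddTorsionFree_of_subsingleton {G : Type} [AddCommGroup G] [Subsingleton G] :
    IsAddTorsionFree G :=
  isAddTorsionFree_of_nsmul fun _ _ _ _ => Subsingleton.elim _ _

/-- A linear form whose kernel is the group of coboundaries embeds the cohomology. -/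
theorem exists_coh_form {k : ℕ} {ε : X (k + 1) → ℤ}
    (hε : ∀ z, z ∈ LinearMap.range (δ k) ↔ Finsupp.linearCombination ℤ ε z = 0) :
    ∃ e : Coh δ (k + 1) →+ ℤ, Function.Injective e ∧ ∀ z : LinearMap.ker (δ (k + 1)),
      e (Submodule.Quotient.mk z) = Finsupp.linearCombination ℤ ε z.1 := by
  refine ⟨evalCycle (k + 1) ⟨ε, mem_cycles_iff.2 fun b hb => (hε b).1 hb⟩, ?_, fun z => rfl⟩
  rw [injective_iff_map_eq_zero]
  intro x hx
  obtain ⟨z, rfl⟩ := Submodule.Quotient.mk_surjective _ x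
  rw [evalCycle_mk] at hx
  exact (Submodule.Quotient.mk_eq_zero _).2 ((hε z.1).2 hx)

theorem isAddTorsionFree_of_injective {G : Type} [AddCommGroup G] {e : G →+ ℤ}
    (he : Function.Injective e) : IsAddTorsionFree G :=
  isAddTorsionFree_of_nsmul fun n hn x hx => (injective_iff_map_eq_zero e).1 he x
    (eq_zero_of_nsmul hn (by rw [← map_nsmul, hx, map_zero]))

/-- The Ext¹ term vanishes, so homology embeds in a group of integral forms. -/
theorem isAddTorsionFree_hml [∀ k, Finite (X k)] (hδ : ∀ k, δ (k + 1) ∘ₗ δ k = 0)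
    (hf : IsCochainMap δ f) {k : ℕ} (h : IsAddTorsionFree (Coh δ (k + 1))) :
    IsAddTorsionFree (Hml δ k) := by
  obtain ⟨i, p, -, -, -, hip, -⟩ := exists_sequence hδ hf k
  have := subsingleton_ext1 (Coh δ (k + 1))
  exact isAddTorsionFree_of_exact hip

/-- If the sum of coefficients detects coboundaries in the top degree and is preserved by the
cochain map, then the limits in the top degree are infinite cyclic. -/
theorem nonempty_lim_equiv_int [∀ k, Finite (X k)] (hδ : ∀ k, δ (k + 1) ∘ₗ δ k = 0)
    (hf : IsCochainMap δ f) {k : ℕ} [Nonempty (X (k + 1))] (htop : IsEmpty (X (k + 2)))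
    (hε : ∀ z, z ∈ LinearMap.range (δ k) ↔ Finsupp.linearCombination ℤ (fun _ => (1 : ℤ)) z = 0)
    (hfε : ∀ z, Finsupp.linearCombination ℤ (fun _ => (1 : ℤ)) (f (k + 1) z) =
      Finsupp.linearCombination ℤ (fun _ => (1 : ℤ)) z) :
    Nonempty (Lim (cohMap hf (k + 1)) ≃+ ℤ) ∧ Nonempty (Lim (hmlMap hf (k + 1)) ≃+ ℤ) := by
  obtain ⟨e, he, hez⟩ := exists_coh_form hε
  have hes : Function.Surjective e := by
    intro n
    let c : X (k + 1) := Classical.arbitrary _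
    refine ⟨Submodule.Quotient.mk ⟨Finsupp.single c n, Subsingleton.elim _ _⟩, ?_⟩
    rw [hez]
    simp
  have hcoh : cohMap hf (k + 1) = 1 := by
    ext x
    apply he
    obtain ⟨z, rfl⟩ := Submodule.Quotient.mk_surjective _ x
    exact (hez _).trans ((hfε z.1).trans (hez z).symm)
  let E : Coh δ (k + 1) ≃+ ℤ := AddEquiv.ofBijective e ⟨he, hes⟩
  obtain ⟨i, p, hp, -, -, hip, hps⟩ := exists_sequence hδ hf (k + 1)
  have : Subsingleton (Coh δ (k + 2)) := subsingleton_coh htop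
  have : IsAddTorsionFree (Coh δ (k + 2)) := isAddTorsionFree_of_subsingleton
  have := subsingleton_ext1 (Coh δ (k + 2))
  have hpi : Function.Injective p := by
    rw [injective_iff_map_eq_zero]
    intro x hx
    obtain ⟨a, rfl⟩ := (hip x).1 hx
    rw [Subsingleton.elim a 0, map_zero]
  -- With vanishing Ext¹ term, evaluation is injective, so the transposed map is also the identity.
  have hhml : hmlMap hf (k + 1) = 1 := by
    ext x
    apply hpi
    rw [eval_hmlMap hf hp, hcoh]
    rfl
  obtain ⟨e₁⟩ := Lim.nonempty_equiv hcoh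
  obtain ⟨e₂⟩ := Lim.nonempty_equiv hhml
  let F : (Coh δ (k + 1) →+ ℤ) ≃+ ℤ :=
    { toFun := fun φ => φ (E.symm 1)
      invFun := fun n => n • E.toAddMonoidHom
      left_inv := fun φ => by
        ext x
        obtain ⟨m, rfl⟩ := E.symm.surjective x
        have h : E.symm m = m • E.symm 1 := by rw [← map_zsmul]; simp
        simp [h, mul_comm]
      right_inv := fun n => by simp
      map_add' := fun φ ψ => rfl }
  exact ⟨⟨e₁.trans E⟩, ⟨e₂.trans ((AddEquiv.ofBijective p ⟨hpi, hps⟩).trans F)⟩⟩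

end Complex

end SubstTiling

/-! ### The complex of stable cells -/

namespace SubstTiling

namespace Substitution

theorem nonempty_stableCell {d : ℕ} {S : Substitution d} {T : Set S.Tile} (hT : S.IsTiling T) :
    Nonempty (StableCell S T d) := by
  obtain ⟨t, ht, -⟩ := hT.exists_mem_supp 0
  exact ⟨StableCell.mk ⟨_, supp_mem_cells ht⟩⟩

theorem delta_comp_delta {d : ℕ} (hd : d = 1 ∨ d = 2) {S : Substitution d}
    (hmaps : Set.MapsTo S.subst S.hull S.hull) (hprim : S.Primitive) (o : S.Orientation)
    {T : Set S.Tile} (hT : T ∈ S.hull) (k : ℕ) : S.delta o T (k + 1) ∘ₗ S.delta o T k = 0 := by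
  by_cases hk : d < k + 2
  · have := stableCell_isEmpty (S := S) T hk
    exact LinearMap.ext fun z => Subsingleton.elim _ _
  · obtain rfl : d = 2 := by omega
    obtain rfl : k = 0 := by omega
    exact delta_one_delta_zero hmaps hprim o hT

theorem isCochainMap_W {d : ℕ} (hd : d = 1 ∨ d = 2) {S : Substitution d}
    (hmaps : Set.MapsTo S.subst S.hull S.hull) (hprim : S.Primitive) (o : S.Orientation)
    {T : Set S.Tile} (hT : T ∈ S.hull) (H : S.Homotopy T) :
    IsCochainMap (S.delta o T) (S.W o H) := by
  intro k
  by_cases hk : d < k + 1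
  · have := stableCell_isEmpty (S := S) T hk
    exact LinearMap.ext fun z => Subsingleton.elim _ _
  · obtain rfl | rfl : k = 0 ∨ k = 1 := by omega
    · rcases hd with rfl | rfl
      · exact W_delta_zero_comm (Or.inl rfl) hmaps hprim o hT H (H.edgeDichotomy_line hmaps o hT)
      · exact W_delta_zero_comm (Or.inr rfl) hmaps hprim o hT H (H.edgeDichotomy hmaps o hT)
    · obtain rfl : d = 2 := by omega
      exact W_delta_one_comm hmaps hprim o hT H

theorem isAddTorsionFree_coh_of_lt {d : ℕ} {S : Substitution d} (o : S.Orientation)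
    {T : Set S.Tile} {k : ℕ} (hk : d < k) : IsAddTorsionFree (Coh (S.delta o T) k) :=
  have := subsingleton_coh (δ := S.delta o T) (stableCell_isEmpty T hk)
  isAddTorsionFree_of_subsingleton

theorem isAddTorsionFree_coh_line {S : Substitution 1}
    (hmaps : Set.MapsTo S.subst S.hull S.hull) (hprim : S.Primitive) (o : S.Orientation)
    {T : Set S.Tile} (hT : T ∈ S.hull) (k : ℕ) : IsAddTorsionFree (Coh (S.delta o T) k) := by
  match k with
  | 0 => exact isAddTorsionFree_coh_zero
  | 1 =>
    obtain ⟨ε, -, hε⟩ := exists_sign_range_delta_zero hmaps hprim o hT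
    obtain ⟨e, he, -⟩ := exists_coh_form hε
    exact isAddTorsionFree_of_injective he
  | k + 2 => exact isAddTorsionFree_coh_of_lt o (by omega)

theorem isAddTorsionFree_coh_plane {S : Substitution 2}
    (hmaps : Set.MapsTo S.subst S.hull S.hull) (hprim : S.Primitive) (o : S.Orientation)
    {T : Set S.Tile} (hT : T ∈ S.hull) {k : ℕ} (hk : k ≠ 1) :
    IsAddTorsionFree (Coh (S.delta o T) k) := by
  match k with
  | 0 => exact isAddTorsionFree_coh_zero
  | 2 =>
    obtain ⟨e, he, -⟩ := exists_coh_form (δ := S.delta o T) (k := 1)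
      (mem_range_delta_one_iff hmaps hprim o hT)
    exact isAddTorsionFree_of_injective he
  | k + 3 => exact isAddTorsionFree_coh_of_lt o (by omega)

end Substitution

end SubstTiling

open SubstTiling SubstTiling.Substitution in
theorem corollaryc {d : ℕ} (hd : d = 1 ∨ d = 2) (S : SubstTiling.Substitution d)
    (hmaps : Set.MapsTo S.subst S.hull S.hull) (hinj : Set.InjOn S.subst S.hull)
    (hprim : S.Primitive) (hflc : S.FLC)
    (T : Set S.Tile) (hT : T ∈ S.hull) (o : S.Orientation) (H : S.Homotopy T) :
    -- there are finitely many stable cells, the coboundary maps form a cochain complex `C_S`,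
    -- and the connecting maps form a cochain map `W`
    (∀ k, Finite (S.StableCell T k)) ∧
    (∀ k, S.delta o T (k + 1) ∘ₗ S.delta o T k = 0) ∧
    ∃ hW : SubstTiling.IsCochainMap (S.delta o T) (S.W o H),
      -- the direct sum decomposition, and the movement of torsion from level `k + 1` to level `k`
      (∀ k, Nonempty (SubstTiling.Hml (S.delta o T) k ≃+
          SubstTiling.Ext1 (SubstTiling.Coh (S.delta o T) (k + 1)) ×
            (SubstTiling.Coh (S.delta o T) k →+ ℤ)) ∧
        Nonempty (AddCommGroup.torsion (SubstTiling.Hml (S.delta o T) k) ≃+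
          AddCommGroup.torsion (SubstTiling.Coh (S.delta o T) (k + 1)))) ∧
      -- `H^{S-tor}_k` is a torsion group, and `H^{ST-torFree}_k` is torsion free
      (∀ k, IsAddTorsion (SubstTiling.Lim (SubstTiling.ext1Map (SubstTiling.cohMap hW k)))) ∧
      (∀ k, IsAddTorsionFree (SubstTiling.Lim (SubstTiling.homMap (SubstTiling.cohMap hW k)))) ∧
      -- the short exact sequences before and after passing to the direct limit
      (∀ k, ∃ (i : SubstTiling.Ext1 (SubstTiling.Coh (S.delta o T) (k + 1)) →+
            SubstTiling.Hml (S.delta o T) k)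
          (p : SubstTiling.Hml (S.delta o T) k →+ (SubstTiling.Coh (S.delta o T) k →+ ℤ)),
        (∀ (g : SubstTiling.cycles (S.delta o T) k) (z : LinearMap.ker (S.delta o T k)),
          p (Submodule.Quotient.mk g) (Submodule.Quotient.mk z) =
            z.1.sum fun c a => a * g.1 c) ∧
        (∀ x, i (SubstTiling.ext1Map (SubstTiling.cohMap hW (k + 1)) x) =
          SubstTiling.hmlMap hW k (i x)) ∧
        Function.Injective i ∧ Function.Exact i p ∧ Function.Surjective p ∧
        ∃ (I : SubstTiling.Lim (SubstTiling.ext1Map (SubstTiling.cohMap hW (k + 1))) →+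
              SubstTiling.Lim (SubstTiling.hmlMap hW k))
            (P : SubstTiling.Lim (SubstTiling.hmlMap hW k) →+
              SubstTiling.Lim (SubstTiling.homMap (SubstTiling.cohMap hW k))),
          (∀ n x, I (SubstTiling.Lim.of _ n x) = SubstTiling.Lim.of _ n (i x)) ∧
          (∀ n x, P (SubstTiling.Lim.of _ n x) = SubstTiling.Lim.of _ n (p x)) ∧
          Function.Injective I ∧ Function.Exact I P ∧ Function.Surjective P) ∧
      -- dimension one: no torsion at all, before or after passing to the direct limit
      (d = 1 → ∀ k,
        IsAddTorsionFree (SubstTiling.Coh (S.delta o T) k) ∧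
        IsAddTorsionFree (SubstTiling.Hml (S.delta o T) k) ∧
        IsAddTorsionFree (SubstTiling.Lim (SubstTiling.cohMap hW k)) ∧
        IsAddTorsionFree (SubstTiling.Lim (SubstTiling.hmlMap hW k))) ∧
      -- dimension two: torsion can only occur in `H^1_S` and in `H^{ST}_0`
      (d = 2 →
        (∀ k, k ≠ 1 → IsAddTorsionFree (SubstTiling.Lim (SubstTiling.cohMap hW k))) ∧
        (∀ k, k ≠ 0 → IsAddTorsionFree (SubstTiling.Lim (SubstTiling.hmlMap hW k))) ∧
        Nonempty (SubstTiling.Lim (SubstTiling.cohMap hW 2) ≃+ ℤ) ∧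
        Nonempty (SubstTiling.Lim (SubstTiling.hmlMap hW 2) ≃+ ℤ)) := by
  have hfin : ∀ k, Finite (S.StableCell T k) := fun k => finite_stableCell (by omega) hflc hT k
  have hδ := delta_comp_delta hd hmaps hprim o hT
  have hW := isCochainMap_W hd hmaps hprim o hT H
  refine ⟨hfin, hδ, hW, fun k => ?_, fun k => Lim.isAddTorsion _ (nonempty_ext1_equiv_torsion _).2,
    fun k => Lim.isAddTorsionFree _, fun k => ?_, ?_, ?_⟩
  · obtain ⟨i, p, -, -, hi, hip, hp⟩ := exists_sequence hδ hW k
    obtain ⟨⟨e⟩, htor⟩ := nonempty_ext1_equiv_torsion (Coh (S.delta o T) (k + 1))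
    obtain ⟨e'⟩ := nonempty_equiv_torsion hi hip htor
    exact ⟨nonempty_equiv_prod hi hip hp, ⟨e'.symm.trans e⟩⟩
  · obtain ⟨i, p, hpe, hie, hi, hip, hp⟩ := exists_sequence hδ hW k
    exact ⟨i, p, fun g z => DFunLike.congr_fun (hpe g) (Submodule.Quotient.mk z), hie, hi, hip, hp,
      Lim.exists_exact hie (eval_hmlMap hW hpe) hi hip hp⟩
  · rintro rfl k
    have hcoh := isAddTorsionFree_coh_line hmaps hprim o hT
    have hk := hcoh k
    have hhml := isAddTorsionFree_hml hδ hW (hcoh (k + 1))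
    exact ⟨hk, hhml, Lim.isAddTorsionFree _, Lim.isAddTorsionFree _⟩
  · rintro rfl
    have hcoh : ∀ k, k ≠ 1 → IsAddTorsionFree (Coh (S.delta o T) k) := fun k hk =>
      isAddTorsionFree_coh_plane hmaps hprim o hT hk
    have hne : Nonempty (S.StableCell T 2) := nonempty_stableCell hT.1
    obtain ⟨h₁, h₂⟩ := nonempty_lim_equiv_int (k := 1) hδ hW (stableCell_isEmpty T (by omega))
      (mem_range_delta_one_iff hmaps hprim o hT) (linearCombination_W hmaps hprim o hT H)
    refine ⟨fun k hk => ?_, fun k hk => ?_, h₁, h₂⟩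
    · have := hcoh k hk
      exact Lim.isAddTorsionFree _
    -- Torsion in homological degree k comes from cohomological degree k + 1, and k ≠ 0 excludes the
    -- exceptional degree 1.
    · have := isAddTorsionFree_hml hδ hW (hcoh (k + 1) (by omega))
      exact Lim.isAddTorsionFree _
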